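/- Let $\mathcal{C}$ be a rigid C$^*$-tensor category, i.e. a C$^*$-tensor category with finite direct sums and subobjects that is semisimple, has irreducible tensor unit $\varepsilon$, and in which every object $\alpha$ has a conjugate $\overline{\alpha}$ that is both a left and a right dual. Write $\operatorname{Mor}(\alpha,\beta)$ for the morphisms from $\beta$ to $\alpha$. Let $\operatorname{Irr}(\mathcal{C})$ be the set of isomorphism classes of irreducible objects, let $d(\alpha)=s_\alpha^* s_\alpha$ be the categorical dimension, where $s_\alpha\in\operatorname{Mor}(\alpha\otimes\overline\alpha,\varepsilon)$, $t_\alpha\in\operatorname{Mor}(\overline\alpha\otimes\alpha,\varepsilon)$ is a solution of the conjugate equations that is standard, i.e. $s_\alpha^*(X\otimes 1)s_\alpha=t_\alpha^*(1\otimes X)t_\alpha$ for all $X\in\operatorname{End}(\alpha)$, and let $\operatorname{mult}(\gamma,\alpha)$ be the multiplicity of $\gamma\in\operatorname{Irr}(\mathcal{C})$ in $\alpha$. The fusion $*$-algebra $\mathbb{C}[\mathcal{C}]$ has vector space basis $\operatorname{Irr}(\mathcal{C})$, product $\alpha\beta=\sum_\gamma\operatorname{mult}(\gamma,\alpha\otimes\beta)\,\gamma$,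 unit $\varepsilon$ and involution $\alpha^*=\overline{\alpha}$; an arbitrary object $\alpha$ defines the element $\sum_\gamma \operatorname{mult}(\gamma,\alpha)\,\gamma$ of $\mathbb{C}[\mathcal{C}]$, still denoted $\alpha$. A multiplier on $\mathcal{C}$ is a family of linear maps $\theta_{\alpha,\beta}:\operatorname{End}(\alpha\otimes\beta)\to\operatorname{End}(\alpha\otimes\beta)$, $\alpha,\beta\in\mathcal{C}$, with $\theta_{\alpha_2,\beta_2}(UXV^*)=U\theta_{\alpha_1,\beta_1}(X)V^*$ and $\theta_{\alpha_2\otimes\alpha_1,\beta_1\otimes\beta_2}(1\otimes X\otimes 1)=1\otimes\theta_{\alpha_1,\beta_1}(X)\otimes 1$ for all $X\in\operatorname{End}(\alpha_1\otimes\beta_1)$ and $U,V\in\operatorname{Mor}(\alpha_2,\alpha_1)\otimes\operatorname{Mor}(\beta_2,\beta_1)$. It extends uniquely to linear maps on all spaces $\operatorname{Mor}(\alpha\otimes\beta,\gamma\otimes\delta)$ compatible with composition with morphisms of the form $f\otimes g$, and it is determined by the function $\varphi:\operatorname{Irr}(\mathcal{C})\to\mathbb{C}$ such that it acts on $\operatorname{Mor}(\alpha\otimes\overline\alpha,\varepsilon\otimes\varepsilon)$,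 $\alpha\in\operatorname{Irr}(\mathcal{C})$, as multiplication by $\varphi(\alpha)$. A function $\varphi$ is called a cp-multiplier if it arises in this way from a multiplier all of whose maps $\theta_{\alpha,\beta}$ are completely positive. A $*$-representation $\Theta:\mathbb{C}[\mathcal{C}]\to B(\mathcal{K})$ on a Hilbert space is called admissible if $\alpha\mapsto d(\alpha)^{-1}\langle\Theta(\alpha)\xi,\xi\rangle$ is a cp-multiplier for every $\xi\in\mathcal{K}$. Then for each $x\in\mathbb{C}[\mathcal{C}]$ the norms $\|\Theta(x)\|$, with $\Theta$ admissible, are bounded, so that the completion $C_u(\mathcal{C})$ of $\mathbb{C}[\mathcal{C}]$ in a universal admissible $*$-representation is defined; and there is a unique $*$-representation $\Theta_0:\mathbb{C}[\mathcal{C}]\to B(\ell^2(\operatorname{Irr}(\mathcal{C})))$ (the regular representation) with $\Theta_0(\alpha)\delta_\beta=\sum_\gamma\operatorname{mult}(\gamma,\alpha\otimes\beta)\,\delta_\gamma$ for all $\alpha,\beta\in\operatorname{Irr}(\mathcal{C})$, and it is admissible. Let $C_r(\mathcal{C})$ be the norm closure of $\Theta_0(\mathbb{C}[\mathcal{C}])$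 and let $\epsilon:\mathbb{C}[\mathcal{C}]\to\mathbb{C}$ be the trivial representation, the linear map with $\epsilon(\alpha)=d(\alpha)$ for $\alpha\in\operatorname{Irr}(\mathcal{C})$. The following conditions are equivalent. 1. $\mathcal{C}$ is amenable: there is a net of finitely supported cp-multipliers $\varphi_n:\operatorname{Irr}(\mathcal{C})\to\mathbb{C}$ that converges to $1$ pointwise. 2. The natural $*$-homomorphism $C_u(\mathcal{C})\to C_r(\mathcal{C})$ is an isomorphism. 3. $|\epsilon(x)|\le\|\Theta_0(x)\|$ for all $x\in\mathbb{C}[\mathcal{C}]$. 4. $\|\Theta_0(\alpha)\|=d(\alpha)$ for all objects $\alpha\in\mathcal{C}$. -/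

import Mathlib

open CategoryTheory MonoidalCategory
open scoped ENNReal

universe v u

noncomputable section

/-- A C*-tensor category: a `ℂ`-linear monoidal category (with `ℂ`-bilinear tensor product of
morphisms) whose morphism spaces are Banach spaces, with an antilinear, involutive, contravariant
operation `dagger` that is the identity on objects, such that the C*-identity holds, `f* f` is a
positive element of the endomorphism algebra, tensoring is compatible with `dagger` and the
structure isomorphisms are unitary. With Mathlib's order of composition, the operator product
`g f` is `f ≫ g`; so `f* f` is `f ≫ dagger f`. -/
class CStarTensorCategory (C : Type u) [Category.{v} C] [Preadditive C] [Linear ℂ C]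
    [MonoidalCategory C] [MonoidalPreadditive C] [MonoidalLinear ℂ C] where
  /-- The adjoint of a morphism. -/
  dagger : ∀ {X Y : C}, (X ⟶ Y) → (Y ⟶ X)
  dagger_dagger : ∀ {X Y : C} (f : X ⟶ Y), dagger (dagger f) = f
  dagger_id : ∀ X : C, dagger (𝟙 X) = 𝟙 X
  dagger_comp : ∀ {X Y Z : C} (f : X ⟶ Y) (g : Y ⟶ Z), dagger (f ≫ g) = dagger g ≫ dagger f
  dagger_add : ∀ {X Y : C} (f g : X ⟶ Y), dagger (f + g) = dagger f + dagger g
  dagger_smul : ∀ {X Y : C} (c : ℂ) (f : X ⟶ Y), dagger (c • f) = star c • dagger f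
  /-- The norm on morphism spaces. -/
  homNorm : ∀ X Y : C, AddGroupNorm (X ⟶ Y)
  homNorm_smul : ∀ {X Y : C} (c : ℂ) (f : X ⟶ Y), homNorm X Y (c • f) = ‖c‖ * homNorm X Y f
  homNorm_complete : ∀ {X Y : C} (f : ℕ → (X ⟶ Y)),
    (∀ r : ℝ, 0 < r → ∃ N, ∀ m ≥ N, ∀ n ≥ N, homNorm X Y (f m - f n) < r) →
      ∃ g : X ⟶ Y, ∀ r : ℝ, 0 < r → ∃ N, ∀ n ≥ N, homNorm X Y (f n - g) < r
  homNorm_comp_le : ∀ {X Y Z : C} (f : X ⟶ Y) (g : Y ⟶ Z),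
    homNorm X Z (f ≫ g) ≤ homNorm X Y f * homNorm Y Z g
  homNorm_comp_dagger : ∀ {X Y : C} (f : X ⟶ Y),
    homNorm X X (f ≫ dagger f) = homNorm X Y f ^ 2
  comp_dagger_positive : ∀ {X Y : C} (f : X ⟶ Y), ∃ g : X ⟶ X, f ≫ dagger f = g ≫ dagger g
  dagger_tensor : ∀ {X₁ Y₁ X₂ Y₂ : C} (f : X₁ ⟶ Y₁) (g : X₂ ⟶ Y₂),
    dagger (f ⊗ₘ g) = dagger f ⊗ₘ dagger g
  dagger_associator : ∀ X Y Z : C, dagger (α_ X Y Z).hom = (α_ X Y Z).inv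
  dagger_leftUnitor : ∀ X : C, dagger (λ_ X).hom = (λ_ X).inv
  dagger_rightUnitor : ∀ X : C, dagger (ρ_ X).hom = (ρ_ X).inv

namespace CStarTensor

open CStarTensorCategory

section Basic

variable {C : Type u} [Category.{v} C] [Preadditive C] [Linear ℂ C]

/-- An object is irreducible if its endomorphism algebra is `ℂ`. -/
def IsIrreducible (X : C) : Prop := Module.finrank ℂ (X ⟶ X) = 1

end Basic

end CStarTensor

open CStarTensorCategory in
/-- A rigid C*-tensor category: a C*-tensor category with (unitary) finite direct sums and
subobjects, that is semisimple, with irreducible tensor unit, and such that every object has a dual.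
The two morphisms of `ExactPairing X Y` are `s : 𝟙 ⟶ X ⊗ Y` and `t* : Y ⊗ X ⟶ 𝟙`, where
`(s, t)` solves the conjugate equations; taking adjoints, `Y` is both a left and a right dual. -/
class RigidCStarTensorCategory (C : Type u) [Category.{v} C] [Preadditive C] [Linear ℂ C]
    [MonoidalCategory C] [MonoidalPreadditive C] [MonoidalLinear ℂ C]
    [CStarTensorCategory C] : Prop where
  exists_directSum : ∀ X Y : C, ∃ (Z : C) (p : X ⟶ Z) (q : Y ⟶ Z),
    p ≫ dagger p = 𝟙 X ∧ q ≫ dagger q = 𝟙 Y ∧ p ≫ dagger q = 0 ∧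
      dagger p ≫ p + dagger q ≫ q = 𝟙 Z
  exists_subobject : ∀ (X : C) (e : X ⟶ X), e ≫ e = e → dagger e = e →
    ∃ (Y : C) (p : Y ⟶ X), p ≫ dagger p = 𝟙 Y ∧ dagger p ≫ p = e
  semisimple : ∀ X : C, ∃ (n : ℕ) (S : Fin n → C) (p : ∀ i, S i ⟶ X),
    (∀ i, CStarTensor.IsIrreducible (S i)) ∧ (∀ i, p i ≫ dagger (p i) = 𝟙 (S i)) ∧
      (∀ i j, i ≠ j → p i ≫ dagger (p j) = 0) ∧ ∑ i, dagger (p i) ≫ p i = 𝟙 X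
  unit_irreducible : CStarTensor.IsIrreducible (𝟙_ C)
  exists_dual : ∀ X : C, ∃ Y : C, Nonempty (ExactPairing X Y)

namespace CStarTensor

open CStarTensorCategory

section Irr

variable (C : Type u) [Category.{v} C] [Preadditive C] [Linear ℂ C]

/-- Isomorphism of irreducible objects. -/
def irrSetoid : Setoid {X : C // IsIrreducible X} where
  r X Y := Nonempty (X.1 ≅ Y.1)
  iseqv := ⟨fun X => ⟨Iso.refl X.1⟩, fun ⟨e⟩ => ⟨e.symm⟩, fun ⟨e⟩ ⟨f⟩ => ⟨e.trans f⟩⟩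

/-- The set of isomorphism classes of irreducible objects. -/
def Irr : Type u := Quotient (irrSetoid C)

variable {C}

/-- The class of an irreducible object. -/
def Irr.mk (X : C) (hX : IsIrreducible X) : Irr C := Quotient.mk (irrSetoid C) ⟨X, hX⟩

/-- A representative of a class. -/
def Irr.obj (a : Irr C) : C := (Quotient.out (s := irrSetoid C) a).1

theorem Irr.obj_irreducible (a : Irr C) : IsIrreducible a.obj :=
  (Quotient.out (s := irrSetoid C) a).2

theorem Irr.eq_mk_of_iso (a : Irr C) {X : C} (hX : IsIrreducible X) (e : a.obj ≅ X) :
    a = Irr.mk X hX := by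
  have h : Quotient.mk (irrSetoid C) (Quotient.out (s := irrSetoid C) a) = Irr.mk X hX :=
    Quotient.sound (s := irrSetoid C) ⟨e⟩
  exact (Quotient.out_eq (s := irrSetoid C) a).symm.trans h

/-- The multiplicity of an irreducible object in an arbitrary object. -/
def mult (c : Irr C) (X : C) : ℕ := Module.finrank ℂ (c.obj ⟶ X)

theorem IsIrreducible.id_ne_zero {X : C} (hX : IsIrreducible X) : 𝟙 X ≠ 0 := by
  intro h
  have : Subsingleton (X ⟶ X) :=
    ⟨fun f g => by rw [← Category.comp_id f, ← Category.comp_id g, h]; simp⟩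
  have h0 : Module.finrank ℂ (X ⟶ X) = 0 := Module.finrank_zero_of_subsingleton
  rw [IsIrreducible, h0] at hX
  exact zero_ne_one hX

theorem IsIrreducible.exists_smul_id {X : C} (hX : IsIrreducible X) (f : X ⟶ X) :
    ∃ c : ℂ, f = c • 𝟙 X := by
  obtain ⟨c, hc⟩ := (finrank_eq_one_iff_of_nonzero' (𝟙 X) hX.id_ne_zero).1 hX f
  exact ⟨c, hc.symm⟩

end Irr

section Main

variable {C : Type u} [Category.{v} C] [Preadditive C] [Linear ℂ C]
  [MonoidalCategory C] [MonoidalPreadditive C] [MonoidalLinear ℂ C] [CStarTensorCategory C]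

/-- Schur's lemma. -/
theorem IsIrreducible.nonempty_iso {X Y : C} (hX : IsIrreducible X) (hY : IsIrreducible Y)
    (f : X ⟶ Y) (hf : f ≠ 0) : Nonempty (X ≅ Y) := by
  obtain ⟨a, ha⟩ := hX.exists_smul_id (f ≫ dagger f)
  obtain ⟨b, hb⟩ := hY.exists_smul_id (dagger f ≫ f)
  have h1 : a • f = b • f := by
    have h := Category.assoc f (dagger f) f
    rw [ha, hb] at h
    simpa using h
  have ha0 : a ≠ 0 := by
    rintro rfl
    have h := homNorm_comp_dagger f
    rw [ha, zero_smul, map_zero] at h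
    exact hf (eq_zero_of_map_eq_zero (homNorm X Y) (pow_eq_zero_iff two_ne_zero |>.1 h.symm))
  have hab : a = b := by
    by_contra hne
    have h2 : (a - b) • f = 0 := by rw [sub_smul, h1, sub_self]
    apply hf
    rw [← one_smul ℂ f, ← inv_mul_cancel₀ (sub_ne_zero.2 hne), mul_smul, h2, smul_zero]
  refine ⟨⟨f, a⁻¹ • dagger f, ?_, ?_⟩⟩
  · rw [Linear.comp_smul, ha, smul_smul, inv_mul_cancel₀ ha0, one_smul]
  · rw [Linear.smul_comp, hb, ← hab, smul_smul, inv_mul_cancel₀ ha0, one_smul]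

variable [RigidCStarTensorCategory C]

theorem mult_support_finite (X : C) :
    (Function.support fun c : Irr C => (mult c X : ℂ)).Finite := by
  obtain ⟨n, S, p, hS, -, -, hp⟩ := RigidCStarTensorCategory.semisimple X
  refine (Set.finite_range fun i => Irr.mk (S i) (hS i)).subset ?_
  intro c hc
  have hc' : Module.finrank ℂ (c.obj ⟶ X) ≠ 0 := by simpa [mult] using hc
  have : Nontrivial (c.obj ⟶ X) := Module.nontrivial_of_finrank_pos (Nat.pos_of_ne_zero hc')
  obtain ⟨f, hf⟩ := exists_ne (0 : c.obj ⟶ X)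
  have : ∃ i, f ≫ dagger (p i) ≠ 0 := by
    by_contra! h
    apply hf
    rw [← Category.comp_id f, ← hp, Preadditive.comp_sum]
    refine Finset.sum_eq_zero fun i _ => ?_
    rw [← Category.assoc, h i, Limits.zero_comp]
  obtain ⟨i, hi⟩ := this
  obtain ⟨e⟩ := c.obj_irreducible.nonempty_iso (hS i) _ hi
  exact ⟨i, (c.eq_mk_of_iso (hS i) e).symm⟩

variable (C)

/-- The underlying vector space of the fusion *-algebra `ℂ[C]`, with basis `Irr C`. -/
def FusionAlgebra : Type u := Irr C →₀ ℂ

instance : AddCommGroup (FusionAlgebra C) := inferInstanceAs (AddCommGroup (Irr C →₀ ℂ))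

instance : Module ℂ (FusionAlgebra C) := inferInstanceAs (Module ℂ (Irr C →₀ ℂ))

variable {C}

/-- The basis element of the fusion algebra given by a class of irreducible objects. -/
def basisElt (a : Irr C) : FusionAlgebra C := Finsupp.single a (1 : ℂ)

/-- The element `∑ γ, mult(γ, X) γ` of the fusion algebra given by an arbitrary object `X`. -/
def objClass (X : C) : FusionAlgebra C :=
  Finsupp.ofSupportFinite (fun c : Irr C => (mult c X : ℂ)) (mult_support_finite X)

/-- A choice of dual (conjugate) object. -/
def conj (X : C) : C := (RigidCStarTensorCategory.exists_dual X).choose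

/-- The product of the fusion algebra: bilinear, with `α β = ∑ γ, mult(γ, α ⊗ β) γ`. -/
instance : Mul (FusionAlgebra C) where
  mul x y := Finsupp.sum (show Irr C →₀ ℂ from x) fun a r =>
    Finsupp.sum (show Irr C →₀ ℂ from y) fun b r' => (r * r') • objClass (a.obj ⊗ b.obj)

/-- The unit of the fusion algebra: the class of the tensor unit. -/
instance : One (FusionAlgebra C) where
  one := basisElt (Irr.mk (𝟙_ C) RigidCStarTensorCategory.unit_irreducible)

/-- The involution of the fusion algebra: antilinear, sending `α` to its conjugate. -/
instance : Star (FusionAlgebra C) where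
  star x := Finsupp.sum (show Irr C →₀ ℂ from x) fun a r => star r • objClass (conj a.obj)

/-- `p`, that is `s = η_ X Y : 𝟙 ⟶ X ⊗ Y` and `t = (ε_ X Y)* : 𝟙 ⟶ Y ⊗ X`, is a standard solution
of the conjugate equations: `s* (f ⊗ 1) s = t* (1 ⊗ f) t` for all endomorphisms `f` of `X`. -/
def IsStandard {X Y : C} (p : ExactPairing X Y) : Prop :=
  ∀ f : X ⟶ X,
    p.coevaluation' ≫ f ▷ Y ≫ dagger p.coevaluation' =
      dagger p.evaluation' ≫ Y ◁ f ≫ p.evaluation'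

/-- The categorical dimension `d(X)`: the number `s* s`, for any standard solution `(s, t)` of the
conjugate equations for `X` (the value does not depend on the choice). -/
def catDim (X : C) : ℝ :=
  Classical.epsilon fun r : ℝ => ∃ (Y : C) (p : ExactPairing X Y), IsStandard p ∧
    p.coevaluation' ≫ dagger p.coevaluation' = (r : ℂ) • 𝟙 (𝟙_ C)

/-- For `T ∈ End(X₁ ⊗ Y₁)`, the endomorphism `1 ⊗ T ⊗ 1` of `(X₂ ⊗ X₁) ⊗ (Y₁ ⊗ Y₂)`. -/
def amplify (X₂ Y₂ : C) {X₁ Y₁ : C} (T : X₁ ⊗ Y₁ ⟶ X₁ ⊗ Y₁) :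
    (X₂ ⊗ X₁) ⊗ (Y₁ ⊗ Y₂) ⟶ (X₂ ⊗ X₁) ⊗ (Y₁ ⊗ Y₂) :=
  (α_ X₂ X₁ (Y₁ ⊗ Y₂)).hom ≫
    X₂ ◁ ((α_ X₁ Y₁ Y₂).inv ≫ T ▷ Y₂ ≫ (α_ X₁ Y₁ Y₂).hom) ≫ (α_ X₂ X₁ (Y₁ ⊗ Y₂)).inv

variable (C)

/-- A multiplier on `C`. By linearity it suffices to require the first compatibility for elementary
tensors `f ⊗ g`, `h ⊗ k`. -/
structure Multiplier where
  map : ∀ X Y : C, (X ⊗ Y ⟶ X ⊗ Y) →ₗ[ℂ] (X ⊗ Y ⟶ X ⊗ Y)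
  map_comp : ∀ {X₁ X₂ Y₁ Y₂ : C} (f : X₁ ⟶ X₂) (g : Y₁ ⟶ Y₂) (h : X₂ ⟶ X₁) (k : Y₂ ⟶ Y₁)
    (T : X₁ ⊗ Y₁ ⟶ X₁ ⊗ Y₁),
    map X₂ Y₂ ((h ⊗ₘ k) ≫ T ≫ (f ⊗ₘ g)) = (h ⊗ₘ k) ≫ map X₁ Y₁ T ≫ (f ⊗ₘ g)
  map_amplify : ∀ {X₁ Y₁ : C} (X₂ Y₂ : C) (T : X₁ ⊗ Y₁ ⟶ X₁ ⊗ Y₁),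
    map (X₂ ⊗ X₁) (Y₁ ⊗ Y₂) (amplify X₂ Y₂ T) = amplify X₂ Y₂ (map X₁ Y₁ T)

variable {C}

/-- A linear map `θ` on `End(Z)` is completely positive: for all `n` and every `n × n` matrix `a`
over `End(Z)`, the matrix obtained by applying `θ` entrywise to `a* a` is of the form `b* b`. -/
def IsCompletelyPositive {Z : C} (θ : (Z ⟶ Z) →ₗ[ℂ] (Z ⟶ Z)) : Prop :=
  ∀ (n : ℕ) (a : Fin n → Fin n → (Z ⟶ Z)), ∃ b : Fin n → Fin n → (Z ⟶ Z),
    ∀ i j, θ (∑ k, a k j ≫ dagger (a k i)) = ∑ k, b k j ≫ dagger (b k i)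

/-- The multiplier is of positive type. -/
def Multiplier.IsPositiveType (θ : Multiplier C) : Prop :=
  ∀ X Y : C, IsCompletelyPositive (θ.map X Y)

/-- An extension of a multiplier to all morphism spaces `Z ⊗ W ⟶ X ⊗ Y` (it exists and is unique). -/
structure Multiplier.Extension (θ : Multiplier C) where
  map : ∀ X Y Z W : C, (Z ⊗ W ⟶ X ⊗ Y) →ₗ[ℂ] (Z ⊗ W ⟶ X ⊗ Y)
  map_self : ∀ X Y : C, map X Y X Y = θ.map X Y
  map_comp : ∀ {X₁ X₂ Y₁ Y₂ Z₁ Z₂ W₁ W₂ : C} (f : X₁ ⟶ X₂) (g : Y₁ ⟶ Y₂)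
    (h : Z₂ ⟶ Z₁) (k : W₂ ⟶ W₁) (T : Z₁ ⊗ W₁ ⟶ X₁ ⊗ Y₁),
    map X₂ Y₂ Z₂ W₂ ((h ⊗ₘ k) ≫ T ≫ (f ⊗ₘ g)) = (h ⊗ₘ k) ≫ map X₁ Y₁ Z₁ W₁ T ≫ (f ⊗ₘ g)

/-- The multiplier `θ` is the one given by the function `φ` on `Irr C`: for irreducible `X` with
conjugate `Y`, it acts on the morphisms `𝟙 ⊗ 𝟙 ⟶ X ⊗ Y` as multiplication by `φ(X)`. -/
def Multiplier.HasSymbol (θ : Multiplier C) (φ : Irr C → ℂ) : Prop :=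
  ∃ E : θ.Extension, ∀ (X Y : C) (hX : IsIrreducible X) (_ : ExactPairing X Y)
    (w : 𝟙_ C ⊗ 𝟙_ C ⟶ X ⊗ Y), E.map X Y (𝟙_ C) (𝟙_ C) w = φ (Irr.mk X hX) • w

/-- The function `φ : Irr C → ℂ` is a cp-multiplier. -/
def IsCpMultiplier (φ : Irr C → ℂ) : Prop :=
  ∃ θ : Multiplier C, θ.HasSymbol φ ∧ θ.IsPositiveType

variable (C)

/-- Amenability: there is a net of finitely supported cp-multipliers converging to `1` pointwise. -/
def IsAmenable : Prop :=
  ∃ (ι : Type u) (_ : Preorder ι) (_ : IsDirectedOrder ι) (_ : Nonempty ι) (φ : ι → Irr C → ℂ),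
    (∀ i, (Function.support (φ i)).Finite ∧ IsCpMultiplier (φ i)) ∧
      ∀ a : Irr C, Filter.Tendsto (fun i => φ i a) Filter.atTop (nhds 1)

/-- A *-representation of the fusion *-algebra on a Hilbert space. -/
structure StarRep (K : Type*) [NormedAddCommGroup K] [InnerProductSpace ℂ K] [CompleteSpace K]
    extends FusionAlgebra C →ₗ[ℂ] (K →L[ℂ] K) where
  map_one' : toFun 1 = 1
  map_mul' : ∀ x y, toFun (x * y) = toFun x * toFun y
  map_star' : ∀ x, toFun (star x) = star (toFun x)

variable {C}

instance {K : Type*} [NormedAddCommGroup K] [InnerProductSpace ℂ K] [CompleteSpace K] :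
    CoeFun (StarRep C K) fun _ => FusionAlgebra C → (K →L[ℂ] K) := ⟨fun Θ => Θ.toFun⟩

/-- Admissibility: all functions `α ↦ d(α)⁻¹ ⟨Θ(α) ξ, ξ⟩` are cp-multipliers (Mathlib's inner product
is linear in the second variable). -/
def StarRep.IsAdmissible {K : Type*} [NormedAddCommGroup K] [InnerProductSpace ℂ K]
    [CompleteSpace K] (Θ : StarRep C K) : Prop :=
  ∀ ξ : K, IsCpMultiplier fun a : Irr C =>
    ((catDim a.obj : ℝ) : ℂ)⁻¹ * inner ℂ ξ (Θ (basisElt a) ξ)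

/-- The *-algebra `Θ(ℂ[C])`. -/
def StarRep.range {K : Type*} [NormedAddCommGroup K] [InnerProductSpace ℂ K]
    [CompleteSpace K] (Θ : StarRep C K) : StarSubalgebra ℂ (K →L[ℂ] K) where
  carrier := Set.range Θ
  mul_mem' := by
    rintro _ _ ⟨x, rfl⟩ ⟨y, rfl⟩
    exact ⟨x * y, Θ.map_mul' x y⟩
  add_mem' := by
    rintro _ _ ⟨x, rfl⟩ ⟨y, rfl⟩
    exact ⟨x + y, Θ.map_add' x y⟩
  algebraMap_mem' r := ⟨r • 1, by
    rw [Algebra.algebraMap_eq_smul_one, ← Θ.map_one']; exact Θ.map_smul' r 1⟩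
  star_mem' := by
    rintro _ ⟨x, rfl⟩
    exact ⟨star x, Θ.map_star' x⟩

/-- The C*-algebra generated by a *-representation, the norm closure of `Θ(ℂ[C])`. -/
abbrev StarRep.cstar {K : Type*} [NormedAddCommGroup K] [InnerProductSpace ℂ K]
    [CompleteSpace K] (Θ : StarRep C K) : StarSubalgebra ℂ (K →L[ℂ] K) :=
  Θ.range.topologicalClosure

variable (C)

/-- The collection of all admissible *-representations on nonzero Hilbert spaces in the universe of
the objects of `C`. Cyclic representations are separated completions of `ℂ[C]`, so up to unitary
equivalence every cyclic admissible representation occurs here. -/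
structure AdmissibleRep where
  K : Type u
  [normedAddCommGroup : NormedAddCommGroup K]
  [innerProductSpace : InnerProductSpace ℂ K]
  [completeSpace : CompleteSpace K]
  [nontrivial : Nontrivial K]
  rep : StarRep C K
  admissible : rep.IsAdmissible

attribute [instance] AdmissibleRep.normedAddCommGroup AdmissibleRep.innerProductSpace
  AdmissibleRep.completeSpace AdmissibleRep.nontrivial

/-- The C*-algebra of bounded families of operators, acting diagonally on the direct sum of the
Hilbert spaces of all admissible *-representations. -/
abbrev AdmissibleRep.Prod : Type (u + 1) := lp (fun π : AdmissibleRep C => π.K →L[ℂ] π.K) ∞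

/-- The image of `ℂ[C]` under the universal admissible *-representation `x ↦ (π(x))_π`, where `π`
runs over all admissible *-representations. -/
def universalRange : StarSubalgebra ℂ (AdmissibleRep.Prod C) where
  carrier := {T | ∃ x : FusionAlgebra C, ∀ π : AdmissibleRep C, T π = π.rep x}
  mul_mem' := by
    rintro S T ⟨x, hx⟩ ⟨y, hy⟩
    refine ⟨x * y, fun π => ?_⟩
    rw [lp.infty_coeFn_mul, Pi.mul_apply, hx, hy]
    exact (π.rep.map_mul' x y).symm
  add_mem' := by
    rintro S T ⟨x, hx⟩ ⟨y, hy⟩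
    refine ⟨x + y, fun π => ?_⟩
    rw [lp.coeFn_add, Pi.add_apply, hx, hy]
    exact (π.rep.map_add' x y).symm
  algebraMap_mem' r := ⟨r • 1, fun π => by
    rw [Algebra.algebraMap_eq_smul_one, lp.coeFn_smul, lp.infty_coeFn_one, Pi.smul_apply,
      Pi.one_apply, ← π.rep.map_one']
    exact (π.rep.map_smul' r 1).symm⟩
  star_mem' := by
    rintro T ⟨x, hx⟩
    refine ⟨star x, fun π => ?_⟩
    rw [lp.star_apply, hx]
    exact (π.rep.map_star' x).symm

/-- The universal C*-algebra `C_u(C)`: the completion of `ℂ[C]` in the universal admissible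
*-representation. -/
abbrev universalCStar : StarSubalgebra ℂ (AdmissibleRep.Prod C) :=
  (universalRange C).topologicalClosure

variable {C}

/-- Evaluation at one admissible *-representation. -/
def evalHom (π : AdmissibleRep C) : AdmissibleRep.Prod C →⋆ₐ[ℂ] (π.K →L[ℂ] π.K) where
  toFun T := T π
  map_one' := by rw [lp.infty_coeFn_one, Pi.one_apply]
  map_mul' S T := by rw [lp.infty_coeFn_mul, Pi.mul_apply]
  map_zero' := by rw [lp.coeFn_zero, Pi.zero_apply]
  map_add' S T := by rw [lp.coeFn_add, Pi.add_apply]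
  commutes' r := by
    rw [Algebra.algebraMap_eq_smul_one, lp.coeFn_smul, lp.infty_coeFn_one, Pi.smul_apply,
      Pi.one_apply, Algebra.algebraMap_eq_smul_one]
  map_star' T := lp.star_apply T π

theorem evalHom_mem (π : AdmissibleRep C) (T : universalCStar C) :
    evalHom π (T : AdmissibleRep.Prod C) ∈ π.rep.cstar := by
  have hcont : Continuous (evalHom π) :=
    (lp.evalCLM ℂ (fun π : AdmissibleRep C => π.K →L[ℂ] π.K) ∞ π).continuous
  have hT : (T : AdmissibleRep.Prod C) ∈ closure (universalRange C : Set (AdmissibleRep.Prod C)) :=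
    T.2
  have hmaps : Set.MapsTo (evalHom π) (universalRange C : Set (AdmissibleRep.Prod C))
      (π.rep.range : Set (π.K →L[ℂ] π.K)) := by
    rintro S ⟨x, hx⟩
    exact ⟨x, (hx π).symm⟩
  exact map_mem_closure hcont hT hmaps

/-- The natural *-homomorphism from `C_u(C)` to the C*-algebra generated by an admissible
*-representation `π`; it maps `(π'(x))_π'` to `π(x)` for `x ∈ ℂ[C]`. -/
def naturalHom (π : AdmissibleRep C) : universalCStar C →⋆ₐ[ℂ] π.rep.cstar :=
  ((evalHom π).comp (universalCStar C).subtype).codRestrict π.rep.cstar (evalHom_mem π)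

variable (C)

/-- The Hilbert space `ℓ²(Irr C)`. -/
abbrev L2Irr : Type u := lp (fun _ : Irr C => ℂ) 2

instance : Nontrivial (L2Irr C) := by
  classical
  refine ⟨lp.single 2 (Irr.mk (𝟙_ C) RigidCStarTensorCategory.unit_irreducible) (1 : ℂ), 0, ?_⟩
  intro h
  have h' := congrArg
    (fun f : L2Irr C => f (Irr.mk (𝟙_ C) RigidCStarTensorCategory.unit_irreducible)) h
  simp at h'

variable {C}

open Classical in
/-- `Θ` is the regular representation: `Θ(α) δ_β = ∑ γ, mult(γ, α ⊗ β) δ_γ`. -/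
def IsRegular (Θ : StarRep C (L2Irr C)) : Prop :=
  ∀ a b c : Irr C,
    Θ (basisElt a) (lp.single 2 b (1 : ℂ)) c = (mult c (a.obj ⊗ b.obj) : ℂ)

/-- The trivial representation `ℂ[C] → ℂ`: linear, with `α ↦ d(α)` for `α ∈ Irr C`. -/
def trivialRep (x : FusionAlgebra C) : ℂ :=
  Finsupp.sum (show Irr C →₀ ℂ from x) fun a r => r * ((catDim a.obj : ℝ) : ℂ)

end Main

end CStarTensor

end

/-! A cp-multiplier `φ` defines a positive linear functional `α ↦ d(α) φ(α)` on the fusion algebra,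
cp-multipliers are closed under products, and the vector states of the regular representation give
cp-multipliers by a trace formula on coactions `A ⟶ T ⊗ A`. If `φ` is a finitely supported
cp-multiplier and `π` is admissible, the product of `φ` with a coefficient of `π` is therefore a
positive functional of the form `x ↦ ⟨Θ₀(x) δ_ε, η⟩`, which is bounded on the regular C*-algebra; in
the limit `φ → 1` amenability gives `‖π(x)‖ ≤ ‖Θ₀(x)‖`, so that the natural homomorphism is
isometric. Its injectivity bounds the trivial representation, which is admissible, by the regular
one, and on objects this is the norm condition, since `‖Θ₀(α)‖ ≤ d(α)` always holds. Conversely,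
under the norm condition an almost norming vector of finite support for `ε + ∑ α` is by rotundity
almost invariant under each `α`, and its coefficients are finitely supported cp-multipliers close to
`1`. -/

noncomputable section

namespace CStarTensor

open CStarTensorCategory
open scoped ComplexOrder

section LinearAlgebra

variable {R V ι : Type*} [CommRing R] [AddCommGroup V] [Module R V] [Module.Free R V]
  [Module.Finite R V] [Fintype ι]

lemma trace_eq_sum_of_frame (e : ι → V) (ε : ι → V →ₗ[R] R) (h : ∀ x, ∑ i, ε i x • e i = x)
    (L : V →ₗ[R] V) : LinearMap.trace R V L = ∑ i, ε i (L (e i)) := by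
  have hL : L = ∑ i, dualTensorHom R V V (ε i ⊗ₜ L (e i)) := by
    ext x
    conv_lhs => rw [← h x]
    simp only [map_sum, map_smul, LinearMap.coe_sum, Finset.sum_apply, dualTensorHom_apply]
  conv_lhs => rw [hL]
  rw [map_sum]
  refine Finset.sum_congr rfl fun i _ => ?_
  rw [LinearMap.trace_eq_contract_apply, contractLeft_apply]

lemma trace_eq_sum_trace {W : ι → Type*} [∀ i, AddCommGroup (W i)] [∀ i, Module R (W i)]
    [∀ i, Module.Free R (W i)] [∀ i, Module.Finite R (W i)]
    (A : ∀ i, W i →ₗ[R] V) (B : ∀ i, V →ₗ[R] W i)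
    (hAB : ∀ x, ∑ i, A i (B i x) = x) (hBA : ∀ i y, B i (A i y) = y)
    (M : V →ₗ[R] V) (N : ∀ i, W i →ₗ[R] W i) (hM : ∀ i x, B i (M x) = N i (B i x)) :
    LinearMap.trace R V M = ∑ i, LinearMap.trace R (W i) (N i) := by
  have hM_sum : M = ∑ i, A i ∘ₗ B i ∘ₗ M := by
    ext x
    simp [hAB]
  have hN i : (B i ∘ₗ M) ∘ₗ A i = N i := by
    ext y
    simp [hM, hBA]
  conv_lhs => rw [hM_sum]
  rw [map_sum]
  exact Finset.sum_congr rfl fun i _ => by rw [LinearMap.trace_comp_comm', hN]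

end LinearAlgebra

section Scalar

variable {C : Type u} [Category.{v} C] [Preadditive C] [Linear ℂ C]

lemma IsIrreducible.smul_id_injective {X : C} (hX : IsIrreducible X) {a b : ℂ}
    (h : a • 𝟙 X = b • 𝟙 X) : a = b :=
  smul_left_injective ℂ hX.id_ne_zero h

/-- The identification of the endomorphisms of an irreducible object with the scalars. -/
def IsIrreducible.scalar {X : C} (hX : IsIrreducible X) : (X ⟶ X) ≃ₗ[ℂ] ℂ :=
  (LinearEquiv.ofBijective (LinearMap.toSpanSingleton ℂ (X ⟶ X) (𝟙 X))
    ⟨fun _ _ h => hX.smul_id_injective h,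
      fun f => (hX.exists_smul_id f).imp fun _ h => h.symm⟩).symm

lemma IsIrreducible.scalar_spec {X : C} (hX : IsIrreducible X) (f : X ⟶ X) :
    f = hX.scalar f • 𝟙 X :=
  (hX.scalar.symm_apply_apply f).symm

lemma IsIrreducible.scalar_eq {X : C} (hX : IsIrreducible X) {a : ℂ} {f : X ⟶ X}
    (h : f = a • 𝟙 X) : hX.scalar f = a :=
  hX.smul_id_injective ((hX.scalar_spec f).symm.trans h)

@[simp] lemma IsIrreducible.scalar_id {X : C} (hX : IsIrreducible X) : hX.scalar (𝟙 X) = 1 :=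
  hX.scalar_eq (one_smul ℂ _).symm

lemma IsIrreducible.scalar_comp {X : C} (hX : IsIrreducible X) (f g : X ⟶ X) :
    hX.scalar (f ≫ g) = hX.scalar f * hX.scalar g := by
  refine hX.scalar_eq ?_
  conv_lhs => rw [hX.scalar_spec f, hX.scalar_spec g]
  simp [smul_smul, mul_comm]

lemma IsIrreducible.scalar_comp_comm {X Y : C} (hX : IsIrreducible X) (hY : IsIrreducible Y)
    (f : X ⟶ Y) (g : Y ⟶ X) : hX.scalar (f ≫ g) = hY.scalar (g ≫ f) := by
  by_cases hf : f = 0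
  · simp [hf]
  · have h : hX.scalar (f ≫ g) • f = hY.scalar (g ≫ f) • f := by
      calc hX.scalar (f ≫ g) • f = (hX.scalar (f ≫ g) • 𝟙 X) ≫ f := by simp
        _ = f ≫ (hY.scalar (g ≫ f) • 𝟙 Y : Y ⟶ Y) := by
          rw [← hX.scalar_spec (f ≫ g), ← hY.scalar_spec (g ≫ f), Category.assoc]
        _ = hY.scalar (g ≫ f) • f := by simp
    exact smul_left_injective ℂ hf h

lemma Irr.mk_obj (a : Irr C) : Irr.mk a.obj a.obj_irreducible = a :=
  (a.eq_mk_of_iso a.obj_irreducible (Iso.refl _)).symm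

lemma Irr.nonempty_iso_mk {X : C} (hX : IsIrreducible X) : Nonempty ((Irr.mk X hX).obj ≅ X) :=
  Quotient.exact (s := irrSetoid C) (Quotient.out_eq (s := irrSetoid C) (Irr.mk X hX))

open Classical in
/-- The canonical morphism between chosen representatives: the identity if the classes agree, and
zero otherwise. -/
def Irr.cmp (a b : Irr C) : a.obj ⟶ b.obj := if h : a = b then eqToHom (by rw [h]) else 0

@[simp] lemma Irr.cmp_self (a : Irr C) : a.cmp a = 𝟙 _ := by simp [Irr.cmp]

lemma Irr.cmp_of_ne {a b : Irr C} (h : a ≠ b) : a.cmp b = 0 := by simp [Irr.cmp, h]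

end Scalar

section Dagger

variable {C : Type u} [Category.{v} C] [Preadditive C] [Linear ℂ C]
  [MonoidalCategory C] [MonoidalPreadditive C] [MonoidalLinear ℂ C] [CStarTensorCategory C]

attribute [simp] dagger_dagger dagger_id dagger_comp dagger_add dagger_smul dagger_tensor
  dagger_associator dagger_leftUnitor dagger_rightUnitor

/-- The adjoint as an additive map. -/
def daggerHom (X Y : C) : (X ⟶ Y) →+ (Y ⟶ X) := AddMonoidHom.mk' dagger dagger_add

@[simp] lemma dagger_zero (X Y : C) : dagger (0 : X ⟶ Y) = 0 := (daggerHom X Y).map_zero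

@[simp] lemma dagger_sub {X Y : C} (f g : X ⟶ Y) : dagger (f - g) = dagger f - dagger g :=
  (daggerHom X Y).map_sub f g

@[simp] lemma dagger_sum {X Y : C} {ι : Type*} (s : Finset ι) (f : ι → (X ⟶ Y)) :
    dagger (∑ i ∈ s, f i) = ∑ i ∈ s, dagger (f i) := map_sum (daggerHom X Y) f s

@[simp] lemma dagger_whiskerRight {X Y : C} (f : X ⟶ Y) (Z : C) :
    dagger (f ▷ Z) = dagger f ▷ Z := by
  rw [← tensorHom_id, dagger_tensor, dagger_id, tensorHom_id]

@[simp] lemma dagger_whiskerLeft {X Y : C} (Z : C) (f : X ⟶ Y) :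
    dagger (Z ◁ f) = Z ◁ dagger f := by
  rw [← id_tensorHom, dagger_tensor, dagger_id, id_tensorHom]

@[simp] lemma dagger_associator_inv (X Y Z : C) : dagger (α_ X Y Z).inv = (α_ X Y Z).hom := by
  rw [← dagger_associator, dagger_dagger]

@[simp] lemma dagger_leftUnitor_inv (X : C) : dagger (λ_ X).inv = (λ_ X).hom := by
  rw [← dagger_leftUnitor, dagger_dagger]

@[simp] lemma dagger_rightUnitor_inv (X : C) : dagger (ρ_ X).inv = (ρ_ X).hom := by
  rw [← dagger_rightUnitor, dagger_dagger]

lemma dagger_injective {X Y : C} {f g : X ⟶ Y} (h : dagger f = dagger g) : f = g := by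
  rw [← dagger_dagger f, h, dagger_dagger]

lemma eq_zero_of_comp_dagger_eq_zero {X Y : C} {f : X ⟶ Y} (h : f ≫ dagger f = 0) : f = 0 := by
  have hnorm := homNorm_comp_dagger f
  rw [h, map_zero] at hnorm
  exact eq_zero_of_map_eq_zero (homNorm X Y) (pow_eq_zero_iff two_ne_zero |>.1 hnorm.symm)

lemma eq_zero_of_dagger_comp_eq_zero {X Y : C} {f : X ⟶ Y} (h : dagger f ≫ f = 0) : f = 0 := by
  have : dagger f = 0 := eq_zero_of_comp_dagger_eq_zero (by rwa [dagger_dagger])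
  rw [← dagger_dagger f, this, dagger_zero]

lemma IsIrreducible.scalar_dagger {X : C} (hX : IsIrreducible X) (f : X ⟶ X) :
    hX.scalar (dagger f) = star (hX.scalar f) := by
  refine hX.scalar_eq ?_
  conv_lhs => rw [hX.scalar_spec f]
  simp

lemma IsIrreducible.scalar_comp_dagger_nonneg {X Y : C} (hX : IsIrreducible X) (f : X ⟶ Y) :
    0 ≤ hX.scalar (f ≫ dagger f) := by
  obtain ⟨g, hg⟩ := comp_dagger_positive f
  rw [hg, hX.scalar_comp, hX.scalar_dagger]
  exact mul_star_self_nonneg _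

lemma IsIrreducible.eq_zero_of_scalar {X Y : C} (hX : IsIrreducible X) {f : X ⟶ Y}
    (h : hX.scalar (f ≫ dagger f) = 0) : f = 0 :=
  eq_zero_of_comp_dagger_eq_zero (by rw [hX.scalar_spec (f ≫ _), h, zero_smul])

lemma IsIrreducible.scalar_comp_dagger_pos {X Y : C} (hX : IsIrreducible X) {f : X ⟶ Y}
    (h : f ≠ 0) : 0 < hX.scalar (f ≫ dagger f) :=
  lt_of_le_of_ne (hX.scalar_comp_dagger_nonneg f) fun h0 => h (hX.eq_zero_of_scalar h0.symm)

lemma Irr.mk_eq_of_hom_ne_zero (a : Irr C) {X : C} (hX : IsIrreducible X) {f : a.obj ⟶ X}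
    (hf : f ≠ 0) : a = Irr.mk X hX := by
  obtain ⟨e⟩ := a.obj_irreducible.nonempty_iso hX f hf
  exact a.eq_mk_of_iso hX e

lemma Irr.hom_eq_zero {a b : Irr C} (h : a ≠ b) (f : a.obj ⟶ b.obj) : f = 0 := by
  by_contra hf
  exact h ((a.mk_eq_of_hom_ne_zero b.obj_irreducible hf).trans b.mk_obj)

lemma IsIrreducible.exists_comp_dagger_eq {X Y : C} (hX : IsIrreducible X) {f : X ⟶ Y}
    (hf : f ≠ 0) : ∃ r : ℝ, 0 < r ∧ f ≫ dagger f = (r : ℂ) • 𝟙 X := by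
  obtain ⟨r, hr, hrf⟩ := RCLike.pos_iff_exists_ofReal.1 (hX.scalar_comp_dagger_pos hf)
  refine ⟨r, hr, (hX.scalar_spec _).trans ?_⟩
  rw [← hrf]
  rfl

lemma IsIrreducible.exists_unitary {X Y : C} (hX : IsIrreducible X) (hY : IsIrreducible Y)
    {f : X ⟶ Y} (hf : f ≠ 0) : ∃ w : X ⟶ Y, w ≫ dagger w = 𝟙 X ∧ dagger w ≫ w = 𝟙 Y := by
  obtain ⟨r, hr, hff⟩ := hX.exists_comp_dagger_eq hf
  have hff' : dagger f ≫ f = (r : ℂ) • 𝟙 Y := by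
    rw [hY.scalar_spec (_ ≫ f), hY.scalar_comp_comm hX, hX.scalar_eq hff]
  obtain ⟨s, hs⟩ : ∃ s : ℝ, s * (s * r) = 1 := by
    refine ⟨(√r)⁻¹, ?_⟩
    rw [← mul_assoc, ← mul_inv, Real.mul_self_sqrt hr.le, inv_mul_cancel₀ hr.ne']
  have hs' : (s : ℂ) * (s * r) = 1 := by exact_mod_cast hs
  refine ⟨(s : ℂ) • f, ?_, ?_⟩ <;>
    simp only [dagger_smul, Linear.comp_smul, Linear.smul_comp, hff, hff', smul_smul,
      Complex.star_def, Complex.conj_ofReal, hs', one_smul]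

lemma Irr.exists_unitary {X : C} (hX : IsIrreducible X) :
    ∃ w : (Irr.mk X hX).obj ⟶ X, w ≫ dagger w = 𝟙 _ ∧ dagger w ≫ w = 𝟙 X := by
  obtain ⟨e⟩ := Irr.nonempty_iso_mk hX
  refine (Irr.mk X hX).obj_irreducible.exists_unitary hX (f := e.hom) fun he => ?_
  apply (Irr.mk X hX).obj_irreducible.id_ne_zero
  rw [← e.hom_inv_id, he, Limits.zero_comp]

end Dagger

section DirectSum

variable {C : Type u} [Category.{v} C] [Preadditive C] [Linear ℂ C]
  [MonoidalCategory C] [MonoidalPreadditive C] [MonoidalLinear ℂ C] [CStarTensorCategory C]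

/-- The isometries `p i` present `X` as the orthogonal direct sum of the objects `S i`. -/
structure IsDirectSum {ι : Type*} [Fintype ι] {S : ι → C} {X : C} (p : ∀ i, S i ⟶ X) : Prop where
  isometry : ∀ i, p i ≫ dagger (p i) = 𝟙 (S i)
  orthogonal : ∀ i j, i ≠ j → p i ≫ dagger (p j) = 0
  complete : ∑ i, dagger (p i) ≫ p i = 𝟙 X

namespace IsDirectSum

variable {ι κ : Type*} [Fintype ι] [Fintype κ] {X : C}

lemma whiskerLeft {S : ι → C} {p : ∀ i, S i ⟶ X} (hp : IsDirectSum p) (Y : C) :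
    IsDirectSum fun i => Y ◁ p i where
  isometry i := by
    rw [dagger_whiskerLeft, ← MonoidalCategory.whiskerLeft_comp, hp.isometry, whiskerLeft_id]
  orthogonal i j hij := by
    rw [dagger_whiskerLeft, ← MonoidalCategory.whiskerLeft_comp, hp.orthogonal i j hij,
      MonoidalPreadditive.whiskerLeft_zero]
  complete := by
    simp only [dagger_whiskerLeft, ← MonoidalCategory.whiskerLeft_comp]
    rw [← whiskerLeft_sum, hp.complete, whiskerLeft_id]

lemma whiskerRight {S : ι → C} {p : ∀ i, S i ⟶ X} (hp : IsDirectSum p) (Y : C) :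
    IsDirectSum fun i => p i ▷ Y where
  isometry i := by
    rw [dagger_whiskerRight, ← comp_whiskerRight, hp.isometry, id_whiskerRight]
  orthogonal i j hij := by
    rw [dagger_whiskerRight, ← comp_whiskerRight, hp.orthogonal i j hij,
      MonoidalPreadditive.zero_whiskerRight]
  complete := by
    simp only [dagger_whiskerRight, ← comp_whiskerRight]
    rw [← sum_whiskerRight, hp.complete, id_whiskerRight]

lemma reindex {S : κ → C} (e : ι ≃ κ) {p : ∀ i, S (e i) ⟶ X} (hp : IsDirectSum p) :
    IsDirectSum (Equiv.piCongrLeft (fun k => S k ⟶ X) e p) where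
  isometry k := by
    obtain ⟨i, rfl⟩ := e.surjective k
    rw [Equiv.piCongrLeft_apply_apply, hp.isometry]
  orthogonal k l hkl := by
    obtain ⟨i, rfl⟩ := e.surjective k
    obtain ⟨j, rfl⟩ := e.surjective l
    rw [Equiv.piCongrLeft_apply_apply, Equiv.piCongrLeft_apply_apply,
      hp.orthogonal i j fun h => hkl (congrArg e h)]
  complete := by
    rw [← e.sum_comp, ← hp.complete]
    simp only [Equiv.piCongrLeft_apply_apply]

lemma comp_unitary {S T : ι → C} {p : ∀ i, S i ⟶ X} (hp : IsDirectSum p) {w : ∀ i, T i ⟶ S i}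
    (hw : ∀ i, w i ≫ dagger (w i) = 𝟙 (T i)) (hw' : ∀ i, dagger (w i) ≫ w i = 𝟙 (S i)) :
    IsDirectSum fun i => w i ≫ p i where
  isometry i := by
    rw [dagger_comp, Category.assoc, ← Category.assoc (p i), hp.isometry, Category.id_comp, hw]
  orthogonal i j hij := by
    rw [dagger_comp, Category.assoc, ← Category.assoc (p i), hp.orthogonal i j hij,
      Limits.zero_comp, Limits.comp_zero]
  complete := by
    rw [← hp.complete]
    refine Finset.sum_congr rfl fun i _ => ?_
    rw [dagger_comp, Category.assoc, ← Category.assoc (dagger (w i)), hw', Category.id_comp]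

lemma cons {n : ℕ} {S : Fin (n + 1) → C} {Z : C} {p : ∀ i : Fin n, S i.succ ⟶ Z}
    (hp : IsDirectSum p) {q : S 0 ⟶ X} {r : Z ⟶ X} (hq : q ≫ dagger q = 𝟙 (S 0))
    (hr : r ≫ dagger r = 𝟙 Z) (hqr : q ≫ dagger r = 0)
    (hsum : dagger q ≫ q + dagger r ≫ r = 𝟙 X) :
    IsDirectSum (Fin.cases q fun i => p i ≫ r : ∀ i, S i ⟶ X) where
  isometry := by
    refine Fin.cases hq fun i => ?_
    simp only [Fin.cases_succ, dagger_comp, Category.assoc]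
    rw [← Category.assoc r, hr, Category.id_comp, hp.isometry]
  orthogonal := by
    have hrq : r ≫ dagger q = 0 := dagger_injective (by simpa using hqr)
    refine Fin.cases (Fin.cases (fun h => absurd rfl h) fun j _ => ?_)
      fun i => Fin.cases (fun _ => ?_) fun j hij => ?_
    · simp only [Fin.cases_succ, Fin.cases_zero, dagger_comp]
      rw [← Category.assoc, hqr, Limits.zero_comp]
    · simp only [Fin.cases_succ, Fin.cases_zero, Category.assoc]
      rw [hrq, Limits.comp_zero]
    · simp only [Fin.cases_succ, dagger_comp, Category.assoc]
      rw [← Category.assoc r, hr, Category.id_comp,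
        hp.orthogonal i j fun h => hij (congrArg Fin.succ h)]
  complete := by
    have hpr : ∑ i, dagger (p i ≫ r) ≫ p i ≫ r = dagger r ≫ (∑ i, dagger (p i) ≫ p i) ≫ r := by
      simp [Preadditive.sum_comp, Preadditive.comp_sum]
    simp only [Fin.sum_univ_succ, Fin.cases_zero, Fin.cases_succ]
    rw [hpr, hp.complete, Category.id_comp, hsum]

end IsDirectSum

variable [RigidCStarTensorCategory C]

lemma exists_zero_object : ∃ Z : C, 𝟙 Z = 0 := by
  obtain ⟨Z, p, hp, hp'⟩ :=
    RigidCStarTensorCategory.exists_subobject (𝟙_ C) 0 (by simp) (by simp)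
  have hp0 : p = 0 := eq_zero_of_dagger_comp_eq_zero hp'
  exact ⟨Z, by rw [← hp, hp0, Limits.zero_comp]⟩

lemma exists_isDirectSum_fin (n : ℕ) (S : Fin n → C) :
    ∃ (Z : C) (p : ∀ i, S i ⟶ Z), IsDirectSum p := by
  induction n with
  | zero =>
    obtain ⟨Z, hZ⟩ := exists_zero_object (C := C)
    exact ⟨Z, fun i => i.elim0, ⟨fun i => i.elim0, fun i => i.elim0, by simp [hZ]⟩⟩
  | succ n ih =>
    obtain ⟨Z, p, hp⟩ := ih fun i => S i.succ
    obtain ⟨W, q, r, hq, hr, hqr, hsum⟩ := RigidCStarTensorCategory.exists_directSum (S 0) Z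
    exact ⟨W, _, hp.cons hq hr hqr hsum⟩

lemma exists_isDirectSum {ι : Type*} [Fintype ι] (S : ι → C) :
    ∃ (Z : C) (p : ∀ i, S i ⟶ Z), IsDirectSum p := by
  let e := (Fintype.equivFin ι).symm
  obtain ⟨Z, p, hp⟩ := exists_isDirectSum_fin _ fun i => S (e i)
  exact ⟨Z, _, hp.reindex e⟩

end DirectSum

section Decomposition

variable {C : Type u} [Category.{v} C] [Preadditive C] [Linear ℂ C]
  [MonoidalCategory C] [MonoidalPreadditive C] [MonoidalLinear ℂ C] [CStarTensorCategory C]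

/-- An orthogonal decomposition of an object into the chosen representatives of classes of
irreducible objects. -/
structure IrrDecomp (X : C) where
  /-- The number of summands. -/
  n : ℕ
  /-- The classes of the summands. -/
  irr : Fin n → Irr C
  /-- The inclusions of the summands. -/
  incl : ∀ i, (irr i).obj ⟶ X
  isDirectSum : IsDirectSum incl

namespace IrrDecomp

variable {X Y : C}

/-- The orthonormal frame of the morphisms `a.obj ⟶ X` given by a decomposition of `X`; the `i`-th
vector is zero unless the `i`-th summand is of class `a`. -/
def frame (D : IrrDecomp X) (a : Irr C) (i : Fin D.n) : a.obj ⟶ X := a.cmp (D.irr i) ≫ D.incl i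

lemma frame_expand (D : IrrDecomp X) {a : Irr C} (f : a.obj ⟶ X) :
    ∑ i, a.obj_irreducible.scalar (f ≫ dagger (D.frame a i)) • D.frame a i = f := by
  conv_rhs => rw [← Category.comp_id f, ← D.isDirectSum.complete, Preadditive.comp_sum]
  refine Finset.sum_congr rfl fun i _ => ?_
  by_cases h : a = D.irr i
  · subst h
    simp only [frame, Irr.cmp_self, Category.id_comp]
    conv_rhs =>
      rw [← Category.assoc, (D.irr i).obj_irreducible.scalar_spec (f ≫ dagger (D.incl i))]
    rw [Linear.smul_comp, Category.id_comp]
  · rw [← Category.assoc, Irr.hom_eq_zero h (f ≫ _)]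
    simp [frame, Irr.cmp_of_ne h]

open Classical in
lemma scalar_frame (D : IrrDecomp X) (a : Irr C) (i : Fin D.n) :
    a.obj_irreducible.scalar (D.frame a i ≫ dagger (D.frame a i)) =
      if D.irr i = a then 1 else 0 := by
  split_ifs with h
  · subst h
    simp [frame, D.isDirectSum.isometry]
  · simp [frame, Irr.cmp_of_ne (Ne.symm h)]

lemma expand (D : IrrDecomp X) (E : IrrDecomp Y) (f : X ⟶ Y) :
    f = ∑ i, ∑ j, dagger (D.incl i) ≫ (D.incl i ≫ f ≫ dagger (E.incl j)) ≫ E.incl j := by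
  calc f = 𝟙 X ≫ f ≫ 𝟙 Y := by rw [Category.id_comp, Category.comp_id]
    _ = _ := by
      rw [← D.isDirectSum.complete, ← E.isDirectSum.complete]
      simp only [Preadditive.sum_comp, Preadditive.comp_sum, Category.assoc]
      rw [Finset.sum_comm]

lemma expand_cmp (D : IrrDecomp X) (E : IrrDecomp Y) (f : X ⟶ Y) :
    ∃ m : Fin D.n → Fin E.n → ℂ,
      f = ∑ i, ∑ j, m i j • (dagger (D.incl i) ≫ (D.irr i).cmp (E.irr j) ≫ E.incl j) := by
  have hcoeff {a b : Irr C} (g : a.obj ⟶ b.obj) : ∃ z : ℂ, g = z • a.cmp b := by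
    by_cases hab : a = b
    · subst hab
      exact ⟨_, by rw [Irr.cmp_self]; exact a.obj_irreducible.scalar_spec g⟩
    · exact ⟨0, by rw [Irr.hom_eq_zero hab g, zero_smul]⟩
  choose m hm using fun i j => hcoeff (D.incl i ≫ f ≫ dagger (E.incl j))
  refine ⟨m, ?_⟩
  conv_lhs => rw [expand D E f]
  simp only [hm, Linear.smul_comp, Linear.comp_smul]

end IrrDecomp

variable [RigidCStarTensorCategory C]

lemma nonempty_irrDecomp (X : C) : Nonempty (IrrDecomp X) := by
  obtain ⟨n, S, p, hS, hp, hp', hsum⟩ := RigidCStarTensorCategory.semisimple X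
  choose w hw hw' using fun i => Irr.exists_unitary (hS i)
  exact ⟨⟨n, fun i => Irr.mk (S i) (hS i), _, IsDirectSum.comp_unitary ⟨hp, hp', hsum⟩ hw hw'⟩⟩

/-- A chosen decomposition into irreducible objects. -/
def irrDecomp (X : C) : IrrDecomp X := (nonempty_irrDecomp X).some

instance finite_hom (X Y : C) : Module.Finite ℂ (X ⟶ Y) := by
  let D := irrDecomp X
  let E := irrDecomp Y
  refine Module.Finite.of_surjective (M := Fin D.n × Fin E.n → ℂ)
    (∑ ij : Fin D.n × Fin E.n, (LinearMap.proj ij : _ →ₗ[ℂ] ℂ).smulRight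
      (dagger (D.incl ij.1) ≫ (D.irr ij.1).cmp (E.irr ij.2) ≫ E.incl ij.2)) fun f => ?_
  obtain ⟨m, hm⟩ := D.expand_cmp E f
  refine ⟨fun ij => m ij.1 ij.2, ?_⟩
  conv_rhs => rw [hm]
  rw [← Fintype.sum_prod_type']
  simp only [LinearMap.sum_apply, LinearMap.smulRight_apply, LinearMap.proj_apply]

open Classical in
lemma IrrDecomp.mult_eq {X : C} (D : IrrDecomp X) (a : Irr C) :
    (mult a X : ℂ) = ∑ i, if D.irr i = a then 1 else 0 := by
  rw [mult, ← LinearMap.trace_one ℂ (a.obj ⟶ X), trace_eq_sum_of_frame (D.frame a)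
    (fun i =>
      a.obj_irreducible.scalar.toLinearMap ∘ₗ Linear.rightComp ℂ a.obj (dagger (D.frame a i)))
    (fun f => D.frame_expand f)]
  exact Finset.sum_congr rfl fun i _ => D.scalar_frame a i

lemma IrrDecomp.objClass_eq {X : C} (D : IrrDecomp X) :
    objClass X = ∑ i, basisElt (D.irr i) := by
  classical
  refine Finsupp.ext fun a => ?_
  refine (D.mult_eq a).trans ?_
  rw [show (∑ i, basisElt (D.irr i) : FusionAlgebra C)
    = ∑ i, (Finsupp.single (D.irr i) (1 : ℂ) : Irr C →₀ ℂ) from rfl, Finsupp.finsetSum_apply]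
  exact Finset.sum_congr rfl fun i _ => by rw [Finsupp.single_apply]

end Decomposition

section Pairings

variable {C : Type u} [Category.{v} C] [MonoidalCategory C]

/-- The morphisms `f : X ⟶ X'` and `g : Y' ⟶ Y` are mates with respect to the exact pairings `p` of
`X` and `Y` and `q` of `X'` and `Y'`: each is the transpose of the other. -/
structure IsMate {X Y X' Y' : C} (p : ExactPairing X Y) (q : ExactPairing X' Y') (f : X ⟶ X')
    (g : Y' ⟶ Y) : Prop where
  coevaluation_comp : p.coevaluation' ≫ f ▷ Y = q.coevaluation' ≫ X' ◁ g
  comp_evaluation : Y' ◁ f ≫ q.evaluation' = g ▷ X ≫ p.evaluation'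

lemma exists_right_mate {X Y X' Y' : C} (p : ExactPairing X Y) (q : ExactPairing X' Y')
    (f : X ⟶ X') : ∃ g : Y' ⟶ Y, IsMate p q f g := by
  let i : HasRightDual X := ⟨Y⟩
  let j : HasRightDual X' := ⟨Y'⟩
  exact ⟨@rightAdjointMate C _ _ X X' i j f,
    ⟨(@coevaluation_comp_rightAdjointMate C _ _ X X' i j f).symm,
      (@rightAdjointMate_comp_evaluation C _ _ X X' i j f).symm⟩⟩

lemma exists_left_mate {X Y X' Y' : C} (p : ExactPairing X Y) (q : ExactPairing X' Y')
    (g : Y' ⟶ Y) : ∃ f : X ⟶ X', IsMate p q f g := by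
  let i : HasLeftDual Y := ⟨X⟩
  let j : HasLeftDual Y' := ⟨X'⟩
  exact ⟨@leftAdjointMate C _ _ Y' Y j i g,
    ⟨@coevaluation_comp_leftAdjointMate C _ _ Y' Y j i g,
      @leftAdjointMate_comp_evaluation C _ _ Y' Y j i g⟩⟩

lemma coevaluation_whiskerRight_injective {X Y Z : C} (p : ExactPairing X Y) {f g : X ⟶ Z}
    (h : p.coevaluation' ≫ f ▷ Y = p.coevaluation' ≫ g ▷ Y) : f = g := by
  have hretract : ∀ f : X ⟶ Z, (λ_ X).inv ≫ (p.coevaluation' ≫ f ▷ Y) ▷ X ≫ (α_ _ _ _).hom ≫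
      Z ◁ p.evaluation' ≫ (ρ_ Z).hom = f := by
    intro f
    have hzigzag := ExactPairing.evaluation_coevaluation'' X Y
    calc _ = 𝟙 _ ⊗≫ p.coevaluation' ▷ X ⊗≫ (f ▷ (Y ⊗ X) ≫ Z ◁ p.evaluation') ⊗≫ 𝟙 _ := by
          monoidal
      _ = 𝟙 _ ⊗≫ (η_ X Y ▷ X ⊗≫ X ◁ ε_ X Y) ⊗≫ f := by
        rw [← whisker_exchange]
        change _ = 𝟙 _ ⊗≫ (p.coevaluation' ▷ X ⊗≫ X ◁ p.evaluation') ⊗≫ f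
        monoidal
      _ = f := by rw [hzigzag]; monoidal
  rw [← hretract f, h, hretract]

lemma coevaluation_whiskerLeft_injective {X Y Z : C} (p : ExactPairing X Y) {f g : Y ⟶ Z}
    (h : p.coevaluation' ≫ X ◁ f = p.coevaluation' ≫ X ◁ g) : f = g := by
  have hretract : ∀ f : Y ⟶ Z, (ρ_ Y).inv ≫ Y ◁ (p.coevaluation' ≫ X ◁ f) ≫ (α_ _ _ _).inv ≫
      p.evaluation' ▷ Z ≫ (λ_ Z).hom = f := by
    intro f
    have hzigzag := ExactPairing.coevaluation_evaluation'' X Y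
    calc _ = 𝟙 _ ⊗≫ Y ◁ p.coevaluation' ⊗≫ ((Y ⊗ X) ◁ f ≫ p.evaluation' ▷ Z) ⊗≫ 𝟙 _ := by
          monoidal
      _ = 𝟙 _ ⊗≫ (Y ◁ η_ X Y ⊗≫ ε_ X Y ▷ Y) ⊗≫ f := by
        rw [whisker_exchange]
        change _ = 𝟙 _ ⊗≫ (Y ◁ p.coevaluation' ⊗≫ p.evaluation' ▷ Y) ⊗≫ f
        monoidal
      _ = f := by rw [hzigzag]; monoidal
  rw [← hretract f, h, hretract]

lemma exists_coevaluation_whiskerLeft_eq {X Y Z : C} (p : ExactPairing X Y) (w : 𝟙_ C ⟶ X ⊗ Z) :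
    ∃ g : Y ⟶ Z, p.coevaluation' ≫ X ◁ g = w := by
  obtain ⟨f, hf⟩ := (@tensorLeftHomEquiv C _ _ (𝟙_ C) X Y Z p).surjective w
  refine ⟨(ρ_ Y).inv ≫ f, hf.symm ▸ ?_⟩
  change _ = (λ_ _).inv ≫ p.coevaluation' ▷ _ ≫ (α_ _ _ _).hom ≫ X ◁ f
  monoidal

lemma IsMate.comp_eq_id {X Y Y₀ : C} {p : ExactPairing X Y} {p₀ : ExactPairing X Y₀}
    {S : Y ⟶ Y₀} {T : Y₀ ⟶ Y} (hT : IsMate p p₀ (𝟙 X) T) (hS : IsMate p₀ p (𝟙 X) S) :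
    T ≫ S = 𝟙 Y₀ := by
  have hT' := hT.coevaluation_comp
  have hS' := hS.coevaluation_comp
  rw [id_whiskerRight, Category.comp_id] at hT' hS'
  refine coevaluation_whiskerLeft_injective p₀ ?_
  rw [MonoidalCategory.whiskerLeft_comp, ← Category.assoc, ← hT', ← hS', whiskerLeft_id,
    Category.comp_id]

lemma zigzag_left {A A' B B' X Y : C} (η : 𝟙_ C ⟶ A ⊗ A') (ε : B' ⊗ B ⟶ 𝟙_ C) (v : A ⟶ X)
    (w : A' ⟶ Y) (v' : X ⟶ B) (w' : Y ⟶ B') :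
    Y ◁ (η ≫ (v ⊗ₘ w)) ≫ (α_ Y X Y).inv ≫ ((w' ⊗ₘ v') ≫ ε) ▷ Y =
      (ρ_ Y).hom ≫ w' ≫ (ρ_ B').inv ≫ (B' ◁ η ≫ (α_ _ _ _).inv ≫ (B' ◁ (v ≫ v') ≫ ε) ▷ A') ≫
        (λ_ A').hom ≫ w ≫ (λ_ Y).inv := by
  have hexchange : Y ◁ (v ⊗ₘ w) ≫ (α_ Y X Y).inv ≫ ((w' ⊗ₘ v') ≫ ε) ▷ Y =
      w' ▷ (A ⊗ A') ≫ (α_ _ _ _).inv ≫ (B' ◁ (v ≫ v') ≫ ε) ▷ A' ≫ 𝟙_ C ◁ w := by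
    rw [← id_tensorHom Y (v ⊗ₘ w), associator_inv_naturality_assoc, ← tensorHom_id _ Y,
      tensorHom_comp_tensorHom, tensorHom_comp_tensorHom_assoc, Category.comp_id, Category.id_comp,
      tensorHom_def (_ ≫ ε), tensorHom_def w']
    simp
  rw [MonoidalCategory.whiskerLeft_comp, Category.assoc, hexchange, whisker_exchange_assoc]
  simp

lemma zigzag_right {A A' B B' X Y : C} (η : 𝟙_ C ⟶ A ⊗ A') (ε : B' ⊗ B ⟶ 𝟙_ C) (v : A ⟶ X)
    (w : A' ⟶ Y) (v' : X ⟶ B) (w' : Y ⟶ B') :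
    (η ≫ (v ⊗ₘ w)) ▷ X ≫ (α_ X Y X).hom ≫ X ◁ ((w' ⊗ₘ v') ≫ ε) =
      (λ_ X).hom ≫ v' ≫ (λ_ B).inv ≫ (η ▷ B ≫ (α_ _ _ _).hom ≫ A ◁ ((w ≫ w') ▷ B ≫ ε)) ≫
        (ρ_ A).hom ≫ v ≫ (ρ_ X).inv := by
  have hexchange : (v ⊗ₘ w) ▷ X ≫ (α_ X Y X).hom ≫ X ◁ ((w' ⊗ₘ v') ≫ ε) =
      (A ⊗ A') ◁ v' ≫ (α_ _ _ _).hom ≫ A ◁ ((w ≫ w') ▷ B ≫ ε) ≫ v ▷ 𝟙_ C := by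
    rw [← tensorHom_id (v ⊗ₘ w) X, associator_naturality_assoc, ← id_tensorHom X,
      tensorHom_comp_tensorHom, tensorHom_comp_tensorHom_assoc, Category.comp_id, Category.id_comp,
      tensorHom_def' v, tensorHom_def' (w ≫ w')]
    simp
  rw [comp_whiskerRight, Category.assoc, hexchange, ← whisker_exchange_assoc]
  simp

end Pairings

section Nonvanishing

variable {C : Type u} [Category.{v} C] [Preadditive C] [MonoidalCategory C]

lemma coevaluation_ne_zero {X Y : C} (p : ExactPairing X Y) (hX : 𝟙 X ≠ 0) :
    p.coevaluation' ≠ 0 := fun h => hX <|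
  coevaluation_whiskerRight_injective p (by rw [h, Limits.zero_comp, Limits.zero_comp])

variable [MonoidalPreadditive C]

lemma evaluation_ne_zero {X Y : C} (p : ExactPairing X Y) (hX : 𝟙 X ≠ 0) :
    p.evaluation' ≠ 0 := by
  intro h
  have hzigzag := p.evaluation_coevaluation'
  rw [h, MonoidalPreadditive.whiskerLeft_zero, Limits.comp_zero, Limits.comp_zero] at hzigzag
  refine hX ?_
  calc 𝟙 X = (λ_ X).inv ≫ ((λ_ X).hom ≫ (ρ_ X).inv) ≫ (ρ_ X).hom := by simp
    _ = 0 := by rw [← hzigzag, Limits.zero_comp, Limits.comp_zero]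

end Nonvanishing

section Traces

variable {C : Type u} [Category.{v} C] [Preadditive C] [Linear ℂ C]
  [MonoidalCategory C] [MonoidalPreadditive C] [MonoidalLinear ℂ C]

/-- The pairing with coevaluation multiplied by `z` and evaluation by `z⁻¹`. -/
abbrev rescalePairing {X Y : C} (p : ExactPairing X Y) {z : ℂ} (hz : z ≠ 0) :
    ExactPairing X Y where
  coevaluation' := z • p.coevaluation'
  evaluation' := z⁻¹ • p.evaluation'
  coevaluation_evaluation' := by
    simp only [MonoidalLinear.whiskerLeft_smul, MonoidalLinear.smul_whiskerRight,
      Linear.comp_smul, Linear.smul_comp, smul_smul]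
    rw [inv_mul_cancel₀ hz, one_smul, p.coevaluation_evaluation']
  evaluation_coevaluation' := by
    simp only [MonoidalLinear.whiskerLeft_smul, MonoidalLinear.smul_whiskerRight,
      Linear.comp_smul, Linear.smul_comp, smul_smul]
    rw [inv_mul_cancel₀ hz, one_smul, p.evaluation_coevaluation']

variable [CStarTensorCategory C]

/-- The adjoint of an exact pairing, which exchanges the roles of the two objects. -/
abbrev daggerPairing {X Y : C} (p : ExactPairing X Y) : ExactPairing Y X where
  coevaluation' := dagger p.evaluation'
  evaluation' := dagger p.coevaluation'
  coevaluation_evaluation' := by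
    simpa using congrArg dagger p.evaluation_coevaluation'
  evaluation_coevaluation' := by
    simpa using congrArg dagger p.coevaluation_evaluation'

/-- The trace of an endomorphism of `X` closed on the right. -/
def rightTrace {X Y : C} (p : ExactPairing X Y) (f : X ⟶ X) : 𝟙_ C ⟶ 𝟙_ C :=
  p.coevaluation' ≫ f ▷ Y ≫ dagger p.coevaluation'

/-- The trace of an endomorphism of `X` closed on the left. -/
def leftTrace {X Y : C} (p : ExactPairing X Y) (f : X ⟶ X) : 𝟙_ C ⟶ 𝟙_ C :=
  dagger p.evaluation' ≫ Y ◁ f ≫ p.evaluation'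

/-- The partial trace over the second factor. -/
def partialTraceRight {X X' Y' : C} (q : ExactPairing X' Y') (f : X ⊗ X' ⟶ X ⊗ X') : X ⟶ X :=
  (ρ_ X).inv ≫ X ◁ q.coevaluation' ≫ (α_ _ _ _).inv ≫ f ▷ Y' ≫ (α_ _ _ _).hom ≫
    X ◁ dagger q.coevaluation' ≫ (ρ_ X).hom

/-- The partial trace over the first factor. -/
def partialTraceLeft {X Y X' : C} (p : ExactPairing X Y) (f : X ⊗ X' ⟶ X ⊗ X') : X' ⟶ X' :=
  (λ_ X').inv ≫ dagger p.evaluation' ▷ X' ≫ (α_ _ _ _).hom ≫ Y ◁ f ≫ (α_ _ _ _).inv ≫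
    p.evaluation' ▷ X' ≫ (λ_ X').hom

lemma rightTrace_comp_dagger {X Y Z : C} (p : ExactPairing X Y) (f : X ⟶ Z) :
    rightTrace p (f ≫ dagger f) =
      (p.coevaluation' ≫ f ▷ Y) ≫ dagger (p.coevaluation' ≫ f ▷ Y) := by
  simp [rightTrace]

lemma rightTrace_tensor {X Y X' Y' : C} (p : ExactPairing X Y) (q : ExactPairing X' Y')
    (f : X ⊗ X' ⟶ X ⊗ X') :
    rightTrace (@ExactPairing.tensor C _ _ X X' Y Y' p q) f =
      rightTrace p (partialTraceRight q f) := by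
  have hcoev : (@ExactPairing.tensor C _ _ X X' Y Y' p q).coevaluation' =
    p.coevaluation' ⊗≫ (X ◁ q.coevaluation') ▷ Y ⊗≫ 𝟙 _ := rfl
  rw [rightTrace, rightTrace, hcoev, partialTraceRight]
  simp [monoidalComp]

lemma leftTrace_tensor {X Y X' Y' : C} (p : ExactPairing X Y) (q : ExactPairing X' Y')
    (f : X ⊗ X' ⟶ X ⊗ X') :
    leftTrace (@ExactPairing.tensor C _ _ X X' Y Y' p q) f =
      leftTrace q (partialTraceLeft p f) := by
  have hev : (@ExactPairing.tensor C _ _ X X' Y Y' p q).evaluation' =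
    𝟙 _ ⊗≫ Y' ◁ (p.evaluation' ▷ X') ⊗≫ q.evaluation' := rfl
  rw [leftTrace, leftTrace, hev, partialTraceLeft]
  simp [monoidalComp]

lemma leftTrace_partialTraceRight {X Y X' Y' : C} (p : ExactPairing X Y) (q : ExactPairing X' Y')
    (f : X ⊗ X' ⟶ X ⊗ X') :
    leftTrace p (partialTraceRight q f) = rightTrace q (partialTraceLeft p f) := by
  rw [leftTrace, rightTrace, partialTraceRight, partialTraceLeft]
  calc _ = 𝟙 _ ⊗≫ (dagger p.evaluation' ▷ 𝟙_ C ≫ (Y ⊗ X) ◁ q.coevaluation') ⊗≫ Y ◁ f ▷ Y' ⊗≫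
        ((Y ⊗ X) ◁ dagger q.coevaluation' ≫ p.evaluation' ▷ 𝟙_ C) ⊗≫ 𝟙 _ := by monoidal
    _ = 𝟙 _ ⊗≫ (𝟙_ C ◁ q.coevaluation' ≫ dagger p.evaluation' ▷ (X' ⊗ Y')) ⊗≫ Y ◁ f ▷ Y' ⊗≫
        (p.evaluation' ▷ (X' ⊗ Y') ≫ 𝟙_ C ◁ dagger q.coevaluation') ⊗≫ 𝟙 _ := by
      rw [whisker_exchange, whisker_exchange]
    _ = _ := by monoidal

lemma IsStandard.tensor {X Y X' Y' : C} {p : ExactPairing X Y} {q : ExactPairing X' Y'}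
    (hp : IsStandard p) (hq : IsStandard q) :
    IsStandard (@ExactPairing.tensor C _ _ X X' Y Y' p q) := fun f =>
  (rightTrace_tensor p q f).trans <| (hp _).trans <| (leftTrace_partialTraceRight p q f).trans <|
    (hq _).trans (leftTrace_tensor p q f).symm

lemma IsStandard.daggerPairing {X Y : C} {p : ExactPairing X Y} (hp : IsStandard p) :
    IsStandard (CStarTensor.daggerPairing p) := by
  intro g
  obtain ⟨f, hf⟩ := exists_left_mate p p g
  change dagger p.evaluation' ≫ g ▷ X ≫ dagger (dagger p.evaluation') =
    dagger (dagger p.coevaluation') ≫ X ◁ g ≫ dagger p.coevaluation'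
  have htrace := hp f
  rw [hf.comp_evaluation, ← Category.assoc, hf.coevaluation_comp, Category.assoc] at htrace
  rw [dagger_dagger, dagger_dagger, htrace]

/-- The orthogonal direct sum of exact pairings. -/
abbrev IsDirectSum.pairing {ι : Type*} [Fintype ι] {S T : ι → C} {X Y : C} {p : ∀ i, S i ⟶ X}
    {q : ∀ i, T i ⟶ Y} (hp : IsDirectSum p) (hq : IsDirectSum q)
    (π : ∀ i, ExactPairing (S i) (T i)) : ExactPairing X Y where
  coevaluation' := ∑ i, (π i).coevaluation' ≫ (p i ⊗ₘ q i)
  evaluation' := ∑ i, (dagger (q i) ⊗ₘ dagger (p i)) ≫ (π i).evaluation'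
  coevaluation_evaluation' := by
    simp only [whiskerLeft_sum, sum_whiskerRight, Preadditive.sum_comp, Preadditive.comp_sum,
      zigzag_left]
    rw [Finset.sum_congr rfl fun i _ => Finset.sum_eq_single i
      (fun j _ hj => by rw [hp.orthogonal j i hj]; simp) (by simp)]
    simp only [hp.isometry, whiskerLeft_id, Category.id_comp, (π _).coevaluation_evaluation',
      Category.assoc, Iso.inv_hom_id_assoc]
    rw [← Preadditive.comp_sum]
    simp only [← Category.assoc]
    rw [← Preadditive.sum_comp, hq.complete]
    simp
  evaluation_coevaluation' := by
    simp only [whiskerLeft_sum, sum_whiskerRight, Preadditive.sum_comp, Preadditive.comp_sum,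
      zigzag_right]
    rw [Finset.sum_congr rfl fun i _ => Finset.sum_eq_single i
      (fun j _ hj => by rw [hq.orthogonal j i hj]; simp) (by simp)]
    simp only [hq.isometry, id_whiskerRight, Category.id_comp, (π _).evaluation_coevaluation',
      Category.assoc, Iso.inv_hom_id_assoc]
    rw [← Preadditive.comp_sum]
    simp only [← Category.assoc]
    rw [← Preadditive.sum_comp, hp.complete]
    simp

section

variable {ι : Type*} [Fintype ι] {S T : ι → C} {X Y : C} {p : ∀ i, S i ⟶ X} {q : ∀ i, T i ⟶ Y}
  (hp : IsDirectSum p) (hq : IsDirectSum q) (π : ∀ i, ExactPairing (S i) (T i)) (f : X ⟶ X)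

lemma IsDirectSum.rightTrace_pairing :
    rightTrace (hp.pairing hq π) f = ∑ i, rightTrace (π i) (p i ≫ f ≫ dagger (p i)) := by
  have hcompress i j : (p i ⊗ₘ q i) ≫ f ▷ Y ≫ (dagger (p j) ⊗ₘ dagger (q j)) =
      (p i ≫ f ≫ dagger (p j)) ⊗ₘ (q i ≫ dagger (q j)) := by
    rw [← tensorHom_id, tensorHom_comp_tensorHom, tensorHom_comp_tensorHom, Category.id_comp]
  change (∑ i, (π i).coevaluation' ≫ (p i ⊗ₘ q i)) ≫ f ▷ Y ≫
    dagger (∑ i, (π i).coevaluation' ≫ (p i ⊗ₘ q i)) = _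
  simp only [rightTrace, dagger_sum, Preadditive.sum_comp, Preadditive.comp_sum, dagger_comp,
    dagger_tensor, Category.assoc, reassoc_of% hcompress]
  rw [Finset.sum_congr rfl fun i _ => Finset.sum_eq_single i
    (fun j _ hj => by rw [hq.orthogonal j i hj]; simp [MonoidalCategory.tensorHom_def]) (by simp)]
  simp only [hq.isometry, tensorHom_id]

lemma IsDirectSum.leftTrace_pairing :
    leftTrace (hp.pairing hq π) f = ∑ i, leftTrace (π i) (p i ≫ f ≫ dagger (p i)) := by
  have hcompress i j : (q i ⊗ₘ p i) ≫ Y ◁ f ≫ (dagger (q j) ⊗ₘ dagger (p j)) =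
      (q i ≫ dagger (q j)) ⊗ₘ (p i ≫ f ≫ dagger (p j)) := by
    rw [← id_tensorHom, tensorHom_comp_tensorHom, tensorHom_comp_tensorHom, Category.id_comp]
  change dagger (∑ i, (dagger (q i) ⊗ₘ dagger (p i)) ≫ (π i).evaluation') ≫ Y ◁ f ≫
    ∑ i, (dagger (q i) ⊗ₘ dagger (p i)) ≫ (π i).evaluation' = _
  simp only [leftTrace, dagger_sum, Preadditive.sum_comp, Preadditive.comp_sum, dagger_comp,
    dagger_tensor, dagger_dagger, Category.assoc, reassoc_of% hcompress]
  rw [Finset.sum_congr rfl fun i _ => Finset.sum_eq_single i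
    (fun j _ hj => by rw [hq.orthogonal j i hj]; simp [MonoidalCategory.tensorHom_def]) (by simp)]
  simp only [hq.isometry, id_tensorHom]

end

lemma exists_trace_comparison {X Y Y₀ : C} (p : ExactPairing X Y) (p₀ : ExactPairing X Y₀) :
    ∃ m n : X ⟶ X, m ≫ n = 𝟙 X ∧ (∀ f, rightTrace p f = rightTrace p₀ (m ≫ f)) ∧
      ∀ f, leftTrace p f = leftTrace p₀ (f ≫ n) := by
  obtain ⟨T, hT⟩ := exists_right_mate p p₀ (𝟙 X)
  obtain ⟨S, hS⟩ := exists_right_mate p₀ p (𝟙 X)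
  obtain ⟨m, hm⟩ := exists_left_mate p₀ p₀ (T ≫ dagger T)
  obtain ⟨n, hn⟩ := exists_left_mate p₀ p₀ (dagger S ≫ S)
  have hTS : (dagger S ≫ S) ≫ T ≫ dagger T = 𝟙 Y₀ := by
    rw [Category.assoc, ← Category.assoc S, hS.comp_eq_id hT, Category.id_comp, ← dagger_comp,
      hT.comp_eq_id hS, dagger_id]
  refine ⟨m, n, coevaluation_whiskerRight_injective p₀ ?_, fun f => ?_, fun f => ?_⟩
  · rw [comp_whiskerRight, ← Category.assoc, hm.coevaluation_comp, Category.assoc,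
      whisker_exchange, ← Category.assoc, hn.coevaluation_comp, Category.assoc,
      ← MonoidalCategory.whiskerLeft_comp, hTS, whiskerLeft_id, id_whiskerRight]
  · have hcoev := hS.coevaluation_comp
    rw [id_whiskerRight, Category.comp_id] at hcoev
    have hcoev' := hT.coevaluation_comp
    rw [id_whiskerRight, Category.comp_id] at hcoev'
    rw [rightTrace, rightTrace, hcoev', comp_whiskerRight,
      ← Category.assoc (p₀.coevaluation'), ← Category.assoc (p₀.coevaluation') (m ▷ _),
      hm.coevaluation_comp]
    simp [whisker_exchange_assoc]
  · have hev := hS.comp_evaluation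
    rw [whiskerLeft_id, Category.id_comp] at hev
    rw [leftTrace, leftTrace, hev, MonoidalCategory.whiskerLeft_comp, Category.assoc,
      hn.comp_evaluation]
    simp [whisker_exchange_assoc]

lemma Irr.catDim_mul_scalar_comm {a b : Irr C} (f : a.obj ⟶ b.obj) (g : b.obj ⟶ a.obj) :
    (catDim a.obj : ℂ) * a.obj_irreducible.scalar (f ≫ g) =
      (catDim b.obj : ℂ) * b.obj_irreducible.scalar (g ≫ f) := by
  by_cases h : a = b
  · subst h
    rw [a.obj_irreducible.scalar_comp_comm a.obj_irreducible]
  · rw [Irr.hom_eq_zero h f]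
    simp

namespace IrrDecomp

variable {X Y : C} (D : IrrDecomp X)

/-- The categorical trace of an endomorphism. -/
def tr : (X ⟶ X) →ₗ[ℂ] ℂ :=
  ∑ i, (catDim (D.irr i).obj : ℂ) • (D.irr i).obj_irreducible.scalar.toLinearMap ∘ₗ
    Linear.leftComp ℂ _ (D.incl i) ∘ₗ Linear.rightComp ℂ X (dagger (D.incl i))

lemma tr_apply (f : X ⟶ X) : D.tr f = ∑ i, (catDim (D.irr i).obj : ℂ) *
    (D.irr i).obj_irreducible.scalar (D.incl i ≫ f ≫ dagger (D.incl i)) := by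
  simp [tr]

lemma tr_id : D.tr (𝟙 X) = ((∑ i, catDim (D.irr i).obj : ℝ) : ℂ) := by
  simp [tr_apply, D.isDirectSum.isometry]

lemma compress_comp (E : IrrDecomp Y) (f : X ⟶ Y) (g : Y ⟶ X) (i : Fin D.n) :
    D.incl i ≫ (f ≫ g) ≫ dagger (D.incl i) =
      ∑ j, (D.incl i ≫ f ≫ dagger (E.incl j)) ≫ E.incl j ≫ g ≫ dagger (D.incl i) := by
  calc _ = (D.incl i ≫ f) ≫ (∑ j, dagger (E.incl j) ≫ E.incl j) ≫ g ≫ dagger (D.incl i) := by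
        rw [E.isDirectSum.complete]; simp
    _ = _ := by simp [Preadditive.sum_comp, Preadditive.comp_sum]

lemma tr_comm (E : IrrDecomp Y) (f : X ⟶ Y) (g : Y ⟶ X) : D.tr (f ≫ g) = E.tr (g ≫ f) := by
  simp only [tr_apply, D.compress_comp E, E.compress_comp D, map_sum, Finset.mul_sum]
  rw [Finset.sum_comm]
  exact Finset.sum_congr rfl fun j _ => Finset.sum_congr rfl fun i _ =>
    Irr.catDim_mul_scalar_comm _ _

lemma tr_comp_dagger (f : X ⟶ Y) : D.tr (f ≫ dagger f) = ∑ i, (catDim (D.irr i).obj : ℂ) *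
    (D.irr i).obj_irreducible.scalar ((D.incl i ≫ f) ≫ dagger (D.incl i ≫ f)) := by
  simp [tr_apply]

end IrrDecomp

end Traces

section StandardPairings

variable {C : Type u} [Category.{v} C] [Preadditive C] [Linear ℂ C]
  [MonoidalCategory C] [MonoidalPreadditive C] [MonoidalLinear ℂ C] [CStarTensorCategory C]
  [RigidCStarTensorCategory C]

lemma IsIrreducible.exists_isStandard {X : C} (hX : IsIrreducible X) :
    ∃ (Y : C) (p : ExactPairing X Y), IsStandard p := by
  obtain ⟨Y, ⟨p⟩⟩ := RigidCStarTensorCategory.exists_dual X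
  have hunit : IsIrreducible (𝟙_ C) := RigidCStarTensorCategory.unit_irreducible
  obtain ⟨a, ha, hcoev⟩ := hunit.exists_comp_dagger_eq (coevaluation_ne_zero p hX.id_ne_zero)
  obtain ⟨b, hb, hev⟩ := hunit.exists_comp_dagger_eq (f := dagger p.evaluation') fun h =>
    evaluation_ne_zero p hX.id_ne_zero (dagger_injective (by rw [h, dagger_zero]))
  rw [dagger_dagger] at hev
  obtain ⟨z, hz, hzab⟩ : ∃ z : ℝ, 0 < z ∧ z * (z * a) = z⁻¹ * (z⁻¹ * b) := by
    have hba : 0 < b / a := div_pos hb ha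
    refine ⟨√√(b / a), Real.sqrt_pos.2 (Real.sqrt_pos.2 hba), ?_⟩
    rw [← mul_assoc, ← mul_assoc, ← mul_inv, Real.mul_self_sqrt (Real.sqrt_nonneg _),
      eq_inv_mul_iff_mul_eq₀ (Real.sqrt_pos.2 hba).ne', ← mul_assoc,
      Real.mul_self_sqrt hba.le, div_mul_cancel₀ _ ha.ne']
  have hz' : (z : ℂ) ≠ 0 := by exact_mod_cast hz.ne'
  have hzab' : (z : ℂ) * (z * a) = (z : ℂ)⁻¹ * ((z : ℂ)⁻¹ * b) := by exact_mod_cast hzab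
  refine ⟨Y, rescalePairing p hz', fun f => ?_⟩
  rw [hX.scalar_spec f]
  change ((z : ℂ) • p.coevaluation') ≫ (hX.scalar f • 𝟙 X) ▷ Y ≫
    dagger ((z : ℂ) • p.coevaluation') = dagger ((z : ℂ)⁻¹ • p.evaluation') ≫
      Y ◁ (hX.scalar f • 𝟙 X) ≫ ((z : ℂ)⁻¹ • p.evaluation')
  simp only [MonoidalLinear.whiskerLeft_smul, MonoidalLinear.smul_whiskerRight, dagger_smul,
    Linear.comp_smul, Linear.smul_comp, id_whiskerRight, whiskerLeft_id, Category.id_comp, hcoev,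
    hev, smul_smul, Complex.star_def, Complex.conj_ofReal, map_inv₀]
  congr 1
  linear_combination hX.scalar f * hzab'

lemma IsStandard.exists_coevaluation_eq_catDim {X Y : C} {p : ExactPairing X Y}
    (hp : IsStandard p) : ∃ (Y : C) (p : ExactPairing X Y), IsStandard p ∧
      p.coevaluation' ≫ dagger p.coevaluation' = (catDim X : ℂ) • 𝟙 (𝟙_ C) := by
  have hunit : IsIrreducible (𝟙_ C) := RigidCStarTensorCategory.unit_irreducible
  have hreal : ∃ r : ℝ, p.coevaluation' ≫ dagger p.coevaluation' = (r : ℂ) • 𝟙 (𝟙_ C) := by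
    by_cases hcoev : p.coevaluation' = 0
    · exact ⟨0, by simp [hcoev]⟩
    · exact (hunit.exists_comp_dagger_eq hcoev).imp fun r hr => hr.2
  exact Classical.epsilon_spec (p := fun r : ℝ => ∃ (Y : C) (p : ExactPairing X Y),
    IsStandard p ∧ p.coevaluation' ≫ dagger p.coevaluation' = (r : ℂ) • 𝟙 (𝟙_ C))
    (hreal.imp fun r hr => ⟨Y, p, hp, hr⟩)

lemma Irr.exists_pairing (a : Irr C) : ∃ (Y : C) (p : ExactPairing a.obj Y), IsStandard p ∧
    p.coevaluation' ≫ dagger p.coevaluation' = (catDim a.obj : ℂ) • 𝟙 (𝟙_ C) := by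
  obtain ⟨Y, p, hp⟩ := a.obj_irreducible.exists_isStandard
  exact hp.exists_coevaluation_eq_catDim

/-- The dual object of a chosen standard pairing. -/
def Irr.dual (a : Irr C) : C := a.exists_pairing.choose

/-- A chosen standard pairing. -/
@[reducible] def Irr.pairing (a : Irr C) : ExactPairing a.obj a.dual :=
  a.exists_pairing.choose_spec.choose

lemma Irr.pairing_isStandard (a : Irr C) : IsStandard a.pairing :=
  a.exists_pairing.choose_spec.choose_spec.1

lemma Irr.pairing_coevaluation (a : Irr C) :
    a.pairing.coevaluation' ≫ dagger a.pairing.coevaluation' = (catDim a.obj : ℂ) • 𝟙 (𝟙_ C) :=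
  a.exists_pairing.choose_spec.choose_spec.2

lemma Irr.catDim_pos (a : Irr C) : 0 < catDim a.obj := by
  have hunit : IsIrreducible (𝟙_ C) := RigidCStarTensorCategory.unit_irreducible
  have hpos := hunit.scalar_comp_dagger_pos
    (coevaluation_ne_zero a.pairing a.obj_irreducible.id_ne_zero)
  rw [hunit.scalar_eq a.pairing_coevaluation] at hpos
  exact_mod_cast hpos

lemma Irr.rightTrace_pairing (a : Irr C) (f : a.obj ⟶ a.obj) :
    rightTrace a.pairing f = ((catDim a.obj : ℂ) * a.obj_irreducible.scalar f) • 𝟙 (𝟙_ C) := by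
  conv_lhs => rw [a.obj_irreducible.scalar_spec f]
  simp only [rightTrace, MonoidalLinear.smul_whiskerRight, Linear.comp_smul, Linear.smul_comp,
    id_whiskerRight, Category.id_comp, a.pairing_coevaluation, smul_smul]
  rw [mul_comm]

lemma Irr.leftTrace_pairing (a : Irr C) (f : a.obj ⟶ a.obj) :
    leftTrace a.pairing f = ((catDim a.obj : ℂ) * a.obj_irreducible.scalar f) • 𝟙 (𝟙_ C) :=
  (a.pairing_isStandard f).symm.trans (a.rightTrace_pairing f)

namespace IrrDecomp

variable {X Y : C} (D : IrrDecomp X)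

lemma catDim_mul_scalar_comp_dagger_nonneg (f : X ⟶ Y) (i : Fin D.n) :
    0 ≤ (catDim (D.irr i).obj : ℂ) *
      (D.irr i).obj_irreducible.scalar ((D.incl i ≫ f) ≫ dagger (D.incl i ≫ f)) :=
  mul_nonneg (by exact_mod_cast (D.irr i).catDim_pos.le)
    ((D.irr i).obj_irreducible.scalar_comp_dagger_nonneg _)

lemma tr_comp_dagger_nonneg (f : X ⟶ Y) : 0 ≤ D.tr (f ≫ dagger f) := by
  rw [tr_comp_dagger]
  exact Finset.sum_nonneg fun i _ => D.catDim_mul_scalar_comp_dagger_nonneg f i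

lemma eq_zero_of_tr {f : X ⟶ Y} (h : D.tr (f ≫ dagger f) = 0) : f = 0 := by
  rw [tr_comp_dagger, Finset.sum_eq_zero_iff_of_nonneg fun i _ =>
    D.catDim_mul_scalar_comp_dagger_nonneg f i] at h
  have hf i : D.incl i ≫ f = 0 := by
    refine (D.irr i).obj_irreducible.eq_zero_of_scalar ?_
    exact (mul_eq_zero.1 (h i (Finset.mem_univ i))).resolve_left
      (by exact_mod_cast (D.irr i).catDim_pos.ne')
  rw [← Category.id_comp f, ← D.isDirectSum.complete, Preadditive.sum_comp]
  simp [hf]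

lemma eq_of_tr_comp_eq {m n : X ⟶ X} (h : ∀ f, D.tr (m ≫ f) = D.tr (n ≫ f)) : m = n := by
  refine sub_eq_zero.1 (D.eq_zero_of_tr ?_)
  rw [Preadditive.sub_comp, map_sub, h, sub_self]

lemma eq_id_of_comp_self {m : X ⟶ X} (hm : m ≫ m = 𝟙 X)
    (hpos : ∀ f : X ⟶ X, 0 ≤ D.tr (m ≫ f ≫ dagger f)) : m = 𝟙 X := by
  have hanti : m ≫ (𝟙 X - m) = -(𝟙 X - m) := by
    rw [Preadditive.comp_sub, hm, Category.comp_id, neg_sub]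
  refine (sub_eq_zero.1 (D.eq_zero_of_tr ?_)).symm
  have h := hpos (𝟙 X - m)
  rw [← Category.assoc, hanti, Preadditive.neg_comp, map_neg] at h
  exact le_antisymm (neg_nonneg.1 h) (D.tr_comp_dagger_nonneg _)

lemma exists_pairing : ∃ (Y : C) (p : ExactPairing X Y),
    (∀ f, rightTrace p f = D.tr f • 𝟙 _) ∧ (∀ f, leftTrace p f = D.tr f • 𝟙 _) := by
  obtain ⟨Y, w, hw⟩ := exists_isDirectSum_fin D.n fun i => (D.irr i).dual
  refine ⟨Y, D.isDirectSum.pairing hw fun i => (D.irr i).pairing, fun f => ?_, fun f => ?_⟩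
  · rw [IsDirectSum.rightTrace_pairing, tr_apply, Finset.sum_smul]
    exact Finset.sum_congr rfl fun i _ => (D.irr i).rightTrace_pairing _
  · rw [IsDirectSum.leftTrace_pairing, tr_apply, Finset.sum_smul]
    exact Finset.sum_congr rfl fun i _ => (D.irr i).leftTrace_pairing _

end IrrDecomp

lemma exists_isStandard (X : C) : ∃ (Y : C) (p : ExactPairing X Y), IsStandard p := by
  obtain ⟨Y, p, hr, hl⟩ := (irrDecomp X).exists_pairing
  exact ⟨Y, p, fun f => (hr f).trans (hl f).symm⟩

lemma IsStandard.rightTrace_eq {X Y : C} {p : ExactPairing X Y} (hp : IsStandard p)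
    (D : IrrDecomp X) (f : X ⟶ X) : rightTrace p f = D.tr f • 𝟙 _ := by
  have hunit : IsIrreducible (𝟙_ C) := RigidCStarTensorCategory.unit_irreducible
  obtain ⟨Y₀, p₀, hright₀, hleft₀⟩ := D.exists_pairing
  obtain ⟨m, n, hmn, hright, hleft⟩ := exists_trace_comparison p p₀
  simp only [hright₀] at hright
  simp only [hleft₀] at hleft
  have hm_eq : m = n := D.eq_of_tr_comp_eq fun g => by
    rw [D.tr_comm D n g]
    exact hunit.smul_id_injective ((hright g).symm.trans ((hp g).trans (hleft g)))
  have hm : m = 𝟙 X := D.eq_id_of_comp_self (by rwa [← hm_eq] at hmn) fun g => by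
    rw [← hunit.scalar_eq (hright _), rightTrace_comp_dagger]
    exact hunit.scalar_comp_dagger_nonneg _
  rw [hright, hm, Category.id_comp]

lemma IsStandard.coevaluation_eq {X Y : C} {p : ExactPairing X Y} (hp : IsStandard p)
    (D : IrrDecomp X) : p.coevaluation' ≫ dagger p.coevaluation' =
      ((∑ i, catDim (D.irr i).obj : ℝ) : ℂ) • 𝟙 (𝟙_ C) := by
  rw [← D.tr_id, ← hp.rightTrace_eq D, rightTrace, id_whiskerRight, Category.id_comp]

lemma IrrDecomp.catDim_eq {X : C} (D : IrrDecomp X) :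
    catDim X = ∑ i, catDim (D.irr i).obj := by
  have hunit : IsIrreducible (𝟙_ C) := RigidCStarTensorCategory.unit_irreducible
  obtain ⟨Y, p, hp⟩ := exists_isStandard X
  obtain ⟨Y', p', hp', hcoev⟩ := hp.exists_coevaluation_eq_catDim
  exact_mod_cast hunit.smul_id_injective (hcoev.symm.trans (hp'.coevaluation_eq D))

lemma IsStandard.coevaluation_eq_catDim {X Y : C} {p : ExactPairing X Y} (hp : IsStandard p) :
    p.coevaluation' ≫ dagger p.coevaluation' = (catDim X : ℂ) • 𝟙 (𝟙_ C) := by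
  rw [hp.coevaluation_eq (irrDecomp X), (irrDecomp X).catDim_eq]

lemma IsStandard.catDim_eq_of_coevaluation {X Y : C} {p : ExactPairing X Y} (hp : IsStandard p)
    {r : ℝ} (h : p.coevaluation' ≫ dagger p.coevaluation' = (r : ℂ) • 𝟙 (𝟙_ C)) :
    catDim X = r := by
  have hunit : IsIrreducible (𝟙_ C) := RigidCStarTensorCategory.unit_irreducible
  exact_mod_cast hunit.smul_id_injective (hp.coevaluation_eq_catDim.symm.trans h)

lemma catDim_nonneg (X : C) : 0 ≤ catDim X := by
  rw [(irrDecomp X).catDim_eq]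
  exact Finset.sum_nonneg fun i _ => (Irr.catDim_pos _).le

lemma IsStandard.partialTraceRight_id {X' Y' : C} {q : ExactPairing X' Y'} (hq : IsStandard q)
    (X : C) : partialTraceRight q (𝟙 (X ⊗ X')) = (catDim X' : ℂ) • 𝟙 X := by
  calc _ = (ρ_ X).inv ≫ X ◁ (q.coevaluation' ≫ dagger q.coevaluation') ≫ (ρ_ X).hom := by
        simp [partialTraceRight]
    _ = _ := by
      rw [hq.coevaluation_eq_catDim]
      simp only [MonoidalLinear.whiskerLeft_smul, whiskerLeft_id, Linear.smul_comp,
        Linear.comp_smul, Category.id_comp, Iso.inv_hom_id]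

lemma catDim_tensor (X X' : C) : catDim (X ⊗ X') = catDim X * catDim X' := by
  obtain ⟨Y, p, hp⟩ := exists_isStandard X
  obtain ⟨Y', p', hp'⟩ := exists_isStandard X'
  refine (hp.tensor hp').catDim_eq_of_coevaluation ?_
  have htrace := rightTrace_tensor p p' (𝟙 _)
  rw [hp'.partialTraceRight_id] at htrace
  simp only [rightTrace, id_whiskerRight, Category.id_comp, MonoidalLinear.smul_whiskerRight,
    Linear.comp_smul, Linear.smul_comp, hp.coevaluation_eq_catDim, smul_smul] at htrace
  rw [htrace, mul_comm (catDim X), Complex.ofReal_mul]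

lemma IsStandard.catDim_dual {X Y : C} {p : ExactPairing X Y} (hp : IsStandard p) :
    catDim Y = catDim X := by
  refine hp.daggerPairing.catDim_eq_of_coevaluation ?_
  have htrace := hp (𝟙 X)
  simp only [id_whiskerRight, whiskerLeft_id, Category.id_comp] at htrace
  rw [← hp.coevaluation_eq_catDim, htrace]
  change dagger p.evaluation' ≫ dagger (dagger p.evaluation') = _
  rw [dagger_dagger]

lemma catDim_eq_of_inverse {X Y : C} {f : X ⟶ Y} {g : Y ⟶ X} (hfg : f ≫ g = 𝟙 X)
    (hgf : g ≫ f = 𝟙 Y) : catDim X = catDim Y := by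
  have htr := (irrDecomp X).tr_comm (irrDecomp Y) f g
  rw [hfg, hgf, IrrDecomp.tr_id, IrrDecomp.tr_id, ← IrrDecomp.catDim_eq,
    ← IrrDecomp.catDim_eq] at htr
  exact_mod_cast htr

lemma catDim_eq_of_pairing {X Y : C} (p : ExactPairing X Y) : catDim Y = catDim X := by
  obtain ⟨Z, q, hq⟩ := exists_isStandard X
  obtain ⟨T, hT⟩ := exists_right_mate p q (𝟙 X)
  obtain ⟨S, hS⟩ := exists_right_mate q p (𝟙 X)
  rw [← hq.catDim_dual]
  exact catDim_eq_of_inverse (hS.comp_eq_id hT) (hT.comp_eq_id hS)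

end StandardPairings

section Rotation

variable {C : Type u} [Category.{v} C] [MonoidalCategory C]

lemma rotate_injective {X Y X' Y' : C} (p : ExactPairing X' X) (q : ExactPairing Y Y')
    {S T : X ⊗ Y ⟶ X ⊗ Y} (h : (p.coevaluation' ⊗ₘ q.coevaluation') ≫ amplify X' Y' S =
      (p.coevaluation' ⊗ₘ q.coevaluation') ≫ amplify X' Y' T) : S = T := by
  let rotate : (X ⊗ Y ⟶ X ⊗ Y) ≃ _ := (@tensorLeftHomEquiv C _ _ Y X' X (X ⊗ Y) p).trans <|
    (Iso.homCongr (λ_ Y) (Iso.refl _)).symm.trans (@tensorRightHomEquiv C _ _ (𝟙_ C) Y Y' _ q)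
  have hrotate S : rotate S = (λ_ _).inv ≫
      ((p.coevaluation' ⊗ₘ q.coevaluation') ≫ amplify X' Y' S) ≫
        (α_ _ _ _).hom ≫ X' ◁ (α_ _ _ _).inv ≫ (α_ _ _ _).inv := by
    change (ρ_ _).inv ≫ _ ◁ q.coevaluation' ≫ (α_ _ _ _).inv ≫ ((λ_ Y).hom ≫ ((λ_ _).inv ≫
      p.coevaluation' ▷ _ ≫ (α_ _ _ _).hom ≫ _ ◁ S) ≫ 𝟙 _) ▷ _ = _
    rw [amplify, MonoidalCategory.tensorHom_def']
    monoidal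
  exact rotate.injective (by rw [hrotate, hrotate, h])

end Rotation

section MultiplierOfSymbol

variable {C : Type u} [Category.{v} C] [Preadditive C] [Linear ℂ C]
  [MonoidalCategory C] [MonoidalPreadditive C] [MonoidalLinear ℂ C] [CStarTensorCategory C]
  [RigidCStarTensorCategory C]

/-- The natural endomorphism acting as `φ a` on the `a`-isotypic component of an object. -/
def isotypic (φ : Irr C → ℂ) (X : C) : X ⟶ X :=
  ∑ i, φ ((irrDecomp X).irr i) • (dagger ((irrDecomp X).incl i) ≫ (irrDecomp X).incl i)

lemma isotypic_naturality (φ : Irr C → ℂ) {X Y : C} (f : X ⟶ Y) :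
    f ≫ isotypic φ Y = isotypic φ X ≫ f := by
  let D := irrDecomp X
  let E := irrDecomp Y
  have schur i j : φ (E.irr j) • (D.incl i ≫ f ≫ dagger (E.incl j)) =
      φ (D.irr i) • (D.incl i ≫ f ≫ dagger (E.incl j)) := by
    by_cases h : D.irr i = E.irr j
    · exact congrArg (fun a => φ a • (D.incl i ≫ f ≫ dagger (E.incl j))) h.symm
    · rw [Irr.hom_eq_zero h (D.incl i ≫ f ≫ _), smul_zero, smul_zero]
  calc f ≫ isotypic φ Y = (∑ i, dagger (D.incl i) ≫ D.incl i) ≫ f ≫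
        (∑ j, φ (E.irr j) • (dagger (E.incl j) ≫ E.incl j)) := by
          rw [D.isDirectSum.complete, Category.id_comp, isotypic]
    _ = ∑ i, ∑ j,
        dagger (D.incl i) ≫ (φ (E.irr j) • (D.incl i ≫ f ≫ dagger (E.incl j))) ≫ E.incl j := by
          simp only [Preadditive.sum_comp, Preadditive.comp_sum, Category.assoc, Linear.comp_smul,
            Linear.smul_comp, Finset.smul_sum]
          rw [Finset.sum_comm]
    _ = ∑ i, ∑ j,
        dagger (D.incl i) ≫ (φ (D.irr i) • (D.incl i ≫ f ≫ dagger (E.incl j))) ≫ E.incl j := by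
          simp only [schur]
    _ = (∑ i, φ (D.irr i) • (dagger (D.incl i) ≫ D.incl i)) ≫ f ≫
        (∑ j, dagger (E.incl j) ≫ E.incl j) := by
          simp only [Preadditive.sum_comp, Preadditive.comp_sum, Category.assoc, Linear.comp_smul,
            Linear.smul_comp]
          rw [Finset.sum_comm]
    _ = isotypic φ X ≫ f := by rw [E.isDirectSum.complete, Category.comp_id, isotypic]

lemma isotypic_of_irreducible (φ : Irr C → ℂ) {X : C} (hX : IsIrreducible X) :
    isotypic φ X = φ (Irr.mk X hX) • 𝟙 X := by
  let D := irrDecomp X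
  rw [isotypic, ← D.isDirectSum.complete, Finset.smul_sum]
  refine Finset.sum_congr rfl fun i _ => ?_
  have hincl : D.incl i ≠ 0 := fun h => (D.irr i).obj_irreducible.id_ne_zero <| by
    rw [← D.isDirectSum.isometry i, h, Limits.zero_comp]
  exact congrArg (fun a => φ a • (dagger (D.incl i) ≫ D.incl i))
    ((D.irr i).mk_eq_of_hom_ne_zero hX hincl)

/-- The chosen exact pairing between the conjugate of an object and the object. -/
@[reducible] def conjPairing (X : C) : ExactPairing (conj X) X :=
  daggerPairing (RigidCStarTensorCategory.exists_dual X).choose_spec.some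

/-- The evaluation of an internal hom. -/
def evalConj (X A : C) : X ⊗ (conj X ⊗ A) ⟶ A :=
  (α_ _ _ _).inv ≫ (conjPairing X).evaluation' ▷ A ≫ (λ_ A).hom

/-- Frobenius reciprocity. -/
def curryConj (X W A : C) : (X ⊗ W ⟶ A) →ₗ[ℂ] (W ⟶ conj X ⊗ A) where
  toFun f := (λ_ _).inv ≫ (conjPairing X).coevaluation' ▷ _ ≫ (α_ _ _ _).hom ≫ _ ◁ f
  map_add' f g := by simp [MonoidalPreadditive.whiskerLeft_add]
  map_smul' c f := by simp

lemma curryConj_evalConj {X W A : C} (f : X ⊗ W ⟶ A) :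
    X ◁ curryConj X W A f ≫ evalConj X A = f :=
  (@tensorLeftHomEquiv C _ _ W (conj X) X A (conjPairing X)).left_inv f

lemma curryConj_whiskerLeft_evalConj {X W A : C} (g : W ⟶ conj X ⊗ A) :
    curryConj X W A (X ◁ g ≫ evalConj X A) = g :=
  (@tensorLeftHomEquiv C _ _ W (conj X) X A (conjPairing X)).right_inv g

lemma evalConj_tensor (Z X Y : C) :
    Z ◁ (α_ (conj Z) X Y).hom ≫ evalConj Z (X ⊗ Y) = (α_ _ _ _).inv ≫ evalConj Z X ▷ Y := by
  simp [evalConj]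

/-- The action of a function on `Irr C` on the morphisms `Z ⊗ W ⟶ X ⊗ Y`: a morphism that factors
through `Z ⊗ V ⊗ Y`, as `W ⟶ V ⊗ Y` followed by `Z ⊗ V ⟶ X`, is modified by `isotypic φ V`. The
definition uses the universal choice `V = conj Z ⊗ X`. -/
def symbolMap (φ : Irr C → ℂ) (X Y Z W : C) : (Z ⊗ W ⟶ X ⊗ Y) →ₗ[ℂ] (Z ⊗ W ⟶ X ⊗ Y) where
  toFun T := Z ◁ (curryConj Z W (X ⊗ Y) T ≫ (α_ _ _ _).inv ≫ isotypic φ (conj Z ⊗ X) ▷ Y) ≫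
    (α_ _ _ _).inv ≫ evalConj Z X ▷ Y
  map_add' S T := by simp [Preadditive.add_comp, MonoidalPreadditive.whiskerLeft_add]
  map_smul' c T := by simp

lemma exists_factorization {X Y Z W : C} (T : Z ⊗ W ⟶ X ⊗ Y) :
    ∃ (V : C) (h : W ⟶ V ⊗ Y) (e : Z ⊗ V ⟶ X), T = Z ◁ h ≫ (α_ _ _ _).inv ≫ e ▷ Y := by
  refine ⟨conj Z ⊗ X, curryConj Z W (X ⊗ Y) T ≫ (α_ _ _ _).inv, evalConj Z X, ?_⟩
  rw [← evalConj_tensor, ← MonoidalCategory.whiskerLeft_comp_assoc, Category.assoc,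
    Iso.inv_hom_id, Category.comp_id, curryConj_evalConj]

lemma symbolMap_factorization (φ : Irr C → ℂ) {V X Y Z W : C} (h : W ⟶ V ⊗ Y) (e : Z ⊗ V ⟶ X) :
    symbolMap φ X Y Z W (Z ◁ h ≫ (α_ _ _ _).inv ≫ e ▷ Y) =
      Z ◁ (h ≫ isotypic φ V ▷ Y) ≫ (α_ _ _ _).inv ≫ e ▷ Y := by
  have huniversal : Z ◁ h ≫ (α_ _ _ _).inv ≫ e ▷ Y =
      Z ◁ (h ≫ curryConj Z V X e ▷ Y ≫ (α_ _ _ _).hom) ≫ evalConj Z (X ⊗ Y) := by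
    rw [MonoidalCategory.whiskerLeft_comp, MonoidalCategory.whiskerLeft_comp, Category.assoc,
      Category.assoc, evalConj_tensor]
    conv_lhs => rw [← curryConj_evalConj e]
    simp
  change Z ◁ (curryConj Z W (X ⊗ Y) _ ≫ (α_ _ _ _).inv ≫ isotypic φ (conj Z ⊗ X) ▷ Y) ≫
    (α_ _ _ _).inv ≫ evalConj Z X ▷ Y = _
  rw [huniversal, curryConj_whiskerLeft_evalConj]
  conv_rhs => rw [← curryConj_evalConj e]
  simp only [Category.assoc, Iso.hom_inv_id_assoc]
  rw [← comp_whiskerRight, isotypic_naturality]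
  simp

lemma symbolMap_comp (φ : Irr C → ℂ) {X₁ X₂ Y₁ Y₂ Z₁ Z₂ W₁ W₂ : C} (f : X₁ ⟶ X₂) (g : Y₁ ⟶ Y₂)
    (h : Z₂ ⟶ Z₁) (k : W₂ ⟶ W₁) (T : Z₁ ⊗ W₁ ⟶ X₁ ⊗ Y₁) :
    symbolMap φ X₂ Y₂ Z₂ W₂ ((h ⊗ₘ k) ≫ T ≫ (f ⊗ₘ g)) =
      (h ⊗ₘ k) ≫ symbolMap φ X₁ Y₁ Z₁ W₁ T ≫ (f ⊗ₘ g) := by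
  obtain ⟨V, a, e, rfl⟩ := exists_factorization T
  have hfactor (b : W₁ ⟶ V ⊗ Y₁) : (h ⊗ₘ k) ≫ (Z₁ ◁ b ≫ (α_ _ _ _).inv ≫ e ▷ Y₁) ≫ (f ⊗ₘ g) =
      Z₂ ◁ (k ≫ b ≫ V ◁ g) ≫ (α_ _ _ _).inv ≫ (h ▷ V ≫ e ≫ f) ▷ Y₂ := by
    calc _ = Z₂ ◁ k ≫ (h ▷ W₁ ≫ Z₁ ◁ b) ⊗≫ e ▷ Y₁ ≫ f ▷ Y₁ ≫ X₂ ◁ g := by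
          rw [MonoidalCategory.tensorHom_def', MonoidalCategory.tensorHom_def f]
          monoidal
      _ = Z₂ ◁ (k ≫ b) ⊗≫ ((h ▷ V ≫ e ≫ f) ▷ Y₁ ≫ X₂ ◁ g) := by
          rw [← whisker_exchange]
          monoidal
      _ = _ := by
          rw [← whisker_exchange]
          monoidal
  rw [hfactor, symbolMap_factorization, symbolMap_factorization, hfactor]
  simp [← whisker_exchange]

lemma symbolMap_amplify (φ : Irr C → ℂ) {X₁ Y₁ : C} (X₂ Y₂ : C) (T : X₁ ⊗ Y₁ ⟶ X₁ ⊗ Y₁) :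
    symbolMap φ _ _ _ _ (amplify X₂ Y₂ T) = amplify X₂ Y₂ (symbolMap φ _ _ _ _ T) := by
  obtain ⟨V, a, e, rfl⟩ := exists_factorization T
  have hfactor (b : Y₁ ⟶ V ⊗ Y₁) : amplify X₂ Y₂ (X₁ ◁ b ≫ (α_ _ _ _).inv ≫ e ▷ Y₁) =
      (X₂ ⊗ X₁) ◁ (b ▷ Y₂ ≫ (α_ _ _ _).hom) ≫ (α_ _ _ _).inv ≫
        ((α_ _ _ _).hom ≫ X₂ ◁ e) ▷ (Y₁ ⊗ Y₂) := by
    rw [amplify]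
    monoidal
  rw [hfactor, symbolMap_factorization, symbolMap_factorization, hfactor]
  simp

/-- The multiplier given by a function on `Irr C`. -/
def multiplierOfSymbol (φ : Irr C → ℂ) : Multiplier C where
  map X Y := symbolMap φ X Y X Y
  map_comp f g h k T := symbolMap_comp φ f g h k T
  map_amplify X₂ Y₂ T := symbolMap_amplify φ X₂ Y₂ T

lemma multiplierOfSymbol_hasSymbol (φ : Irr C → ℂ) : (multiplierOfSymbol φ).HasSymbol φ := by
  refine ⟨⟨symbolMap φ, fun _ _ => rfl, fun f g h k T => symbolMap_comp φ f g h k T⟩,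
    fun X Y hX _ w => ?_⟩
  have hfactor : w = 𝟙_ C ◁ ((λ_ _).inv ≫ w) ≫ (α_ _ _ _).inv ≫ (λ_ X).hom ▷ Y := by simp
  rw [hfactor]
  change symbolMap φ X Y (𝟙_ C) (𝟙_ C) _ = _
  rw [symbolMap_factorization, isotypic_of_irreducible φ hX]
  simp

namespace Multiplier.Extension

variable {θ : Multiplier C} (E : θ.Extension) {φ : Irr C → ℂ}

lemma map_obj (hE : ∀ (X Y : C) (hX : IsIrreducible X) (_ : ExactPairing X Y)
      (w : 𝟙_ C ⊗ 𝟙_ C ⟶ X ⊗ Y), E.map X Y (𝟙_ C) (𝟙_ C) w = φ (Irr.mk X hX) • w)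
    (a : Irr C) {Q : C} (w : 𝟙_ C ⊗ 𝟙_ C ⟶ a.obj ⊗ Q) :
    E.map a.obj Q (𝟙_ C) (𝟙_ C) w = φ a • w := by
  obtain ⟨g, hg⟩ := exists_coevaluation_whiskerLeft_eq a.pairing ((λ_ _).inv ≫ w)
  have hw : w = ((λ_ _).hom ≫ a.pairing.coevaluation') ≫ a.obj ◁ g := by
    rw [Category.assoc, hg, Iso.hom_inv_id_assoc]
  have hcomp :=
    E.map_comp (𝟙 a.obj) g (𝟙 (𝟙_ C)) (𝟙 (𝟙_ C)) ((λ_ _).hom ≫ a.pairing.coevaluation')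
  simp only [id_tensorHom, whiskerLeft_id, Category.id_comp] at hcomp
  rw [hw, hcomp, hE _ _ a.obj_irreducible a.pairing, Irr.mk_obj, Linear.smul_comp]

lemma map_unit (hE : ∀ (X Y : C) (hX : IsIrreducible X) (_ : ExactPairing X Y)
      (w : 𝟙_ C ⊗ 𝟙_ C ⟶ X ⊗ Y), E.map X Y (𝟙_ C) (𝟙_ C) w = φ (Irr.mk X hX) • w)
    {P Q : C} (w : 𝟙_ C ⊗ 𝟙_ C ⟶ P ⊗ Q) :
    E.map P Q (𝟙_ C) (𝟙_ C) w = w ≫ isotypic φ P ▷ Q := by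
  let D := irrDecomp P
  have hmap i : E.map P Q (𝟙_ C) (𝟙_ C) ((w ≫ dagger (D.incl i) ▷ Q) ≫ D.incl i ▷ Q) =
      φ (D.irr i) • ((w ≫ dagger (D.incl i) ▷ Q) ≫ D.incl i ▷ Q) := by
    have hcomp :=
      E.map_comp (D.incl i) (𝟙 Q) (𝟙 (𝟙_ C)) (𝟙 (𝟙_ C)) (w ≫ dagger (D.incl i) ▷ Q)
    simp only [tensorHom_id, id_whiskerRight, Category.id_comp] at hcomp
    rw [hcomp, E.map_obj hE, Linear.smul_comp]
  calc E.map P Q (𝟙_ C) (𝟙_ C) w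
      = E.map P Q (𝟙_ C) (𝟙_ C) (∑ i, (w ≫ dagger (D.incl i) ▷ Q) ≫ D.incl i ▷ Q) := by
        simp only [Category.assoc, ← comp_whiskerRight]
        rw [← Preadditive.comp_sum, ← sum_whiskerRight, D.isDirectSum.complete, id_whiskerRight,
          Category.comp_id]
    _ = ∑ i, φ (D.irr i) • ((w ≫ dagger (D.incl i) ▷ Q) ≫ D.incl i ▷ Q) := by
        rw [map_sum, Finset.sum_congr rfl fun i _ => hmap i]
    _ = w ≫ isotypic φ P ▷ Q := by
        rw [isotypic, sum_whiskerRight, Preadditive.comp_sum]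
        simp only [MonoidalLinear.smul_whiskerRight, comp_whiskerRight, Linear.comp_smul,
          Category.assoc]
        rfl

end Multiplier.Extension

lemma Multiplier.HasSymbol.coevaluation_comp_amplify_map {θ : Multiplier C} {φ : Irr C → ℂ}
    (hθ : θ.HasSymbol φ) {X X' Y Y' : C} (p : ExactPairing X' X) (q : ExactPairing Y Y')
    (T : X ⊗ Y ⟶ X ⊗ Y) :
    (p.coevaluation' ⊗ₘ q.coevaluation') ≫ amplify X' Y' (θ.map X Y T) =
      ((p.coevaluation' ⊗ₘ q.coevaluation') ≫ amplify X' Y' T) ≫ isotypic φ _ ▷ _ := by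
  obtain ⟨E, hE⟩ := hθ
  have hcomp := E.map_comp (𝟙 _) (𝟙 _) p.coevaluation' q.coevaluation' (amplify X' Y' T)
  simp only [id_tensorHom, whiskerLeft_id, Category.comp_id] at hcomp
  rw [← E.map_unit hE, ← θ.map_amplify, ← E.map_self, hcomp]

lemma Multiplier.HasSymbol.map_eq {θ : Multiplier C} {φ : Irr C → ℂ} (hθ : θ.HasSymbol φ)
    (X Y : C) (T : X ⊗ Y ⟶ X ⊗ Y) : θ.map X Y T = symbolMap φ X Y X Y T := by
  obtain ⟨Y', ⟨q⟩⟩ := RigidCStarTensorCategory.exists_dual Y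
  exact rotate_injective (conjPairing X) q <|
    (hθ.coevaluation_comp_amplify_map _ _ T).trans
      ((multiplierOfSymbol_hasSymbol φ).coevaluation_comp_amplify_map _ _ T).symm

end MultiplierOfSymbol

section TensorCoaction

variable {C : Type u} [Category.{v} C] [MonoidalCategory C]

/-- The morphism `k ⊗ 1`, for a coaction `k : A ⟶ T ⊗ A`. -/
def tensorCoaction {T A : C} (k : A ⟶ T ⊗ A) (Q : C) : A ⊗ Q ⟶ T ⊗ (A ⊗ Q) :=
  k ▷ Q ≫ (α_ _ _ _).hom

lemma whiskerLeft_tensorCoaction {T A : C} (k : A ⟶ T ⊗ A) {Q R : C} (g : Q ⟶ R) :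
    A ◁ g ≫ tensorCoaction k R = tensorCoaction k Q ≫ T ◁ (A ◁ g) := by
  rw [tensorCoaction, tensorCoaction, whisker_exchange_assoc]
  simp

end TensorCoaction

section TraceFormula

variable {C : Type u} [Category.{v} C] [Preadditive C] [Linear ℂ C]
  [MonoidalCategory C] [MonoidalPreadditive C] [MonoidalLinear ℂ C] [CStarTensorCategory C]

/-- The operator `f ↦ k₂* (1 ⊗ f) k₁`. -/
def sandwich {T N N' : C} (k₁ : N ⟶ T ⊗ N) (k₂ : N' ⟶ T ⊗ N') : (N ⟶ N') →ₗ[ℂ] (N ⟶ N') where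
  toFun f := k₁ ≫ T ◁ f ≫ dagger k₂
  map_add' f g := by simp [MonoidalPreadditive.whiskerLeft_add]
  map_smul' c f := by simp

lemma sandwich_apply {T N N' : C} (k₁ : N ⟶ T ⊗ N) (k₂ : N' ⟶ T ⊗ N') (f : N ⟶ N') :
    sandwich k₁ k₂ f = k₁ ≫ T ◁ f ≫ dagger k₂ := rfl

lemma sandwich_precomp {T A N : C} (k : A ⟶ T ⊗ A) (l : N ⟶ T ⊗ N) {Q R : C} (g : Q ⟶ R)
    (f : A ⊗ R ⟶ N) :
    sandwich (tensorCoaction k Q) l (A ◁ g ≫ f) = A ◁ g ≫ sandwich (tensorCoaction k R) l f := by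
  rw [sandwich_apply, sandwich_apply, ← Category.assoc (A ◁ g), whiskerLeft_tensorCoaction]
  simp

lemma sandwich_comp_leftUnitor_inv {A : C} (m : A ⟶ A) (Q : C) (f : A ⊗ Q ⟶ A) :
    sandwich (tensorCoaction (m ≫ (λ_ A).inv) Q) (m ≫ (λ_ A).inv) f = m ▷ Q ≫ f ≫ dagger m := by
  rw [sandwich_apply, tensorCoaction]
  simp

/-- The Frobenius transpose of a coaction. -/
def bend {A B T : C} (p : ExactPairing A B) (k : A ⟶ T ⊗ A) : A ⊗ B ⟶ T :=
  k ▷ B ≫ (α_ _ _ _).hom ≫ T ◁ dagger p.coevaluation' ≫ (ρ_ T).hom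

lemma bend_leftUnitor_inv {A B : C} (p : ExactPairing A B) :
    bend p (λ_ A).inv = dagger p.coevaluation' := by
  rw [bend]
  simp [unitors_inv_equal]

lemma exists_bend {A B T : C} (p : ExactPairing A B) (y : A ⊗ B ⟶ T) :
    ∃ k : A ⟶ T ⊗ A, bend p k = y := by
  let q := daggerPairing p
  exact ⟨(@tensorRightHomEquiv C _ _ A B A T q) y,
    (@tensorRightHomEquiv C _ _ A B A T q).left_inv y⟩

/-- The evaluation of the internal hom `B ⊗ A` given by the adjoint pairing. -/
def evalPair {A B : C} (p : ExactPairing A B) : A ⊗ (B ⊗ A) ⟶ A :=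
  (α_ _ _ _).inv ≫ dagger p.coevaluation' ▷ A ≫ (λ_ A).hom

/-- Frobenius reciprocity for the adjoint pairing. -/
def curryPair {A B : C} (p : ExactPairing A B) (Q : C) : (A ⊗ Q ⟶ A) →ₗ[ℂ] (Q ⟶ B ⊗ A) where
  toFun f := (λ_ _).inv ≫ dagger p.evaluation' ▷ _ ≫ (α_ _ _ _).hom ≫ _ ◁ f
  map_add' f g := by simp [MonoidalPreadditive.whiskerLeft_add]
  map_smul' c f := by simp

lemma curryPair_evalPair {A B Q : C} (p : ExactPairing A B) (f : A ⊗ Q ⟶ A) :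
    A ◁ curryPair p Q f ≫ evalPair p = f :=
  (@tensorLeftHomEquiv C _ _ Q B A A (daggerPairing p)).left_inv f

lemma curryPair_whiskerLeft_evalPair {A B Q : C} (p : ExactPairing A B) (g : Q ⟶ B ⊗ A) :
    curryPair p Q (A ◁ g ≫ evalPair p) = g :=
  (@tensorLeftHomEquiv C _ _ Q B A A (daggerPairing p)).right_inv g

lemma partialTraceLeft_comp_dagger {A B Q : C} (p : ExactPairing A B) (f g : A ⊗ Q ⟶ A) :
    partialTraceLeft p (f ≫ dagger g) = curryPair p Q f ≫ dagger (curryPair p Q g) := by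
  change _ = ((λ_ _).inv ≫ dagger p.evaluation' ▷ _ ≫ (α_ _ _ _).hom ≫ _ ◁ f) ≫
    dagger ((λ_ _).inv ≫ dagger p.evaluation' ▷ _ ≫ (α_ _ _ _).hom ≫ _ ◁ g)
  simp [partialTraceLeft]

lemma bend_comp_dagger {A B T : C} (p : ExactPairing A B) (k : A ⟶ T ⊗ A) :
    bend p k ≫ dagger (bend p k) = A ◁ ((ρ_ B).inv ≫ B ◁ p.coevaluation' ≫ (α_ _ _ _).inv) ≫
      (α_ _ _ _).inv ≫ (sandwich (tensorCoaction k (B ⊗ A)) k (evalPair p)) ▷ B := by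
  rw [sandwich_apply, tensorCoaction, evalPair, bend]
  simp only [dagger_comp, dagger_rightUnitor, dagger_whiskerLeft, dagger_dagger,
    dagger_associator, dagger_whiskerRight]
  symm
  calc _ = 𝟙 _ ⊗≫ ((A ⊗ B) ◁ p.coevaluation' ≫
        (k ▷ B ≫ (α_ _ _ _).hom ≫ T ◁ dagger p.coevaluation') ▷ (A ⊗ B)) ⊗≫ dagger k ▷ B := by
          monoidal
    _ = 𝟙 _ ⊗≫ ((k ▷ B ≫ (α_ _ _ _).hom ≫ T ◁ dagger p.coevaluation') ▷ 𝟙_ C ≫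
        (T ⊗ 𝟙_ C) ◁ p.coevaluation') ⊗≫ dagger k ▷ B := by rw [whisker_exchange]
    _ = _ := by monoidal

lemma coevaluation_expand {A B Q : C} (p : ExactPairing A B) (g : B ⊗ A ⟶ Q) :
    p.coevaluation' ≫ A ◁ (((ρ_ B).inv ≫ B ◁ p.coevaluation' ≫ (α_ _ _ _).inv) ≫ g ▷ B) ≫
      (α_ _ _ _).inv = p.coevaluation' ≫ (dagger (evalPair p) ≫ A ◁ g) ▷ B := by
  rw [evalPair]
  simp only [dagger_comp, dagger_leftUnitor, dagger_dagger, dagger_associator_inv,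
    dagger_whiskerRight]
  calc _ = 𝟙 _ ⊗≫ (p.coevaluation' ▷ 𝟙_ C ≫ (A ⊗ B) ◁ p.coevaluation') ⊗≫
        A ◁ g ▷ B ⊗≫ 𝟙 _ := by monoidal
    _ = 𝟙 _ ⊗≫ (𝟙_ C ◁ p.coevaluation' ≫ p.coevaluation' ▷ (A ⊗ B)) ⊗≫
        A ◁ g ▷ B ⊗≫ 𝟙 _ := by rw [whisker_exchange]
    _ = _ := by monoidal

lemma coevaluation_comp_sandwich {A B T Q : C} (p : ExactPairing A B) (k : A ⟶ T ⊗ A)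
    (U : Q ⟶ B ⊗ A) :
    p.coevaluation' ≫ (A ◁ (((ρ_ B).inv ≫ B ◁ p.coevaluation' ≫ (α_ _ _ _).inv) ≫
        (dagger U ≫ U) ▷ B) ≫ (α_ _ _ _).inv ≫
          sandwich (tensorCoaction k (B ⊗ A)) k (evalPair p) ▷ B) ≫ dagger p.coevaluation' =
      rightTrace p (dagger (A ◁ U ≫ evalPair p) ≫
        sandwich (tensorCoaction k Q) k (A ◁ U ≫ evalPair p)) := by
  have hexpand := coevaluation_expand p (dagger U)
  have hnaturality : A ◁ (((ρ_ B).inv ≫ B ◁ p.coevaluation' ≫ (α_ _ _ _).inv) ≫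
      (dagger U ≫ U) ▷ B) ≫ (α_ _ _ _).inv =
        (A ◁ (((ρ_ B).inv ≫ B ◁ p.coevaluation' ≫ (α_ _ _ _).inv) ≫ dagger U ▷ B) ≫
          (α_ _ _ _).inv) ≫ (A ◁ U) ▷ B := by
    simp
  rw [rightTrace, sandwich_precomp, dagger_comp, dagger_whiskerLeft]
  simp only [Category.assoc] at hnaturality hexpand ⊢
  rw [reassoc_of% hnaturality, reassoc_of% hexpand]
  simp

variable [RigidCStarTensorCategory C]

lemma isotypic_eq_sum_frame (φ : Irr C → ℂ) (X : C) {F : Finset (Irr C)}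
    (hF : ∀ i, (irrDecomp X).irr i ∈ F) :
    isotypic φ X =
      ∑ a ∈ F, φ a • ∑ i, dagger ((irrDecomp X).frame a i) ≫ (irrDecomp X).frame a i := by
  simp only [Finset.smul_sum]
  rw [Finset.sum_comm, isotypic]
  refine Finset.sum_congr rfl fun i _ => ?_
  rw [Finset.sum_eq_single_of_mem _ (hF i)]
  · simp [IrrDecomp.frame]
  · intro b _ hb
    simp [IrrDecomp.frame, Irr.cmp_of_ne hb]

lemma trace_eq_sum_scalar_frame {A B : C} (p : ExactPairing A B) (D : IrrDecomp (B ⊗ A)) (a : Irr C)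
    (S : (A ⊗ a.obj ⟶ A) →ₗ[ℂ] (A ⊗ a.obj ⟶ A)) :
    LinearMap.trace ℂ _ S = ∑ i, a.obj_irreducible.scalar
      (curryPair p a.obj (S (A ◁ D.frame a i ≫ evalPair p)) ≫ dagger (D.frame a i)) := by
  refine trace_eq_sum_of_frame (fun i => A ◁ D.frame a i ≫ evalPair p)
    (fun i => a.obj_irreducible.scalar.toLinearMap ∘ₗ Linear.rightComp ℂ a.obj
      (dagger (D.frame a i)) ∘ₗ curryPair p a.obj) (fun x => ?_) S
  conv_rhs => rw [← curryPair_evalPair p x, ← D.frame_expand (curryPair p _ x),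
    whiskerLeft_sum, Preadditive.sum_comp]
  refine Finset.sum_congr rfl fun i _ => ?_
  rw [MonoidalLinear.whiskerLeft_smul, Linear.smul_comp]
  rfl

lemma rightTrace_dagger_comp {A B : C} {p : ExactPairing A B} (hp : IsStandard p) (a : Irr C)
    (f g : A ⊗ a.obj ⟶ A) :
    rightTrace p (dagger g ≫ f) = ((catDim a.obj : ℂ) * a.obj_irreducible.scalar
      (curryPair p a.obj f ≫ dagger (curryPair p a.obj g))) • 𝟙 (𝟙_ C) := by
  have hs := hp.tensor a.pairing_isStandard
  rw [hp.rightTrace_eq (irrDecomp A), IrrDecomp.tr_comm _ (irrDecomp (A ⊗ a.obj)),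
    ← hs.rightTrace_eq, ← partialTraceLeft_comp_dagger, ← a.leftTrace_pairing,
    ← leftTrace_tensor p a.pairing]
  exact hs _

/-- The quadratic form of `φ : Irr C → ℂ` on the coactions `k : A ⟶ T ⊗ A`, summed over a finite set
`F` of classes; it computes the multiplier of symbol `φ` on positive elements. -/
def symbolForm (φ : Irr C → ℂ) {T A : C} (F : Finset (Irr C)) (k : A ⟶ T ⊗ A) : ℂ :=
  ∑ a ∈ F, φ a * (catDim a.obj * LinearMap.trace ℂ _ (sandwich (tensorCoaction k a.obj) k))

lemma symbolMap_bend {A B T : C} {p : ExactPairing A B} (hp : IsStandard p) (φ : Irr C → ℂ)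
    {F : Finset (Irr C)} (hF : ∀ i, (irrDecomp (B ⊗ A)).irr i ∈ F) (k : A ⟶ T ⊗ A) :
    p.coevaluation' ≫ symbolMap φ A B A B (bend p k ≫ dagger (bend p k)) ≫
      dagger p.coevaluation' = symbolForm φ F k • 𝟙 (𝟙_ C) := by
  rw [bend_comp_dagger, symbolMap_factorization, isotypic_eq_sum_frame φ _ hF, symbolForm,
    Finset.sum_smul]
  simp only [sum_whiskerRight, MonoidalLinear.smul_whiskerRight, whiskerLeft_sum,
    MonoidalLinear.whiskerLeft_smul, Preadditive.sum_comp, Preadditive.comp_sum, Linear.smul_comp,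
    Linear.comp_smul]
  refine Finset.sum_congr rfl fun a _ => ?_
  rw [mul_smul, trace_eq_sum_scalar_frame p (irrDecomp (B ⊗ A)), Finset.mul_sum, Finset.sum_smul]
  congr 1
  refine Finset.sum_congr rfl fun i _ => ?_
  rw [coevaluation_comp_sandwich, rightTrace_dagger_comp hp, curryPair_whiskerLeft_evalPair]

end TraceFormula

section GramMatrix

open scoped MatrixOrder Matrix.Norms.L2Operator in
lemma exists_gram_matrix {m : Type*} [Fintype m] (M : Matrix m m ℂ)
    (hM : ∀ x : m → ℂ, 0 ≤ ∑ i, ∑ j, star (x i) * M i j * x j) :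
    ∃ G : Matrix m m ℂ, ∀ i j, M i j = ∑ r, star (G r i) * G r j := by
  classical
  have hM_inner (v : EuclideanSpace ℂ m) : 0 ≤ inner ℂ (Matrix.toEuclideanLin M v) v := by
    rw [← inner_conj_symm, starRingEnd_apply, star_nonneg_iff,
      EuclideanSpace.inner_eq_star_dotProduct, dotProduct_comm]
    convert hM v.ofLp using 1
    simp [dotProduct, Matrix.mulVec, Finset.mul_sum, mul_assoc]
  have hM_posSemidef : M.PosSemidef := by
    rw [← Matrix.isPositive_toEuclideanLin_iff, LinearMap.isPositive_iff_complex]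
    intro v
    obtain ⟨hre, him⟩ := Complex.nonneg_iff.1 (hM_inner v)
    exact ⟨Complex.ext rfl him, hre⟩
  obtain ⟨G, hG⟩ := CStarAlgebra.nonneg_iff_eq_star_mul_self.1 hM_posSemidef.nonneg
  exact ⟨G, fun i j => by simp [hG, Matrix.mul_apply]⟩

end GramMatrix

section CompletePositivity

variable {C : Type u} [Category.{v} C] [Preadditive C] [Linear ℂ C]
  [MonoidalCategory C] [MonoidalPreadditive C] [MonoidalLinear ℂ C] [CStarTensorCategory C]

namespace IsDirectSum

variable {ι : Type*} [Fintype ι] {S : ι → C} {X Z : C} {p : ∀ i, S i ⟶ X}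

lemma comp_sum_dagger (hp : IsDirectSum p) (f : ∀ i, S i ⟶ Z) (i : ι) :
    p i ≫ ∑ j, dagger (p j) ≫ f j = f i := by
  rw [Preadditive.comp_sum, Finset.sum_eq_single_of_mem i (Finset.mem_univ i)]
  · rw [← Category.assoc, hp.isometry, Category.id_comp]
  · intro j _ hj
    rw [← Category.assoc, hp.orthogonal _ _ hj.symm, Limits.zero_comp]

lemma sum_comp_dagger_sum (hp : IsDirectSum p) (f g : ∀ i, Z ⟶ S i) :
    (∑ i, f i ≫ p i) ≫ dagger (∑ i, g i ≫ p i) = ∑ i, f i ≫ dagger (g i) := by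
  simp only [dagger_sum, dagger_comp, Preadditive.sum_comp, Category.assoc]
  refine Finset.sum_congr rfl fun i _ => ?_
  rw [hp.comp_sum_dagger fun j => dagger (g j)]

end IsDirectSum

lemma exists_gram_scalar_frame {Z : C} (D : IrrDecomp Z) {n : ℕ} (x : Fin n → Fin n → (Z ⟶ Z))
    (c : Irr C) (h : ∀ f : Fin n → (c.obj ⟶ Z),
      0 ≤ c.obj_irreducible.scalar (∑ i, ∑ j, f j ≫ x i j ≫ dagger (f i))) :
    ∃ G : Matrix (Fin n × Fin D.n) (Fin n × Fin D.n) ℂ, ∀ i j q r,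
      c.obj_irreducible.scalar (D.frame c q ≫ x i j ≫ dagger (D.frame c r)) =
        ∑ s, star (G s (i, r)) * G s (j, q) := by
  let M : Matrix (Fin n × Fin D.n) (Fin n × Fin D.n) ℂ := fun ip jq =>
    c.obj_irreducible.scalar (D.frame c jq.2 ≫ x ip.1 jq.1 ≫ dagger (D.frame c ip.2))
  obtain ⟨G, hG⟩ := exists_gram_matrix M fun y => by
    convert h (fun j => ∑ q, y (j, q) • D.frame c q) using 1
    simp only [Fintype.sum_prod_type, dagger_sum, dagger_smul, Preadditive.sum_comp,
      Preadditive.comp_sum, Linear.smul_comp, Linear.comp_smul, map_sum, map_smul, smul_eq_mul, M]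
    refine Finset.sum_congr rfl fun i _ => ?_
    rw [Finset.sum_comm]
    refine Finset.sum_congr rfl fun j _ => Finset.sum_congr rfl fun q _ => ?_
    rw [Finset.mul_sum]
    refine Finset.sum_congr rfl fun p _ => ?_
    ring
  exact ⟨G, fun i j q r => hG (i, r) (j, q)⟩

variable [RigidCStarTensorCategory C]

lemma exists_square_gram {Z : C} {n : ℕ} {R : Type*} [Fintype R] {S : R → C}
    (x : Fin n → Fin n → (Z ⟶ Z)) (B : ∀ r, Fin n → (Z ⟶ S r))
    (hx : ∀ i j, x i j = ∑ r, B r j ≫ dagger (B r i)) :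
    ∃ b : Fin n → Fin n → (Z ⟶ Z), ∀ i j, x i j = ∑ k, b k j ≫ dagger (b k i) := by
  obtain ⟨T, p, hp⟩ := exists_isDirectSum S
  obtain ⟨W, q, hq⟩ := exists_isDirectSum_fin n fun _ => Z
  let column (j : Fin n) : Z ⟶ T := ∑ r, B r j ≫ p r
  let f : W ⟶ T := ∑ j, dagger (q j) ≫ column j
  have hqf (j : Fin n) : q j ≫ f = column j := hq.comp_sum_dagger column j
  obtain ⟨g, hg⟩ := comp_dagger_positive f
  refine ⟨fun k j => q j ≫ g ≫ dagger (q k), fun i j => ?_⟩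
  calc x i j = column j ≫ dagger (column i) := by rw [hx, hp.sum_comp_dagger_sum]
    _ = q j ≫ (f ≫ dagger f) ≫ dagger (q i) := by
        rw [← hqf, ← hqf]
        simp
    _ = q j ≫ (g ≫ (∑ k, dagger (q k) ≫ q k) ≫ dagger g) ≫ dagger (q i) := by
        rw [hg, hq.complete]
        simp
    _ = _ := by
        simp [Preadditive.sum_comp, Preadditive.comp_sum]

lemma isotypic_one (X : C) : isotypic (fun _ => 1) X = 𝟙 X := by
  simp [isotypic, (irrDecomp X).isDirectSum.complete]

lemma expand_frame {Z Z' : C} (x : Z ⟶ Z') {F : Finset (Irr C)}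
    (hF : ∀ i, (irrDecomp Z).irr i ∈ F) :
    x = ∑ c ∈ F, ∑ q, ∑ r, c.obj_irreducible.scalar ((irrDecomp Z).frame c q ≫ x ≫
      dagger ((irrDecomp Z').frame c r)) • (dagger ((irrDecomp Z).frame c q) ≫
        (irrDecomp Z').frame c r) := by
  have hid := isotypic_eq_sum_frame (fun _ => (1 : ℂ)) Z hF
  rw [isotypic_one] at hid
  calc x = 𝟙 Z ≫ x := by simp
    _ = ∑ c ∈ F, ∑ q, dagger ((irrDecomp Z).frame c q) ≫ ((irrDecomp Z).frame c q ≫ x) := by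
      conv_lhs => rw [hid]
      simp [Preadditive.sum_comp]
    _ = _ := by
      refine Finset.sum_congr rfl fun c _ => Finset.sum_congr rfl fun q _ => ?_
      conv_lhs => rw [← (irrDecomp Z').frame_expand ((irrDecomp Z).frame c q ≫ x)]
      simp [Preadditive.comp_sum]

lemma exists_gram_of_forall {Z : C} {n : ℕ} (x : Fin n → Fin n → (Z ⟶ Z))
    (h : ∀ (c : Irr C) (f : Fin n → (c.obj ⟶ Z)),
      0 ≤ c.obj_irreducible.scalar (∑ i, ∑ j, f j ≫ x i j ≫ dagger (f i))) :
    ∃ b : Fin n → Fin n → (Z ⟶ Z), ∀ i j, x i j = ∑ k, b k j ≫ dagger (b k i) := by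
  classical
  let D := irrDecomp Z
  choose G hG using fun c => exists_gram_scalar_frame D x c (h c)
  let F : Finset (Irr C) := Finset.univ.image D.irr
  refine exists_square_gram (R := F × (Fin n × Fin D.n)) (S := fun r => (r.1 : Irr C).obj) x
    (fun r j => ∑ q, G r.1 r.2 (j, q) • dagger (D.frame r.1 q)) fun i j => ?_
  rw [expand_frame (x i j) (F := F) (fun i => Finset.mem_image_of_mem _ (Finset.mem_univ i)),
    Fintype.sum_prod_type, ← Finset.sum_coe_sort F]
  refine Finset.sum_congr rfl fun c _ => ?_
  have hscalar := hG (c : Irr C) i j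
  simp only [D] at hscalar
  simp only [hscalar, Finset.sum_smul, dagger_sum, dagger_smul, dagger_dagger, Preadditive.sum_comp,
    Preadditive.comp_sum, Linear.smul_comp, Linear.comp_smul, Finset.smul_sum, smul_smul]
  rw [Finset.sum_comm]
  conv_rhs => rw [Finset.sum_comm]
  refine Finset.sum_congr rfl fun r _ => ?_
  rw [Finset.sum_comm]

lemma symbolMap_whiskerRight (φ : Irr C → ℂ) {X Y : C} (Q : C) (S : X ⊗ Y ⟶ X ⊗ Y) :
    symbolMap φ X (Y ⊗ Q) X (Y ⊗ Q) ((α_ _ _ _).inv ≫ S ▷ Q ≫ (α_ _ _ _).hom) =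
      (α_ _ _ _).inv ≫ symbolMap φ X Y X Y S ▷ Q ≫ (α_ _ _ _).hom := by
  obtain ⟨V, a, e, rfl⟩ := exists_factorization S
  have hfactor (b : Y ⟶ V ⊗ Y) : (α_ _ _ _).inv ≫ (X ◁ b ≫ (α_ _ _ _).inv ≫ e ▷ Y) ▷ Q ≫
      (α_ _ _ _).hom = X ◁ (b ▷ Q ≫ (α_ _ _ _).hom) ≫ (α_ _ _ _).inv ≫ e ▷ (Y ⊗ Q) := by
    monoidal
  rw [hfactor, symbolMap_factorization, symbolMap_factorization, hfactor]
  simp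

lemma IsCpMultiplier.map_nonneg {φ : Irr C → ℂ} (hφ : IsCpMultiplier φ) {A B T : C}
    (w : 𝟙_ C ⟶ A ⊗ B) (y : A ⊗ B ⟶ T) :
    0 ≤ (RigidCStarTensorCategory.unit_irreducible (C := C)).scalar
      (w ≫ symbolMap φ A B A B (y ≫ dagger y) ≫ dagger w) := by
  obtain ⟨θ, hθ, hpos⟩ := hφ
  obtain ⟨g, hg⟩ := comp_dagger_positive y
  obtain ⟨b, hb⟩ := hpos A B 1 fun _ _ => g
  have hb : θ.map A B (g ≫ dagger g) = b 0 0 ≫ dagger (b 0 0) := by simpa using hb 0 0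
  rw [hg, ← hθ.map_eq, hb]
  simpa using (RigidCStarTensorCategory.unit_irreducible (C := C)).scalar_comp_dagger_nonneg
    (w ≫ b 0 0)

lemma IsCpMultiplier.symbolForm_nonneg {φ : Irr C → ℂ} (hφ : IsCpMultiplier φ) {A B T : C}
    {p : ExactPairing A B} (hp : IsStandard p) {F : Finset (Irr C)}
    (hF : ∀ i, (irrDecomp (B ⊗ A)).irr i ∈ F) (k : A ⟶ T ⊗ A) : 0 ≤ symbolForm φ F k := by
  have h := hφ.map_nonneg p.coevaluation' (bend p k)
  rwa [symbolMap_bend hp φ hF, map_smul, IsIrreducible.scalar_id, smul_eq_mul, mul_one] at h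

lemma rightTrace_symbolMap (φ : Irr C → ℂ) {X B Y Z Z' W : C} (p : ExactPairing X B)
    (q : ExactPairing Z Z') {f f' : Z ⟶ X ⊗ Y} {g g' : B ⟶ Y ⊗ Z'}
    (hg : p.coevaluation' ≫ X ◁ g = q.coevaluation' ≫ f ▷ Z' ≫ (α_ _ _ _).hom)
    (hg' : p.coevaluation' ≫ X ◁ g' = q.coevaluation' ≫ f' ▷ Z' ≫ (α_ _ _ _).hom)
    (a a' : X ⊗ Y ⟶ W) :
    rightTrace q (f ≫ symbolMap φ X Y X Y (a ≫ dagger a') ≫ dagger f') =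
      p.coevaluation' ≫ symbolMap φ X B X B ((X ◁ g ≫ (α_ _ _ _).inv ≫ a ▷ Z') ≫
        dagger (X ◁ g' ≫ (α_ _ _ _).inv ≫ a' ▷ Z')) ≫ dagger p.coevaluation' := by
  have hfactor : (X ◁ g ≫ (α_ _ _ _).inv ≫ a ▷ Z') ≫
      dagger (X ◁ g' ≫ (α_ _ _ _).inv ≫ a' ▷ Z') = (𝟙 X ⊗ₘ g) ≫
        ((α_ X Y Z').inv ≫ (a ≫ dagger a') ▷ Z' ≫ (α_ _ _ _).hom) ≫ (𝟙 X ⊗ₘ dagger g') := by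
    simp
  have hg'_dagger := congrArg dagger hg'
  simp only [dagger_comp, dagger_whiskerLeft, dagger_associator, dagger_whiskerRight,
    Category.assoc] at hg'_dagger
  rw [hfactor, symbolMap_comp, symbolMap_whiskerRight, id_tensorHom, id_tensorHom, rightTrace]
  simp only [Category.assoc]
  rw [hg'_dagger, ← Category.assoc p.coevaluation', hg]
  simp

lemma scalar_sum_symbolMap_nonneg {φ : Irr C → ℂ}
    (hφ : ∀ {A B T : C} {p : ExactPairing A B} (_ : IsStandard p) (k : A ⟶ T ⊗ A),
      ∃ F : Finset (Irr C), (∀ i, (irrDecomp (B ⊗ A)).irr i ∈ F) ∧ 0 ≤ symbolForm φ F k)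
    {X Y W : C} (c : Irr C) {n : ℕ} (f : Fin n → (c.obj ⟶ X ⊗ Y)) (a : Fin n → (X ⊗ Y ⟶ W)) :
    0 ≤ c.obj_irreducible.scalar
      (∑ i, ∑ j, f j ≫ symbolMap φ X Y X Y (a j ≫ dagger (a i)) ≫ dagger (f i)) := by
  obtain ⟨B, p, hp⟩ := exists_isStandard X
  choose g hg using fun j => exists_coevaluation_whiskerLeft_eq p
    (c.pairing.coevaluation' ≫ f j ▷ c.dual ≫ (α_ _ _ _).hom)
  let y : X ⊗ B ⟶ W ⊗ c.dual := ∑ j, X ◁ g j ≫ (α_ _ _ _).inv ≫ a j ▷ c.dual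
  obtain ⟨l, hl⟩ := exists_bend p y
  obtain ⟨F, hF, hform⟩ := hφ hp l
  have htrace : rightTrace c.pairing
      (∑ i, ∑ j, f j ≫ symbolMap φ X Y X Y (a j ≫ dagger (a i)) ≫ dagger (f i)) =
        p.coevaluation' ≫ symbolMap φ X B X B (y ≫ dagger y) ≫ dagger p.coevaluation' := by
    simp only [rightTrace, y, dagger_sum, Preadditive.sum_comp, Preadditive.comp_sum, map_sum,
      sum_whiskerRight]
    exact Finset.sum_congr rfl fun i _ => Finset.sum_congr rfl fun j _ =>
      rightTrace_symbolMap φ p c.pairing (hg j) (hg i) (a j) (a i)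
  rw [c.rightTrace_pairing, ← hl, symbolMap_bend hp φ hF l] at htrace
  rw [← RigidCStarTensorCategory.unit_irreducible.smul_id_injective htrace] at hform
  have hdim : (0 : ℂ) < (catDim c.obj : ℂ) := by exact_mod_cast c.catDim_pos
  exact le_of_mul_le_mul_left (by rwa [mul_zero]) hdim

lemma isCpMultiplier_of_symbolForm_nonneg {φ : Irr C → ℂ}
    (hφ : ∀ {A B T : C} {p : ExactPairing A B} (_ : IsStandard p) (k : A ⟶ T ⊗ A),
      ∃ F : Finset (Irr C), (∀ i, (irrDecomp (B ⊗ A)).irr i ∈ F) ∧ 0 ≤ symbolForm φ F k) :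
    IsCpMultiplier φ := by
  refine ⟨multiplierOfSymbol φ, multiplierOfSymbol_hasSymbol φ, fun X Y n a => ?_⟩
  change ∃ b : Fin n → Fin n → (X ⊗ Y ⟶ X ⊗ Y), ∀ i j,
    symbolMap φ X Y X Y (∑ k, a k j ≫ dagger (a k i)) = ∑ k, b k j ≫ dagger (b k i)
  refine exists_gram_of_forall _ fun c f => ?_
  have hsum : (∑ i, ∑ j, f j ≫ symbolMap φ X Y X Y (∑ k, a k j ≫ dagger (a k i)) ≫
      dagger (f i)) =
        ∑ k, ∑ i, ∑ j, f j ≫ symbolMap φ X Y X Y (a k j ≫ dagger (a k i)) ≫ dagger (f i) := by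
    simp only [map_sum, Preadditive.sum_comp, Preadditive.comp_sum]
    conv_rhs => rw [Finset.sum_comm]
    refine Finset.sum_congr rfl fun i _ => ?_
    rw [Finset.sum_comm]
  rw [hsum, map_sum]
  exact Finset.sum_nonneg fun k _ => scalar_sum_symbolMap_nonneg hφ c f (a k)

end CompletePositivity

section FinrankHom

variable {C : Type u} [Category.{v} C] [Preadditive C] [Linear ℂ C]

lemma finrank_hom_congr_right (W : C) {X Y : C} (e : X ≅ Y) :
    Module.finrank ℂ (W ⟶ X) = Module.finrank ℂ (W ⟶ Y) :=
  LinearEquiv.finrank_eq (LinearEquiv.ofLinearMap (Linear.rightComp ℂ W e.hom)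
    (Linear.rightComp ℂ W e.inv) (by ext; simp) (by ext; simp))

lemma mult_congr (c : Irr C) {X Y : C} (e : X ≅ Y) : mult c X = mult c Y :=
  finrank_hom_congr_right _ e

variable [MonoidalCategory C] [MonoidalPreadditive C] [MonoidalLinear ℂ C]

lemma finrank_tensorRight {X Y : C} (q : ExactPairing X Y) (W A : C) :
    Module.finrank ℂ (W ⊗ X ⟶ A) = Module.finrank ℂ (W ⟶ A ⊗ Y) :=
  LinearEquiv.finrank_eq { @tensorRightHomEquiv C _ _ W X Y A q with
    map_add' := by simp [tensorRightHomEquiv]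
    map_smul' := by simp [tensorRightHomEquiv] }

variable [CStarTensorCategory C]

lemma finrank_hom_symm (X Y : C) : Module.finrank ℂ (X ⟶ Y) = Module.finrank ℂ (Y ⟶ X) := by
  have h := rank_eq_of_equiv_equiv (R := ℂ) (R' := ℂ) (M := X ⟶ Y) (M₁ := Y ⟶ X) star
    { daggerHom X Y with
      invFun := dagger
      left_inv := fun f => dagger_dagger f
      right_inv := fun f => dagger_dagger f }
    star_involutive.bijective fun r f => dagger_smul r f
  exact congrArg Cardinal.toNat h

lemma finrank_hom_congr_left (W : C) {X Y : C} (e : X ≅ Y) :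
    Module.finrank ℂ (X ⟶ W) = Module.finrank ℂ (Y ⟶ W) := by
  rw [finrank_hom_symm, finrank_hom_congr_right W e, finrank_hom_symm]

open Classical in
lemma mult_obj (b c : Irr C) : mult c b.obj = if c = b then 1 else 0 := by
  split_ifs with h
  · subst h
    exact c.obj_irreducible
  · have : Subsingleton (c.obj ⟶ b.obj) :=
      ⟨fun f g => by rw [Irr.hom_eq_zero h f, Irr.hom_eq_zero h g]⟩
    exact Module.finrank_zero_of_subsingleton

end FinrankHom

section Multiplicities

variable {C : Type u} [Category.{v} C] [Preadditive C] [Linear ℂ C]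
  [MonoidalCategory C] [MonoidalPreadditive C] [MonoidalLinear ℂ C] [CStarTensorCategory C]
  [RigidCStarTensorCategory C]

lemma finrank_tensorLeft (X W A : C) :
    Module.finrank ℂ (X ⊗ W ⟶ A) = Module.finrank ℂ (W ⟶ conj X ⊗ A) :=
  LinearEquiv.finrank_eq { curryConj X W A with
    invFun := fun g => X ◁ g ≫ evalConj X A
    left_inv := curryConj_evalConj
    right_inv := curryConj_whiskerLeft_evalConj }

lemma mult_conj_tensor (X : C) (b c : Irr C) :
    mult b (conj X ⊗ c.obj) = mult c (X ⊗ b.obj) := by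
  rw [mult, mult, ← finrank_tensorLeft, finrank_hom_symm]

lemma mult_tensor_dual (a b c : Irr C) :
    mult c (a.obj ⊗ b.dual) = mult a (c.obj ⊗ b.obj) := by
  rw [mult, mult, finrank_hom_symm a.obj, finrank_tensorRight b.pairing]

lemma mult_conj_conj_tensor (X Y : C) (b c : Irr C) :
    mult b (conj (X ⊗ Y) ⊗ c.obj) = mult b (conj Y ⊗ (conj X ⊗ c.obj)) := by
  rw [mult, mult, ← finrank_tensorLeft, ← finrank_tensorLeft, ← finrank_tensorLeft,
    finrank_hom_congr_left _ (α_ _ _ _)]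

lemma IsDirectSum.mult_eq_sum {X : C} {ι : Type*} [Fintype ι] {S : ι → C} {p : ∀ i, S i ⟶ X}
    (hp : IsDirectSum p) (c : Irr C) : (mult c X : ℂ) = ∑ i, (mult c (S i) : ℂ) := by
  have h := trace_eq_sum_trace (fun i => Linear.rightComp ℂ c.obj (p i))
    (fun i => Linear.rightComp ℂ c.obj (dagger (p i))) (fun x => ?_) (fun i y => ?_) LinearMap.id
    (fun i => LinearMap.id) (fun i x => rfl)
  · simpa [mult] using h
  · simp [← Preadditive.comp_sum, hp.complete]
  · simp [hp.isometry]

lemma IrrDecomp.sum_eq {X : C} (D : IrrDecomp X) {M : Type*} [AddCommMonoid M] [Module ℂ M]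
    (f : Irr C → M) {F : Finset (Irr C)} (hF : ∀ i, D.irr i ∈ F) :
    ∑ i, f (D.irr i) = ∑ c ∈ F, (mult c X : ℂ) • f c := by
  classical
  simp only [D.mult_eq, Finset.sum_smul]
  rw [Finset.sum_comm]
  refine Finset.sum_congr rfl fun i _ => ?_
  simp [hF i]

/-- The irreducible objects that occur in an object. -/
def irrSupport (X : C) : Finset (Irr C) := by
  classical exact Finset.univ.image (irrDecomp X).irr

lemma mem_irrSupport (X : C) (i) : (irrDecomp X).irr i ∈ irrSupport X := by
  classical exact Finset.mem_image_of_mem _ (Finset.mem_univ i)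

lemma mult_eq_zero_of_notMem {X : C} {F : Finset (Irr C)} (hF : irrSupport X ⊆ F) {c : Irr C}
    (hc : c ∉ F) : mult c X = 0 := by
  classical
  have h := (irrDecomp X).mult_eq c
  rw [Finset.sum_eq_zero] at h
  · exact_mod_cast h
  · intro i _
    rw [if_neg]
    rintro rfl
    exact hc (hF (mem_irrSupport X i))

lemma mult_tensor_right_eq {X : C} (Y : C) (b : Irr C) {F : Finset (Irr C)}
    (hF : irrSupport X ⊆ F) :
    (mult b (Y ⊗ X) : ℂ) = ∑ c ∈ F, (mult c X : ℂ) * mult b (Y ⊗ c.obj) := by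
  rw [((irrDecomp X).isDirectSum.whiskerLeft Y).mult_eq_sum b,
    (irrDecomp X).sum_eq (fun c => (mult b (Y ⊗ c.obj) : ℂ))
    fun i => hF (mem_irrSupport X i)]
  rfl

lemma mult_tensor_left_eq {X : C} (Y : C) (b : Irr C) {F : Finset (Irr C)}
    (hF : irrSupport X ⊆ F) :
    (mult b (X ⊗ Y) : ℂ) = ∑ c ∈ F, (mult c X : ℂ) * mult b (c.obj ⊗ Y) := by
  rw [((irrDecomp X).isDirectSum.whiskerRight Y).mult_eq_sum b,
    (irrDecomp X).sum_eq (fun c => (mult b (c.obj ⊗ Y) : ℂ))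
    fun i => hF (mem_irrSupport X i)]
  rfl

variable (C) in
/-- The class of the tensor unit. -/
def Irr.unit : Irr C := Irr.mk (𝟙_ C) RigidCStarTensorCategory.unit_irreducible

open Classical in
lemma mult_tensor_unit (b c : Irr C) :
    mult c (b.obj ⊗ (Irr.unit C).obj) = if c = b then 1 else 0 := by
  obtain ⟨e⟩ : Nonempty ((Irr.unit C).obj ≅ 𝟙_ C) := Irr.nonempty_iso_mk _
  rw [mult_congr c (whiskerLeftIso b.obj e ≪≫ ρ_ _), mult_obj]

open Classical in
lemma mult_unit_tensor (b c : Irr C) :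
    mult c ((Irr.unit C).obj ⊗ b.obj) = if c = b then 1 else 0 := by
  obtain ⟨e⟩ : Nonempty ((Irr.unit C).obj ≅ 𝟙_ C) := Irr.nonempty_iso_mk _
  rw [mult_congr c (whiskerRightIso e b.obj ≪≫ λ_ _), mult_obj]

end Multiplicities

section Positivity

variable {C : Type u} [Category.{v} C] [Preadditive C] [Linear ℂ C]
  [MonoidalCategory C] [MonoidalPreadditive C] [MonoidalLinear ℂ C] [CStarTensorCategory C]
  [RigidCStarTensorCategory C]

lemma trace_sandwich_eq_sum {T A : C} (k : A ⟶ T ⊗ A) {Q : C} (D : IrrDecomp Q) :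
    LinearMap.trace ℂ _ (sandwich (tensorCoaction k Q) k) =
      ∑ i, LinearMap.trace ℂ _ (sandwich (tensorCoaction k (D.irr i).obj) k) := by
  refine trace_eq_sum_trace (fun i => Linear.leftComp ℂ A (A ◁ dagger (D.incl i)))
    (fun i => Linear.leftComp ℂ A (A ◁ D.incl i)) (fun x => ?_) (fun i y => ?_) _ _ fun i x => ?_
  · simp only [Linear.leftComp_apply, ← MonoidalCategory.whiskerLeft_comp_assoc]
    rw [← Preadditive.sum_comp, ← whiskerLeft_sum, D.isDirectSum.complete]
    simp
  · simp only [Linear.leftComp_apply, ← MonoidalCategory.whiskerLeft_comp_assoc,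
      D.isDirectSum.isometry]
    simp
  · simp only [Linear.leftComp_apply, sandwich_precomp]

lemma trace_sandwich_tensor_dual {T A : C} (k : A ⟶ T ⊗ A) (c b : Irr C) :
    LinearMap.trace ℂ _ (sandwich (tensorCoaction k (c.obj ⊗ b.dual)) k) =
      LinearMap.trace ℂ _ (sandwich (tensorCoaction k c.obj) (tensorCoaction k b.obj)) := by
  let q := daggerPairing b.pairing
  let e₀ := @tensorRightHomEquiv C _ _ (A ⊗ c.obj) b.dual b.obj A q
  have he₀ : ∀ f, e₀ f = (ρ_ _).inv ≫ _ ◁ q.coevaluation' ≫ (α_ _ _ _).inv ≫ f ▷ b.obj :=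
    fun f => rfl
  let e₁ : (A ⊗ (c.obj ⊗ b.dual) ⟶ A) ≃ₗ[ℂ] (A ⊗ c.obj ⟶ A ⊗ b.obj) :=
    { toFun := fun f => e₀ ((α_ _ _ _).hom ≫ f)
      invFun := fun g => (α_ _ _ _).inv ≫ e₀.symm g
      left_inv := fun f => by simp
      right_inv := fun g => by simp
      map_add' := fun f g => by simp [he₀]
      map_smul' := fun c f => by simp [he₀] }
  rw [← LinearMap.trace_conj' _ e₁]
  congr 1
  refine LinearMap.ext fun g => ?_
  obtain ⟨f, rfl⟩ := e₁.surjective g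
  rw [LinearEquiv.conj_apply_apply, LinearEquiv.symm_apply_apply]
  change e₀ ((α_ _ _ _).hom ≫ sandwich (tensorCoaction k (c.obj ⊗ b.dual)) k f) =
    sandwich (tensorCoaction k c.obj) (tensorCoaction k b.obj) (e₀ ((α_ _ _ _).hom ≫ f))
  rw [he₀, he₀, sandwich_apply, sandwich_apply]
  simp only [tensorCoaction, dagger_comp, dagger_whiskerRight, dagger_associator]
  symm
  calc _ = 𝟙 _ ⊗≫ ((k ▷ c.obj) ▷ 𝟙_ C ≫ ((T ⊗ A) ⊗ c.obj) ◁ q.coevaluation') ⊗≫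
        T ◁ f ▷ b.obj ⊗≫ dagger k ▷ b.obj := by monoidal
    _ = 𝟙 _ ⊗≫ ((A ⊗ c.obj) ◁ q.coevaluation' ≫ (k ▷ c.obj) ▷ (b.dual ⊗ b.obj)) ⊗≫
        T ◁ f ▷ b.obj ⊗≫ dagger k ▷ b.obj := by rw [whisker_exchange]
    _ = _ := by monoidal

/-- The `g`-component of a coaction. -/
def coactionComponent {T N : C} (k : N ⟶ T ⊗ N) (g : Irr C) : g.obj ⟶ T ⊗ g.obj :=
  ∑ j, (irrDecomp N).frame g j ≫ k ≫ T ◁ dagger ((irrDecomp N).frame g j)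

lemma trace_sandwich {T N N' : C} (k : N ⟶ T ⊗ N) (l : N' ⟶ T ⊗ N') {G : Finset (Irr C)}
    (hG : irrSupport N ⊆ G) :
    LinearMap.trace ℂ _ (sandwich k l) = ∑ g ∈ G,
      g.obj_irreducible.scalar (coactionComponent k g ≫ dagger (coactionComponent l g)) := by
  rw [trace_eq_sum_of_frame (ι := G × Fin (irrDecomp N).n × Fin (irrDecomp N').n)
    (fun x => dagger ((irrDecomp N).frame x.1 x.2.1) ≫ (irrDecomp N').frame x.1 x.2.2)
    (fun x => (x.1 : Irr C).obj_irreducible.scalar.toLinearMap ∘ₗ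
      Linear.leftComp ℂ _ ((irrDecomp N).frame x.1 x.2.1) ∘ₗ
      Linear.rightComp ℂ _ (dagger ((irrDecomp N').frame x.1 x.2.2))) (fun x => ?_),
    Fintype.sum_prod_type, ← Finset.sum_coe_sort G]
  · refine Finset.sum_congr rfl fun g _ => ?_
    rw [Fintype.sum_prod_type]
    simp only [coactionComponent, dagger_sum, Preadditive.sum_comp, Preadditive.comp_sum, map_sum,
      LinearMap.comp_apply, Linear.leftComp_apply, Linear.rightComp_apply, sandwich_apply]
    conv_rhs => rw [Finset.sum_comm]
    simp
  · rw [Fintype.sum_prod_type, Finset.sum_coe_sort G (fun g => ∑ y : Fin _ × Fin _,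
      ((g.obj_irreducible.scalar.toLinearMap ∘ₗ Linear.leftComp ℂ _ ((irrDecomp N).frame g y.1) ∘ₗ
      Linear.rightComp ℂ _ (dagger ((irrDecomp N').frame g y.2))) x) •
      (dagger ((irrDecomp N).frame g y.1) ≫ (irrDecomp N').frame g y.2))]
    conv_rhs => rw [expand_frame x fun i => hG (mem_irrSupport N i)]
    refine Finset.sum_congr rfl fun g _ => ?_
    rw [Fintype.sum_prod_type]
    rfl

/-- The matrix coefficients `γ ↦ d(γ)⁻¹ ⟨γ ξ, ξ⟩` of the regular representation, for finitely
supported `ξ`. -/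
def regularCoeff (S : Finset (Irr C)) (ξ : Irr C → ℂ) (a : Irr C) : ℂ :=
  (catDim a.obj : ℂ)⁻¹ * ∑ b ∈ S, ∑ c ∈ S, star (ξ c) * ξ b * mult c (a.obj ⊗ b.obj)

lemma symbolForm_regularCoeff {T A : C} (S : Finset (Irr C)) (ξ : Irr C → ℂ) (k : A ⟶ T ⊗ A)
    {F : Finset (Irr C)} (hF : ∀ b ∈ S, ∀ c ∈ S, irrSupport (c.obj ⊗ b.dual) ⊆ F) :
    symbolForm (regularCoeff S ξ) F k = ∑ b ∈ S, ∑ c ∈ S, star (ξ c) * ξ b *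
      LinearMap.trace ℂ _ (sandwich (tensorCoaction k c.obj) (tensorCoaction k b.obj)) := by
  have htrace : ∀ b ∈ S, ∀ c ∈ S, LinearMap.trace ℂ _
      (sandwich (tensorCoaction k c.obj) (tensorCoaction k b.obj)) =
      ∑ a ∈ F, (mult c (a.obj ⊗ b.obj) : ℂ) *
        LinearMap.trace ℂ _ (sandwich (tensorCoaction k a.obj) k) := by
    intro b hb c hc
    rw [← trace_sandwich_tensor_dual, trace_sandwich_eq_sum k (irrDecomp _),
      (irrDecomp (c.obj ⊗ b.dual)).sum_eq (fun a => LinearMap.trace ℂ _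
        (sandwich (tensorCoaction k a.obj) k)) fun i => hF b hb c hc (mem_irrSupport _ i)]
    refine Finset.sum_congr rfl fun a _ => ?_
    rw [mult_tensor_dual, smul_eq_mul]
  have hcoeff : ∀ a ∈ F, regularCoeff S ξ a * (catDim a.obj * LinearMap.trace ℂ _
      (sandwich (tensorCoaction k a.obj) k)) = ∑ b ∈ S, ∑ c ∈ S, star (ξ c) * ξ b *
        ((mult c (a.obj ⊗ b.obj) : ℂ) *
          LinearMap.trace ℂ _ (sandwich (tensorCoaction k a.obj) k)) := by
    intro a _
    have hd : (catDim a.obj : ℂ) ≠ 0 := by exact_mod_cast a.catDim_pos.ne'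
    generalize LinearMap.trace ℂ _ (sandwich (tensorCoaction k a.obj) k) = t
    rw [regularCoeff, mul_comm (catDim a.obj : ℂ)⁻¹, mul_assoc, inv_mul_cancel_left₀ hd]
    simp only [Finset.sum_mul, mul_assoc]
  rw [symbolForm, Finset.sum_congr rfl hcoeff, Finset.sum_comm]
  refine Finset.sum_congr rfl fun b hb => ?_
  rw [Finset.sum_comm]
  refine Finset.sum_congr rfl fun c hc => ?_
  rw [htrace b hb c hc, Finset.mul_sum]

lemma sum_trace_sandwich_nonneg {T A : C} (S : Finset (Irr C)) (ξ : Irr C → ℂ) (k : A ⟶ T ⊗ A) :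
    0 ≤ ∑ b ∈ S, ∑ c ∈ S, star (ξ c) * ξ b *
      LinearMap.trace ℂ _ (sandwich (tensorCoaction k c.obj) (tensorCoaction k b.obj)) := by
  classical
  let G : Finset (Irr C) := S.biUnion fun c => irrSupport (A ⊗ c.obj)
  have hG : ∀ c ∈ S, irrSupport (A ⊗ c.obj) ⊆ G := fun c hc =>
    Finset.subset_biUnion_of_mem (fun c => irrSupport (A ⊗ c.obj)) hc
  have hsum : ∑ b ∈ S, ∑ c ∈ S, star (ξ c) * ξ b *
      LinearMap.trace ℂ _ (sandwich (tensorCoaction k c.obj) (tensorCoaction k b.obj)) =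
      ∑ g ∈ G, g.obj_irreducible.scalar
        ((∑ c ∈ S, star (ξ c) • coactionComponent (tensorCoaction k c.obj) g) ≫
          dagger (∑ b ∈ S, star (ξ b) • coactionComponent (tensorCoaction k b.obj) g)) := by
    simp only [dagger_sum, dagger_smul, star_star, Preadditive.sum_comp, Preadditive.comp_sum,
      Linear.smul_comp, Linear.comp_smul, map_sum, map_smul, smul_eq_mul, Finset.mul_sum]
    rw [Finset.sum_comm (s := G)]
    refine Finset.sum_congr rfl fun b _ => ?_
    rw [Finset.sum_comm (s := G)]
    refine Finset.sum_congr rfl fun c hc => ?_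
    rw [trace_sandwich _ _ (hG c hc), Finset.mul_sum]
    exact Finset.sum_congr rfl fun g _ => by ring
  rw [hsum]
  exact Finset.sum_nonneg fun g _ => g.obj_irreducible.scalar_comp_dagger_nonneg _

lemma exists_finset_irrSupport (X : C) {ι : Type*} (S : Finset ι) (Y : ι → ι → C) :
    ∃ F : Finset (Irr C), irrSupport X ⊆ F ∧ ∀ b ∈ S, ∀ c ∈ S, irrSupport (Y b c) ⊆ F := by
  classical
  refine ⟨irrSupport X ∪ (S ×ˢ S).biUnion fun x => irrSupport (Y x.1 x.2),
    Finset.subset_union_left, fun b hb c hc => ?_⟩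
  exact (Finset.subset_biUnion_of_mem (fun x : ι × ι => irrSupport (Y x.1 x.2))
    (Finset.mk_mem_product hb hc)).trans Finset.subset_union_right

lemma isCpMultiplier_regularCoeff (S : Finset (Irr C)) (ξ : Irr C → ℂ) :
    IsCpMultiplier (regularCoeff S ξ) := by
  refine isCpMultiplier_of_symbolForm_nonneg @fun A B T _ _ k => ?_
  obtain ⟨F, hBA, hS⟩ := exists_finset_irrSupport (B ⊗ A) S fun b c => c.obj ⊗ b.dual
  refine ⟨F, fun i => hBA (mem_irrSupport _ i), ?_⟩
  rw [symbolForm_regularCoeff S ξ k hS]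
  exact sum_trace_sandwich_nonneg S ξ k

end Positivity

namespace FusionAlgebra

section Lift

variable {C : Type u} [Category.{v} C] [Preadditive C] [Linear ℂ C]

/-- The linear map on the fusion algebra with given values on the basis. -/
def lift {M : Type*} [AddCommGroup M] [Module ℂ M] (f : Irr C → M) : FusionAlgebra C →ₗ[ℂ] M :=
  Finsupp.linearCombination ℂ f

variable {M : Type*} [AddCommGroup M] [Module ℂ M]

lemma lift_apply (f : Irr C → M) (x : FusionAlgebra C) :
    lift f x = Finsupp.sum (show Irr C →₀ ℂ from x) fun a r => r • f a := rfl

@[simp] lemma lift_basisElt (f : Irr C → M) (a : Irr C) : lift f (basisElt a) = f a := by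
  rw [lift, basisElt]
  exact (Finsupp.linearCombination_single ℂ 1 a).trans (one_smul _ _)

lemma hom_ext {f g : FusionAlgebra C →ₗ[ℂ] M} (h : ∀ a, f (basisElt a) = g (basisElt a)) :
    f = g :=
  Finsupp.lhom_ext' fun a => LinearMap.ext_ring (h a)

lemma exists_eq_sum (x : FusionAlgebra C) : ∃ (S : Finset (Irr C)) (r : Irr C → ℂ),
    x = ∑ a ∈ S, r a • basisElt a := by
  refine ⟨(show Irr C →₀ ℂ from x).support, (show Irr C →₀ ℂ from x), ?_⟩
  refine (Finsupp.sum_single (show Irr C →₀ ℂ from x)).symm.trans ?_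
  refine Finset.sum_congr rfl fun a _ => ?_
  exact ((Finsupp.smul_single _ _ _).trans (by rw [smul_eq_mul, mul_one])).symm

end Lift

section Product

variable {C : Type u} [Category.{v} C] [Preadditive C] [Linear ℂ C]
  [MonoidalCategory C] [MonoidalPreadditive C] [MonoidalLinear ℂ C] [CStarTensorCategory C]
  [RigidCStarTensorCategory C]

lemma lift_objClass {M : Type*} [AddCommGroup M] [Module ℂ M] (f : Irr C → M) {X : C}
    (D : IrrDecomp X) : lift f (objClass X) = ∑ i, f (D.irr i) := by
  rw [D.objClass_eq, map_sum]
  simp only [lift_basisElt]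

/-- The product as a bilinear map. -/
def mulHom : FusionAlgebra C →ₗ[ℂ] FusionAlgebra C →ₗ[ℂ] FusionAlgebra C :=
  lift fun a => lift fun b => objClass (a.obj ⊗ b.obj)

lemma mul_eq_mulHom (x y : FusionAlgebra C) : x * y = mulHom x y := by
  rw [mulHom, lift_apply, Finsupp.sum, LinearMap.sum_apply]
  refine Finset.sum_congr rfl fun a _ => ?_
  rw [LinearMap.smul_apply, lift_apply, Finsupp.sum, Finset.smul_sum]
  refine Finset.sum_congr rfl fun b _ => ?_
  rw [smul_smul]

lemma basisElt_mul_basisElt (a b : Irr C) :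
    basisElt a * basisElt b = objClass (a.obj ⊗ b.obj) := by
  simp [mul_eq_mulHom, mulHom]

lemma objClass_mul_basisElt (X : C) (b : Irr C) :
    objClass X * basisElt b = objClass (X ⊗ b.obj) := by
  rw [(irrDecomp X).objClass_eq, mul_eq_mulHom, map_sum, LinearMap.sum_apply]
  simp only [← mul_eq_mulHom, basisElt_mul_basisElt]
  refine Finsupp.ext fun c => ?_
  rw [show (∑ i, objClass (((irrDecomp X).irr i).obj ⊗ b.obj) : FusionAlgebra C) =
    ∑ i, (show Irr C →₀ ℂ from objClass (((irrDecomp X).irr i).obj ⊗ b.obj)) from rfl,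
    Finsupp.finsetSum_apply]
  exact (((irrDecomp X).isDirectSum.whiskerRight b.obj).mult_eq_sum c).symm

/-- The involution as an antilinear map. -/
def starHom : FusionAlgebra C →ₛₗ[starRingEnd ℂ] FusionAlgebra C where
  toFun := star
  map_add' x y := Finsupp.sum_add_index' (fun a => by simp) fun a r s => by
    rw [star_add, add_smul]
  map_smul' c x := (Finsupp.sum_smul_index (fun a => by simp)).trans
    ((Finset.sum_congr rfl fun a _ =>
      (congrArg (· • objClass (conj a.obj)) (star_mul' c _)).trans (mul_smul _ _ _)).trans
      Finset.smul_sum.symm)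

lemma star_basisElt (a : Irr C) : star (basisElt a) = objClass (conj a.obj) :=
  (Finsupp.sum_single_index (by simp)).trans (by simp)

lemma lift_mul {A : Type*} [Ring A] [Algebra ℂ A] {f : Irr C → A}
    (hf : ∀ a b : Irr C, lift f (objClass (a.obj ⊗ b.obj)) = f a * f b) (x y : FusionAlgebra C) :
    lift f (x * y) = lift f x * lift f y := by
  obtain ⟨S, r, rfl⟩ := exists_eq_sum x
  obtain ⟨S', r', rfl⟩ := exists_eq_sum y
  simp only [mul_eq_mulHom, map_sum, LinearMap.sum_apply, map_smul, LinearMap.smul_apply]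
  simp only [← mul_eq_mulHom, basisElt_mul_basisElt, hf, lift_basisElt, Finset.sum_mul,
    Finset.mul_sum, smul_mul_assoc, mul_smul_comm, Finset.smul_sum]

lemma lift_star {A : Type*} [AddCommGroup A] [Module ℂ A] [StarAddMonoid A] [StarModule ℂ A]
    {f : Irr C → A} (hf : ∀ a : Irr C, lift f (objClass (conj a.obj)) = star (f a))
    (x : FusionAlgebra C) : lift f (star x) = star (lift f x) := by
  obtain ⟨S, r, rfl⟩ := exists_eq_sum x
  change lift f (starHom _) = _
  have hstar (a : Irr C) : lift f (starHom (basisElt a)) = star (f a) :=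
    (congrArg (lift f) (star_basisElt a)).trans (hf a)
  simp only [map_sum, map_smul, map_smulₛₗ, hstar, lift_basisElt, star_sum, star_smul,
    starRingEnd_apply]

lemma star_sum_mul_sum (S : Finset (Irr C)) (r : Irr C → ℂ) :
    star (∑ a ∈ S, r a • basisElt a) * (∑ b ∈ S, r b • basisElt b) =
      ∑ a ∈ S, ∑ b ∈ S, (star (r a) * r b) • objClass (conj a.obj ⊗ b.obj) := by
  have hstar : star (∑ a ∈ S, r a • basisElt a : FusionAlgebra C) =
      ∑ a ∈ S, star (r a) • objClass (conj a.obj) := by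
    change starHom _ = _
    rw [map_sum]
    refine Finset.sum_congr rfl fun a _ => ?_
    rw [map_smulₛₗ]
    exact congrArg _ (star_basisElt a)
  rw [hstar, mul_eq_mulHom]
  simp only [map_sum, LinearMap.sum_apply, map_smul, LinearMap.smul_apply, ← mul_eq_mulHom,
    objClass_mul_basisElt, Finset.smul_sum, smul_smul]
  rw [Finset.sum_comm]
  exact Finset.sum_congr rfl fun a _ => Finset.sum_congr rfl fun b _ => by rw [mul_comm]

end Product

end FusionAlgebra

open FusionAlgebra

section SymbolFunctional

variable {C : Type u} [Category.{v} C] [Preadditive C] [Linear ℂ C]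
  [MonoidalCategory C] [MonoidalPreadditive C] [MonoidalLinear ℂ C] [CStarTensorCategory C]
  [RigidCStarTensorCategory C]

/-- The linear functional `α ↦ d(α) φ(α)` on the fusion algebra. -/
def symbolFunctional (φ : Irr C → ℂ) : FusionAlgebra C →ₗ[ℂ] ℂ := lift fun a => catDim a.obj * φ a

lemma symbolFunctional_objClass (φ : Irr C → ℂ) {X : C} {F : Finset (Irr C)}
    (hF : irrSupport X ⊆ F) :
    symbolFunctional φ (objClass X) = ∑ c ∈ F, (mult c X : ℂ) * (catDim c.obj * φ c) := by
  rw [symbolFunctional, lift_objClass _ (irrDecomp X),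
    (irrDecomp X).sum_eq (fun c => (catDim c.obj : ℂ) * φ c) fun i => hF (mem_irrSupport X i)]
  rfl

lemma symbolMap_id (φ : Irr C → ℂ) (X Y : C) :
    symbolMap φ X Y X Y (𝟙 _) = φ (Irr.unit C) • 𝟙 _ := by
  have h := symbolMap_factorization φ (λ_ Y).inv (ρ_ X).hom
  rw [isotypic_of_irreducible φ RigidCStarTensorCategory.unit_irreducible] at h
  have htriangle : X ◁ (λ_ Y).inv ≫ (α_ _ _ _).inv ≫ (ρ_ X).hom ▷ Y = 𝟙 _ := by monoidal
  simp only [MonoidalLinear.smul_whiskerRight, Linear.comp_smul, MonoidalLinear.whiskerLeft_smul,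
    Linear.smul_comp, id_whiskerRight, Category.comp_id] at h
  rwa [htriangle] at h

section Diagonal

variable {ι : Type*} [Fintype ι] {S : ι → C} {A : C} {p : ∀ i, S i ⟶ A} {m : A ⟶ A} {r : ι → ℂ}

lemma trace_sandwich_diagonal (hp : IsDirectSum p) (hm : ∀ i, p i ≫ m = r i • p i) (c : Irr C) :
    LinearMap.trace ℂ _ (sandwich (tensorCoaction (m ≫ (λ_ A).inv) c.obj) (m ≫ (λ_ A).inv)) =
      ∑ i, ∑ j, r i * star (r j) * mult c (conj (S i) ⊗ S j) := by
  have hm_dagger (i : ι) : dagger m ≫ dagger (p i) = star (r i) • dagger (p i) := by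
    rw [← dagger_comp, hm, dagger_smul]
  rw [trace_eq_sum_trace (ι := ι × ι) (W := fun x => S x.1 ⊗ c.obj ⟶ S x.2)
    (fun x => Linear.leftComp ℂ _ (dagger (p x.1) ▷ c.obj) ∘ₗ Linear.rightComp ℂ _ (p x.2))
    (fun x => Linear.leftComp ℂ _ (p x.1 ▷ c.obj) ∘ₗ Linear.rightComp ℂ _ (dagger (p x.2)))
    (fun f => ?_) (fun x f => ?_) _
    (fun x => (r x.1 * star (r x.2)) • LinearMap.id) fun x f => ?_, Fintype.sum_prod_type]
  · refine Finset.sum_congr rfl fun i _ => Finset.sum_congr rfl fun j _ => ?_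
    rw [map_smul, LinearMap.trace_id, finrank_tensorLeft, mult, smul_eq_mul]
  · calc _ = ∑ i, ∑ j, (dagger (p i) ≫ p i) ▷ c.obj ≫ f ≫ (dagger (p j) ≫ p j) := by
          rw [Fintype.sum_prod_type]
          simp
      _ = f := by
          simp only [← Preadditive.comp_sum, ← Preadditive.sum_comp, hp.complete,
            ← sum_whiskerRight]
          simp
  · simp only [LinearMap.comp_apply, Linear.leftComp_apply, Linear.rightComp_apply,
      Category.assoc, hp.isometry, Category.comp_id]
    rw [← comp_whiskerRight_assoc, hp.isometry, id_whiskerRight, Category.id_comp]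
  · simp only [LinearMap.comp_apply, Linear.leftComp_apply, Linear.rightComp_apply,
      sandwich_comp_leftUnitor_inv, Category.assoc, hm_dagger, Linear.comp_smul,
      LinearMap.smul_apply, LinearMap.id_apply]
    rw [← comp_whiskerRight_assoc, hm, MonoidalLinear.smul_whiskerRight, Linear.smul_comp,
      smul_smul, mul_comm]

lemma symbolForm_diagonal (hp : IsDirectSum p) (hm : ∀ i, p i ≫ m = r i • p i) (φ : Irr C → ℂ)
    {F : Finset (Irr C)} (hF : ∀ i j, irrSupport (conj (S i) ⊗ S j) ⊆ F) :
    symbolForm φ F (m ≫ (λ_ A).inv) =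
      ∑ i, ∑ j, r i * star (r j) * symbolFunctional φ (objClass (conj (S i) ⊗ S j)) := by
  simp only [symbolForm, trace_sandwich_diagonal hp hm, symbolFunctional_objClass φ (hF _ _),
    Finset.mul_sum]
  rw [Finset.sum_comm]
  refine Finset.sum_congr rfl fun i _ => ?_
  rw [Finset.sum_comm]
  exact Finset.sum_congr rfl fun j _ => Finset.sum_congr rfl fun c _ => by ring

end Diagonal

lemma IsStandard.coevaluation_comp_symbolMap {X B : C} {p : ExactPairing X B} (hp : IsStandard p)
    (φ : Irr C → ℂ) :
    p.coevaluation' ≫ symbolMap φ X B X B (dagger p.coevaluation' ≫ p.coevaluation') ≫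
      dagger p.coevaluation' = symbolFunctional φ (objClass (conj X ⊗ X)) • 𝟙 (𝟙_ C) := by
  classical
  let F := irrSupport (B ⊗ X) ∪ irrSupport (conj X ⊗ X)
  have hbend := symbolMap_bend hp φ (F := F)
    (fun i => Finset.subset_union_left (mem_irrSupport _ i)) (λ_ X).inv
  have hid : IsDirectSum fun _ : Unit => 𝟙 X :=
    ⟨fun _ => by simp, fun i j hij => absurd (Subsingleton.elim i j) hij, by simp⟩
  have hform := symbolForm_diagonal hid (m := 𝟙 X) (r := 1) (by simp) φ (F := F)
    fun _ _ => Finset.subset_union_right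
  rw [Category.id_comp] at hform
  rwa [bend_leftUnitor_inv, dagger_dagger, hform, Fintype.sum_unique, Fintype.sum_unique,
    Pi.one_apply, star_one, one_mul, one_mul] at hbend

lemma IsCpMultiplier.symbolFunctional_le {φ : Irr C → ℂ} (hφ : IsCpMultiplier φ) {X : C}
    (hX : 0 < catDim X) :
    symbolFunctional φ (objClass (conj X ⊗ X)) ≤ (catDim X : ℂ) ^ 2 * φ (Irr.unit C) := by
  obtain ⟨B, p, hp⟩ := exists_isStandard X
  have hd : (0 : ℂ) < (catDim X : ℂ) := by exact_mod_cast hX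
  set d : ℂ := (catDim X : ℂ)
  set s := p.coevaluation'
  have hs : s ≫ dagger s = d • 𝟙 _ := hp.coevaluation_eq_catDim
  let e : X ⊗ B ⟶ X ⊗ B := d⁻¹ • (dagger s ≫ s)
  have he_dagger : dagger e = e := by
    simp [e, d, dagger_smul, dagger_comp, dagger_dagger]
  have he_idem : e ≫ e = e := by
    have : (dagger s ≫ s) ≫ dagger s ≫ s = d • (dagger s ≫ s) := by
      rw [Category.assoc, ← Category.assoc s, hs]
      simp
    simp [e, this, hd.ne']
  have hproj : (𝟙 _ - e) ≫ dagger (𝟙 _ - e) = 𝟙 _ - e := by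
    simp [he_dagger, he_idem]
  -- Complete positivity on the projection onto the complement of `s`, compressed by `s`.
  have hpos := hφ.map_nonneg s (𝟙 _ - e)
  have hvalue : s ≫ symbolMap φ X B X B (𝟙 _ - e) ≫ dagger s =
      (d * φ (Irr.unit C) - d⁻¹ * symbolFunctional φ (objClass (conj X ⊗ X))) • 𝟙 (𝟙_ C) := by
    rw [map_sub, symbolMap_id, map_smul, Preadditive.sub_comp, Preadditive.comp_sub,
      Linear.smul_comp, Linear.smul_comp, Linear.comp_smul, Linear.comp_smul,
      hp.coevaluation_comp_symbolMap, Category.id_comp, hs, smul_smul, smul_smul, sub_smul,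
      mul_comm d]
  rw [hproj, hvalue, map_smul, IsIrreducible.scalar_id, smul_eq_mul, mul_one] at hpos
  have := mul_nonneg hd.le hpos
  rwa [mul_sub, mul_inv_cancel_left₀ hd.ne', ← mul_assoc, ← sq, sub_nonneg] at this

lemma IsCpMultiplier.symbolFunctional_nonneg {φ : Irr C → ℂ} (hφ : IsCpMultiplier φ)
    (x : FusionAlgebra C) : 0 ≤ symbolFunctional φ (star x * x) := by
  obtain ⟨S, r, rfl⟩ := exists_eq_sum x
  obtain ⟨A, p, hp⟩ := exists_isDirectSum fun a : S => (a : Irr C).obj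
  obtain ⟨B, q, hq⟩ := exists_isStandard A
  obtain ⟨F, hBA, hF⟩ := exists_finset_irrSupport (B ⊗ A) S fun a b => conj a.obj ⊗ b.obj
  let m : A ⟶ A := ∑ a : S, dagger (p a) ≫ ((star (r a) : ℂ) • p a)
  have hm (a : S) : p a ≫ m = (star (r a) : ℂ) • p a :=
    hp.comp_sum_dagger (fun a => (star (r a) : ℂ) • p a) a
  have hform := symbolForm_diagonal hp hm φ fun a b => hF a a.2 b b.2
  have hpos := hφ.symbolForm_nonneg hq (fun i => hBA (mem_irrSupport _ i)) (m ≫ (λ_ A).inv)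
  rw [hform] at hpos
  simp only [star_sum_mul_sum, map_sum, map_smul, smul_eq_mul]
  simpa only [star_star, ← Finset.sum_coe_sort S] using hpos

end SymbolFunctional

section CpMultipliers

variable {C : Type u} [Category.{v} C] [Preadditive C] [Linear ℂ C]
  [MonoidalCategory C] [MonoidalPreadditive C] [MonoidalLinear ℂ C] [CStarTensorCategory C]

/-- The composition of two multipliers. -/
def Multiplier.comp (θ ψ : Multiplier C) : Multiplier C where
  map X Y := θ.map X Y ∘ₗ ψ.map X Y
  map_comp f g h k T := by
    rw [LinearMap.comp_apply, LinearMap.comp_apply, ψ.map_comp, θ.map_comp]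
  map_amplify X₂ Y₂ T := by
    rw [LinearMap.comp_apply, LinearMap.comp_apply, ψ.map_amplify, θ.map_amplify]

lemma IsCpMultiplier.mul {φ ψ : Irr C → ℂ} (hφ : IsCpMultiplier φ) (hψ : IsCpMultiplier ψ) :
    IsCpMultiplier fun a => φ a * ψ a := by
  obtain ⟨θ, ⟨E, hE⟩, hθ⟩ := hφ
  obtain ⟨θ', ⟨E', hE'⟩, hθ'⟩ := hψ
  refine ⟨θ.comp θ', ⟨⟨fun X Y Z W => E.map X Y Z W ∘ₗ E'.map X Y Z W, fun X Y => ?_,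
    fun f g h k T => ?_⟩, fun X Y hX p w => ?_⟩, fun X Y n a => ?_⟩
  · rw [E.map_self, E'.map_self]
    rfl
  · rw [LinearMap.comp_apply, LinearMap.comp_apply, E'.map_comp, E.map_comp]
  · change E.map X Y _ _ (E'.map X Y _ _ w) = _
    rw [hE' X Y hX p, map_smul, hE X Y hX p, smul_smul, mul_comm]
  · obtain ⟨b, hb⟩ := hθ' X Y n a
    obtain ⟨c, hc⟩ := hθ X Y n b
    refine ⟨c, fun i j => ?_⟩
    rw [← hc, ← hb]
    rfl

lemma isCpMultiplier_const {z : ℂ} (hz : 0 ≤ z) : IsCpMultiplier fun _ : Irr C => z := by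
  obtain ⟨w, rfl⟩ := CStarAlgebra.nonneg_iff_eq_star_mul_self.1 hz
  refine ⟨⟨fun X Y => (star w * w) • LinearMap.id, fun f g h k T => by simp,
    fun X₂ Y₂ T => by simp [amplify]⟩, ⟨⟨fun X Y Z W => (star w * w) • LinearMap.id,
    fun X Y => rfl, fun f g h k T => by simp⟩, fun _ _ _ _ _ => rfl⟩,
    fun X Y n a => ⟨fun k j => w • a k j, fun i j => ?_⟩⟩
  simp only [LinearMap.smul_apply, LinearMap.id_apply, Finset.smul_sum, dagger_smul,
    Linear.smul_comp, Linear.comp_smul, smul_smul]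

variable [RigidCStarTensorCategory C]

lemma isCpMultiplier_of_tendsto {ι : Type*} {l : Filter ι} [l.NeBot] {φ : ι → Irr C → ℂ}
    {ψ : Irr C → ℂ} (hφ : ∀ i, IsCpMultiplier (φ i))
    (h : ∀ a, Filter.Tendsto (fun i => φ i a) l (nhds (ψ a))) : IsCpMultiplier ψ := by
  refine isCpMultiplier_of_symbolForm_nonneg @fun A B T p hp k => ?_
  refine ⟨irrSupport (B ⊗ A), mem_irrSupport _, ?_⟩
  refine ge_of_tendsto' (f := fun i => symbolForm (φ i) (irrSupport (B ⊗ A)) k) (x := l) ?_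
    fun i => (hφ i).symbolForm_nonneg hp (mem_irrSupport _) k
  exact tendsto_finsetSum _ fun a _ => (h a).mul_const _

end CpMultipliers

section Single

variable {C : Type u} [Category.{v} C] [Preadditive C] [Linear ℂ C]

open Classical in
lemma ext_of_single {S T : L2Irr C →L[ℂ] L2Irr C}
    (h : ∀ b c : Irr C, S (lp.single 2 b (1 : ℂ)) c = T (lp.single 2 b (1 : ℂ)) c) : S = T :=
  lp.ext_continuousLinearMap (by norm_num) fun b =>
    ContinuousLinearMap.ext_ring <| lp.ext <| funext fun c => h b c

end Single

section RegularRepresentation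

variable {C : Type u} [Category.{v} C] [Preadditive C] [Linear ℂ C]
  [MonoidalCategory C] [MonoidalPreadditive C] [MonoidalLinear ℂ C] [CStarTensorCategory C]
  [RigidCStarTensorCategory C]

/-- The additive extension of a function on `Irr C` to all objects. -/
def objectSum (ξ : Irr C → ℂ) (Z : C) : ℂ := ∑ i, ξ ((irrDecomp Z).irr i)

lemma objectSum_eq (ξ : Irr C → ℂ) {Z : C} {F : Finset (Irr C)} (hF : irrSupport Z ⊆ F) :
    objectSum ξ Z = ∑ c ∈ F, (mult c Z : ℂ) * ξ c :=
  (irrDecomp Z).sum_eq ξ fun i => hF (mem_irrSupport Z i)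

lemma objectSum_eq_of_support {ξ : Irr C → ℂ} {R : Finset (Irr C)} (hξ : ∀ b, b ∉ R → ξ b = 0)
    (Z : C) : objectSum ξ Z = ∑ c ∈ R, (mult c Z : ℂ) * ξ c := by
  classical
  rw [objectSum_eq ξ (F := irrSupport Z ∪ R) Finset.subset_union_left]
  refine (Finset.sum_subset Finset.subset_union_right fun c _ hc => ?_).symm
  rw [hξ c hc, mul_zero]

lemma objectSum_congr {ξ : Irr C → ℂ} {X Y : C} (h : ∀ b : Irr C, mult b X = mult b Y) :
    objectSum ξ X = objectSum ξ Y := by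
  classical
  rw [objectSum_eq ξ (F := irrSupport X ∪ irrSupport Y) Finset.subset_union_left,
    objectSum_eq ξ (F := irrSupport X ∪ irrSupport Y) Finset.subset_union_right]
  simp only [h]

lemma sum_objectSum {ι : Type*} (S : Finset ι) (X : ι → C) (Y : C) (ξ : Irr C → ℂ)
    (h : ∀ b : Irr C, (mult b Y : ℂ) = ∑ i ∈ S, (mult b (X i) : ℂ)) :
    ∑ i ∈ S, objectSum ξ (X i) = objectSum ξ Y := by
  classical
  obtain ⟨F, hY, hX⟩ := exists_finset_irrSupport Y S fun i _ => X i
  rw [objectSum_eq ξ hY, Finset.sum_congr rfl fun i hi => objectSum_eq ξ (hX i hi i hi),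
    Finset.sum_comm]
  simp only [h, Finset.sum_mul]

lemma objectSum_objectSum (ξ : Irr C → ℂ) (Y Z : C) :
    objectSum (fun c => objectSum ξ (Y ⊗ c.obj)) Z = objectSum ξ (Y ⊗ Z) :=
  sum_objectSum _ _ _ ξ fun b => ((irrDecomp Z).isDirectSum.whiskerLeft Y).mult_eq_sum b

lemma Irr.catDim_unit : catDim (Irr.unit C).obj = 1 := by
  obtain ⟨e⟩ : Nonempty ((Irr.unit C).obj ≅ 𝟙_ C) := Irr.nonempty_iso_mk _
  have hunit : catDim (Irr.unit C).obj = catDim (𝟙_ C) :=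
    catDim_eq_of_inverse e.hom_inv_id e.inv_hom_id
  have hsq : catDim (𝟙_ C) * catDim (𝟙_ C) = catDim (𝟙_ C) :=
    (catDim_tensor _ _).symm.trans (catDim_eq_of_inverse (λ_ _).hom_inv_id (λ_ _).inv_hom_id)
  have hpos := (Irr.unit C).catDim_pos
  rw [hunit] at hpos ⊢
  exact mul_left_cancel₀ hpos.ne' (hsq.trans (mul_one _).symm)

lemma regularCoeff_unit (S : Finset (Irr C)) (ξ : Irr C → ℂ) :
    regularCoeff S ξ (Irr.unit C) = ((∑ b ∈ S, ‖ξ b‖ ^ 2 : ℝ) : ℂ) := by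
  classical
  rw [regularCoeff, Irr.catDim_unit]
  push_cast
  rw [inv_one, one_mul]
  refine Finset.sum_congr rfl fun b hb => ?_
  rw [Finset.sum_eq_single_of_mem b hb]
  · rw [mult_unit_tensor, if_pos rfl, Nat.cast_one, mul_one, Complex.star_def, Complex.conj_mul']
  · intro c _ hc
    rw [mult_unit_tensor, if_neg hc, Nat.cast_zero, mul_zero]

lemma sum_mult_conj_tensor_mul (X : C) (b b' : Irr C) {F : Finset (Irr C)}
    (hF : irrSupport (X ⊗ b.obj) ⊆ F) :
    ∑ c ∈ F, (mult b' (conj X ⊗ c.obj) : ℂ) * mult b (conj X ⊗ c.obj) =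
      ∑ g ∈ irrSupport (conj X ⊗ X), (mult g (conj X ⊗ X) : ℂ) * mult b' (g.obj ⊗ b.obj) := by
  rw [← mult_tensor_left_eq b.obj b' subset_rfl, mult_congr b' (α_ _ _ _),
    mult_tensor_right_eq _ _ hF]
  refine Finset.sum_congr rfl fun c _ => ?_
  rw [mult_conj_tensor X b c, mul_comm]

lemma norm_objectSum_sq {ξ : Irr C → ℂ} {R : Finset (Irr C)} (hξ : ∀ b, b ∉ R → ξ b = 0) (Z : C) :
    (‖objectSum ξ Z‖ : ℂ) ^ 2 =
      ∑ b ∈ R, ∑ b' ∈ R, star (ξ b') * ξ b * ((mult b' Z : ℂ) * mult b Z) := by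
  rw [← Complex.conj_mul', objectSum_eq_of_support hξ, map_sum, Finset.sum_mul_sum,
    Finset.sum_comm]
  refine Finset.sum_congr rfl fun b _ => Finset.sum_congr rfl fun b' _ => ?_
  rw [map_mul, Complex.conj_natCast, ← Complex.star_def]
  ring

-- With `λ` the regular representation, both sides are `⟨λ(X)* λ(X) ξ, ξ⟩`.
lemma symbolFunctional_regularCoeff_conj_tensor {X : C} {ξ : Irr C → ℂ} {R F : Finset (Irr C)}
    (hξ : ∀ b, b ∉ R → ξ b = 0) (hF : ∀ b ∈ R, irrSupport (X ⊗ b.obj) ⊆ F) :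
    symbolFunctional (regularCoeff R ξ) (objClass (conj X ⊗ X)) =
      ((∑ c ∈ F, ‖objectSum ξ (conj X ⊗ c.obj)‖ ^ 2 : ℝ) : ℂ) := by
  rw [symbolFunctional_objClass _ subset_rfl]
  push_cast
  calc _ = ∑ g ∈ irrSupport (conj X ⊗ X), ∑ b ∈ R, ∑ b' ∈ R, star (ξ b') * ξ b *
        ((mult g (conj X ⊗ X) : ℂ) * mult b' (g.obj ⊗ b.obj)) := by
        refine Finset.sum_congr rfl fun g _ => ?_
        have hd : (catDim g.obj : ℂ) ≠ 0 := by exact_mod_cast g.catDim_pos.ne'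
        rw [regularCoeff, mul_inv_cancel_left₀ hd]
        simp only [Finset.mul_sum, mul_left_comm]
    _ = ∑ c ∈ F, ∑ b ∈ R, ∑ b' ∈ R, star (ξ b') * ξ b *
        ((mult b' (conj X ⊗ c.obj) : ℂ) * mult b (conj X ⊗ c.obj)) := by
        rw [Finset.sum_comm, Finset.sum_comm (s := F)]
        refine Finset.sum_congr rfl fun b hb => ?_
        rw [Finset.sum_comm, Finset.sum_comm (s := F)]
        refine Finset.sum_congr rfl fun b' _ => ?_
        rw [← Finset.mul_sum, ← Finset.mul_sum, sum_mult_conj_tensor_mul X b b' (hF b hb)]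
    _ = _ := by simp only [norm_objectSum_sq hξ]

lemma sum_norm_objectSum_le (a : Irr C) {ξ : Irr C → ℂ} {R : Finset (Irr C)}
    (hξ : ∀ b, b ∉ R → ξ b = 0) (S : Finset (Irr C)) :
    ∑ c ∈ S, ‖objectSum ξ (conj a.obj ⊗ c.obj)‖ ^ 2 ≤ catDim a.obj ^ 2 * ∑ b ∈ R, ‖ξ b‖ ^ 2 := by
  classical
  let F := S ∪ R.biUnion fun b => irrSupport (a.obj ⊗ b.obj)
  have hF : ∀ b ∈ R, irrSupport (a.obj ⊗ b.obj) ⊆ F := fun b hb =>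
    (Finset.subset_biUnion_of_mem (fun b => irrSupport (a.obj ⊗ b.obj)) hb).trans
      Finset.subset_union_right
  have hle := (isCpMultiplier_regularCoeff R ξ).symbolFunctional_le a.catDim_pos
  rw [symbolFunctional_regularCoeff_conj_tensor hξ hF, regularCoeff_unit] at hle
  calc _ ≤ ∑ c ∈ F, ‖objectSum ξ (conj a.obj ⊗ c.obj)‖ ^ 2 :=
        Finset.sum_le_sum_of_subset_of_nonneg Finset.subset_union_left fun _ _ _ => by positivity
    _ ≤ _ := by exact_mod_cast hle

lemma sum_norm_objectSum_le_norm (a : Irr C) (ξ : L2Irr C) (S : Finset (Irr C)) :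
    ∑ c ∈ S, ‖objectSum ξ (conj a.obj ⊗ c.obj)‖ ^ 2 ≤ (catDim a.obj * ‖ξ‖) ^ 2 := by
  classical
  let R := S.biUnion fun c => irrSupport (conj a.obj ⊗ c.obj)
  let ξ' : Irr C → ℂ := fun b => if b ∈ R then ξ b else 0
  have hobj : ∀ c ∈ S, objectSum ξ' (conj a.obj ⊗ c.obj) = objectSum ξ (conj a.obj ⊗ c.obj) :=
    fun c hc => Finset.sum_congr rfl fun i _ =>
      if_pos (Finset.mem_biUnion.2 ⟨c, hc, mem_irrSupport _ i⟩)
  have hnorm : ∑ b ∈ R, ‖ξ' b‖ ^ 2 ≤ ‖ξ‖ ^ 2 := by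
    rw [Finset.sum_congr rfl fun b hb => by rw [show ξ' b = ξ b from if_pos hb]]
    simpa using lp.sum_rpow_le_norm_rpow (p := 2) (by norm_num) ξ R
  calc _ = ∑ c ∈ S, ‖objectSum ξ' (conj a.obj ⊗ c.obj)‖ ^ 2 :=
        Finset.sum_congr rfl fun c hc => by rw [hobj c hc]
    _ ≤ catDim a.obj ^ 2 * ∑ b ∈ R, ‖ξ' b‖ ^ 2 := sum_norm_objectSum_le a (fun b hb => if_neg hb) S
    _ ≤ (catDim a.obj * ‖ξ‖) ^ 2 := by rw [mul_pow]; gcongr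

/-- The operator of the class of `a` in the regular representation. Since
`mult c (a ⊗ b) = mult b (conj a ⊗ c)`, its value at `c` is the additive extension of `ξ` evaluated
at `conj a ⊗ c`. -/
def regularOp (a : Irr C) : L2Irr C →L[ℂ] L2Irr C :=
  LinearMap.mkContinuous
    { toFun := fun ξ => ⟨fun c => objectSum ξ (conj a.obj ⊗ c.obj), memℓp_gen'
        (C := (catDim a.obj * ‖ξ‖) ^ 2) fun S => by
          simpa using sum_norm_objectSum_le_norm a ξ S⟩
      map_add' := fun ξ η => lp.ext <| funext fun c => by
        change objectSum (fun c => ξ c + η c) _ = objectSum ξ _ + objectSum η _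
        simp [objectSum, Finset.sum_add_distrib]
      map_smul' := fun z ξ => lp.ext <| funext fun c => by
        simp [objectSum, Finset.mul_sum] }
    (catDim a.obj) fun ξ => lp.norm_le_of_forall_sum_le (by norm_num)
      (mul_nonneg a.catDim_pos.le (norm_nonneg _)) fun S => by
        simpa using sum_norm_objectSum_le_norm a ξ S

lemma regularOp_apply (a : Irr C) (ξ : L2Irr C) (c : Irr C) :
    regularOp a ξ c = objectSum ξ (conj a.obj ⊗ c.obj) := rfl

lemma lift_regularOp_objClass (X : C) (ξ : L2Irr C) (c : Irr C) :
    lift regularOp (objClass X) ξ c = objectSum ξ (conj X ⊗ c.obj) := by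
  rw [lift_objClass _ (irrDecomp X), sum_apply, lp.coeFn_sum,
    Finset.sum_apply]
  simp only [regularOp_apply]
  refine sum_objectSum _ _ _ _ fun b => ?_
  rw [mult_conj_tensor, ((irrDecomp X).isDirectSum.whiskerRight b.obj).mult_eq_sum c]
  simp only [mult_conj_tensor]

open Classical in
lemma regularOp_single (a b c : Irr C) :
    regularOp a (lp.single 2 b (1 : ℂ)) c = (mult c (a.obj ⊗ b.obj) : ℂ) := by
  rw [regularOp_apply, objectSum_eq_of_support (R := {b})]
  · rw [Finset.sum_singleton, lp.single_apply_self, mul_one, mult_conj_tensor]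
  · intro c hc
    rw [lp.single_apply_ne _ _ _ (by simpa using hc)]

lemma lift_regularOp_conj (a : Irr C) :
    lift regularOp (objClass (conj a.obj)) = star (regularOp a) := by
  classical
  refine ext_of_single fun b c => ?_
  rw [lift_regularOp_objClass, ContinuousLinearMap.star_eq_adjoint]
  have hcoord : (ContinuousLinearMap.adjoint (regularOp a) (lp.single 2 b (1 : ℂ))) c =
      inner ℂ (lp.single 2 c (1 : ℂ) : L2Irr C)
        (ContinuousLinearMap.adjoint (regularOp a) (lp.single 2 b (1 : ℂ))) := by
    rw [lp.inner_single_left]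
    simp
  rw [hcoord, ContinuousLinearMap.adjoint_inner_right, lp.inner_single_right, regularOp_single,
    objectSum_eq_of_support (R := {b})]
  · rw [Finset.sum_singleton, lp.single_apply_self, mul_one, mult_conj_tensor, mult_conj_tensor]
    simp
  · intro c hc
    rw [lp.single_apply_ne _ _ _ (by simpa using hc)]

lemma lift_regularOp_tensor (a b : Irr C) :
    lift regularOp (objClass (a.obj ⊗ b.obj)) = regularOp a * regularOp b := by
  refine ContinuousLinearMap.ext fun ξ => lp.ext (funext fun c => ?_)
  rw [lift_regularOp_objClass]
  exact (objectSum_congr (mult_conj_conj_tensor _ _ · _)).trans (objectSum_objectSum ξ _ _).symm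

variable (C) in
/-- The regular representation, built from the operators `regularOp`. -/
def regularRep : StarRep C (L2Irr C) where
  toLinearMap := lift regularOp
  map_one' := by
    classical
    refine ext_of_single fun b c => ?_
    change lift regularOp (basisElt (Irr.unit C)) _ _ = _
    rw [lift_basisElt, regularOp_single, mult_unit_tensor]
    simp [lp.single_apply, Pi.single_apply]
  map_mul' := lift_mul lift_regularOp_tensor
  map_star' := lift_star lift_regularOp_conj

lemma isRegular_regularRep : IsRegular (regularRep C) := by
  intro a b c
  change lift regularOp (basisElt a) _ _ = _
  rw [lift_basisElt]
  exact regularOp_single a b c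

lemma IsRegular.eq_regularRep {Θ : StarRep C (L2Irr C)} (hΘ : IsRegular Θ) : Θ = regularRep C := by
  have h : Θ.toLinearMap = (regularRep C).toLinearMap := hom_ext fun a =>
    ext_of_single fun b c => (hΘ a b c).trans (isRegular_regularRep a b c).symm
  cases Θ
  congr

open Classical in
lemma IsRegular.inner_eq_regularCoeff {Θ : StarRep C (L2Irr C)} (hΘ : IsRegular Θ) (a : Irr C)
    (S : Finset (Irr C)) (ξ : Irr C → ℂ) :
    ((catDim a.obj : ℝ) : ℂ)⁻¹ * inner ℂ (∑ c ∈ S, (lp.single 2 c (ξ c) : L2Irr C))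
      (Θ (basisElt a) (∑ b ∈ S, (lp.single 2 b (ξ b) : L2Irr C))) = regularCoeff S ξ a := by
  rw [regularCoeff]
  congr 1
  rw [map_sum, inner_sum]
  refine Finset.sum_congr rfl fun b _ => ?_
  rw [sum_inner]
  refine Finset.sum_congr rfl fun c _ => ?_
  have hsmul : (lp.single 2 b (ξ b) : L2Irr C) = ξ b • lp.single 2 b (1 : ℂ) := by
    rw [← lp.single_smul, smul_eq_mul, mul_one]
  rw [hsmul, map_smul, inner_smul_right, lp.inner_single_left, hΘ a b c]
  simp only [RCLike.inner_apply, RCLike.star_def]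
  ring

lemma IsRegular.isAdmissible {Θ : StarRep C (L2Irr C)} (hΘ : IsRegular Θ) : Θ.IsAdmissible := by
  classical
  intro ξ
  refine isCpMultiplier_of_tendsto (l := Filter.atTop)
    (fun S : Finset (Irr C) => isCpMultiplier_regularCoeff S ξ) fun a => ?_
  have hlim : Filter.Tendsto (fun S : Finset (Irr C) => ∑ b ∈ S, (lp.single 2 b (ξ b) : L2Irr C))
      Filter.atTop (nhds ξ) := lp.hasSum_single (by norm_num) ξ
  simp only [← hΘ.inner_eq_regularCoeff]
  exact (hlim.inner (((Θ (basisElt a)).continuous.tendsto ξ).comp hlim)).const_mul _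

end RegularRepresentation

section Analysis

lemma exists_norm_sub_eq_star_mul_self {A : Type*} [CStarAlgebra A] {b : A}
    (hb : IsSelfAdjoint b) : ∃ y, algebraMap ℝ A ‖b‖ - b = star y * y := by
  let _ : PartialOrder A := CStarAlgebra.spectralOrder A
  have _ : StarOrderedRing A := CStarAlgebra.spectralOrderedRing A
  exact CStarAlgebra.nonneg_iff_eq_star_mul_self.1 (sub_nonneg.2 hb.le_algebraMap_norm_self)

open Classical in
lemma exists_sum_single_lt_norm_apply {ι F : Type*} [NormedAddCommGroup F] [NormedSpace ℂ F]
    (T : lp (fun _ : ι => ℂ) 2 →L[ℂ] F) {r : ℝ} (hr : r < ‖T‖) :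
    ∃ (S : Finset ι) (ξ : ι → ℂ),
      ‖∑ i ∈ S, (lp.single 2 i (ξ i) : lp (fun _ : ι => ℂ) 2)‖ < 1 ∧
        r < ‖T (∑ i ∈ S, lp.single 2 i (ξ i))‖ := by
  obtain ⟨η, hη, hTη⟩ := T.exists_lt_apply_of_lt_opNorm hr
  have hlim : Filter.Tendsto
      (fun S : Finset ι => ∑ i ∈ S, (lp.single 2 i (η i) : lp (fun _ : ι => ℂ) 2))
      Filter.atTop (nhds η) := lp.hasSum_single (by norm_num) η
  obtain ⟨S, hS⟩ := ((hlim.norm.eventually_lt_const hη).and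
    (((T.continuous.tendsto η).comp hlim).norm.eventually_const_lt hTη)).exists
  exact ⟨S, η, hS⟩

lemma norm_one_sub_sq_le {z : ℂ} (hz : ‖z‖ ≤ 1) : ‖1 - z‖ ^ 2 ≤ 2 * (1 - z.re) := by
  have hexpand : ‖1 - z‖ ^ 2 = 1 - 2 * z.re + ‖z‖ ^ 2 := by
    simpa using norm_sub_sq (𝕜 := ℂ) 1 z
  linarith [pow_le_one₀ (n := 2) (norm_nonneg z) hz]

lemma norm_one_sub_inv_mul_inner_sq_le {K : Type*} [NormedAddCommGroup K] [InnerProductSpace ℂ K]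
    {ζ η : K} {d δ : ℝ} (hd : 1 ≤ d) (hδ : 0 ≤ δ) (hδ1 : δ ≤ 1) (hζ : ‖ζ‖ ≤ 1) (hη : ‖η‖ ≤ d)
    (h : 1 + d - δ ≤ ‖ζ + η‖) : ‖1 - (d : ℂ)⁻¹ * inner ℂ ζ η‖ ^ 2 ≤ 4 * δ := by
  have hd0 : 0 < d := one_pos.trans_le hd
  have hinner : ‖inner ℂ ζ η‖ ≤ d :=
    (norm_inner_le_norm ζ η).trans
      ((mul_le_mul hζ hη (norm_nonneg _) zero_le_one).trans_eq (one_mul d))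
  have hz : ‖(d : ℂ)⁻¹ * inner ℂ ζ η‖ ≤ 1 := by
    rw [norm_mul, norm_inv, Complex.norm_real, Real.norm_of_nonneg hd0.le]
    exact inv_mul_le_one_of_le₀ hinner hd0.le
  have hre : d - δ * (1 + d) ≤ (inner ℂ ζ η).re := by
    have hexpand : ‖ζ + η‖ ^ 2 = ‖ζ‖ ^ 2 + 2 * (inner ℂ ζ η).re + ‖η‖ ^ 2 :=
      norm_add_sq (𝕜 := ℂ) ζ η
    have hlow : (1 + d - δ) ^ 2 ≤ ‖ζ + η‖ ^ 2 := pow_le_pow_left₀ (by linarith) h 2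
    have hζ2 : ‖ζ‖ ^ 2 ≤ 1 := pow_le_one₀ (norm_nonneg _) hζ
    have hη2 : ‖η‖ ^ 2 ≤ d ^ 2 := pow_le_pow_left₀ (norm_nonneg _) hη 2
    nlinarith [sq_nonneg δ]
  have hre' : 1 - 2 * δ ≤ ((d : ℂ)⁻¹ * inner ℂ ζ η).re := by
    rw [← Complex.ofReal_inv, Complex.re_ofReal_mul, inv_mul_eq_div, le_div_iff₀ hd0]
    nlinarith
  linarith [norm_one_sub_sq_le hz]

end Analysis

section Representations

variable {C : Type u} [Category.{v} C] [Preadditive C] [Linear ℂ C]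
  [MonoidalCategory C] [MonoidalPreadditive C] [MonoidalLinear ℂ C] [CStarTensorCategory C]
  [RigidCStarTensorCategory C]

variable {K : Type*} [NormedAddCommGroup K] [InnerProductSpace ℂ K] [CompleteSpace K]

/-- The matrix coefficient `α ↦ d(α)⁻¹ ⟨Θ(α) ξ, ξ⟩`, with Mathlib's inner product, which is linear
in the second variable. -/
def StarRep.coeff (Θ : StarRep C K) (ξ : K) (a : Irr C) : ℂ :=
  ((catDim a.obj : ℝ) : ℂ)⁻¹ * inner ℂ ξ (Θ (basisElt a) ξ)

lemma StarRep.coeff_unit (Θ : StarRep C K) (ξ : K) :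
    Θ.coeff ξ (Irr.unit C) = ((‖ξ‖ ^ 2 : ℝ) : ℂ) := by
  have hone : Θ (basisElt (Irr.unit C)) = 1 := Θ.map_one'
  rw [StarRep.coeff, Irr.catDim_unit, hone]
  simp [inner_self_eq_norm_sq_to_K]

lemma StarRep.symbolFunctional_coeff (Θ : StarRep C K) (ξ : K) (x : FusionAlgebra C) :
    symbolFunctional (Θ.coeff ξ) x = inner ℂ ξ (Θ x ξ) := by
  let f : FusionAlgebra C →ₗ[ℂ] ℂ :=
    { toFun := fun x => inner ℂ ξ (Θ x ξ)
      map_add' := fun x y => by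
        rw [Θ.map_add', add_apply, inner_add_right]
      map_smul' := fun c x => by
        rw [Θ.map_smul', smul_apply, inner_smul_right]
        rfl }
  have hf : symbolFunctional (Θ.coeff ξ) = f := hom_ext fun a => by
    have hd : (catDim a.obj : ℂ) ≠ 0 := by exact_mod_cast a.catDim_pos.ne'
    rw [symbolFunctional, lift_basisElt, StarRep.coeff, mul_inv_cancel_left₀ hd]
    rfl
  rw [hf]
  rfl

lemma StarRep.symbolFunctional_coeff_star_mul (Θ : StarRep C K) (ξ : K) (x : FusionAlgebra C) :
    symbolFunctional (Θ.coeff ξ) (star x * x) = ((‖Θ x ξ‖ ^ 2 : ℝ) : ℂ) := by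
  rw [StarRep.symbolFunctional_coeff, Θ.map_mul', Θ.map_star', mul_apply_eq_comp,
    ContinuousLinearMap.star_eq_adjoint, ContinuousLinearMap.adjoint_inner_right,
    inner_self_eq_norm_sq_to_K]
  simp

lemma StarRep.IsAdmissible.norm_basisElt_le {Θ : StarRep C K} (hΘ : Θ.IsAdmissible) (a : Irr C) :
    ‖Θ (basisElt a)‖ ≤ catDim a.obj := by
  refine ContinuousLinearMap.opNorm_le_bound _ a.catDim_pos.le fun ξ => ?_
  have hle := IsCpMultiplier.symbolFunctional_le (φ := Θ.coeff ξ) (hΘ ξ) a.catDim_pos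
  rw [← objClass_mul_basisElt, ← star_basisElt, Θ.symbolFunctional_coeff_star_mul,
    Θ.coeff_unit] at hle
  have hsq : ‖Θ (basisElt a) ξ‖ ^ 2 ≤ (catDim a.obj * ‖ξ‖) ^ 2 := by
    rw [mul_pow]
    exact_mod_cast hle
  exact le_of_sq_le_sq hsq (mul_nonneg a.catDim_pos.le (norm_nonneg _))

lemma StarRep.IsAdmissible.norm_sum_le {Θ : StarRep C K} (hΘ : Θ.IsAdmissible)
    {ι : Type*} (S : Finset ι) (r : ι → ℂ) (c : ι → Irr C) :
    ‖Θ (∑ i ∈ S, r i • basisElt (c i))‖ ≤ ∑ i ∈ S, ‖r i‖ * catDim (c i).obj := by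
  change ‖Θ.toLinearMap (∑ i ∈ S, r i • basisElt (c i))‖ ≤ _
  rw [map_sum]
  refine (_root_.norm_sum_le _ _).trans (Finset.sum_le_sum fun i _ => ?_)
  rw [map_smul, norm_smul]
  exact mul_le_mul_of_nonneg_left (hΘ.norm_basisElt_le (c i)) (norm_nonneg _)

lemma StarRep.IsAdmissible.norm_objClass_le {Θ : StarRep C K} (hΘ : Θ.IsAdmissible) (X : C) :
    ‖Θ (objClass X)‖ ≤ catDim X := by
  simpa only [one_smul, ← (irrDecomp X).objClass_eq, norm_one, one_mul,
    ← (irrDecomp X).catDim_eq] using hΘ.norm_sum_le Finset.univ (fun _ => 1) (irrDecomp X).irr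

lemma exists_universal (x : FusionAlgebra C) : ∃ T : universalCStar C,
    ∀ π : AdmissibleRep C, (T : AdmissibleRep.Prod C) π = π.rep x := by
  obtain ⟨S, r, hx⟩ := exists_eq_sum x
  let T : AdmissibleRep.Prod C := ⟨fun π => π.rep x, memℓp_infty ⟨∑ a ∈ S, ‖r a‖ * catDim a.obj, by
    rintro _ ⟨π, rfl⟩
    simp only [hx]
    exact π.admissible.norm_sum_le S r id⟩⟩
  exact ⟨⟨T, (universalRange C).le_topologicalClosure ⟨x, fun π => rfl⟩⟩, fun π => rfl⟩

-- By density, positivity extends to the generated C*-algebra, where `‖b‖ - b` is a square for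
-- `b = Θ(x)* Θ(x)`.
lemma StarRep.map_star_mul_self_le (Θ : StarRep C K) (Ω : (K →L[ℂ] K) →L[ℂ] ℂ)
    (hΩ : ∀ x, 0 ≤ Ω (Θ (star x * x))) (x : FusionAlgebra C) :
    Ω (Θ (star x * x)) ≤ ((‖Θ x‖ ^ 2 : ℝ) : ℂ) * Ω 1 := by
  have hcl : IsClosed (Θ.cstar : Set (K →L[ℂ] K)) := Θ.range.isClosed_topologicalClosure
  have hpos : ∀ y ∈ Θ.cstar, 0 ≤ Ω (star y * y) := by
    intro y hy
    have hy' : y ∈ closure (Θ.range : Set (K →L[ℂ] K)) := hy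
    refine closure_minimal (t := {y | 0 ≤ Ω (star y * y)}) ?_ ?_ hy'
    · rintro _ ⟨z, rfl⟩
      have := hΩ z
      rwa [Θ.map_mul', Θ.map_star'] at this
    · exact isClosed_le continuous_const (by fun_prop)
  have hx : Θ x ∈ Θ.cstar := Θ.range.le_topologicalClosure ⟨x, rfl⟩
  let b : Θ.cstar := star ⟨Θ x, hx⟩ * ⟨Θ x, hx⟩
  have hnorm : ‖b‖ = ‖Θ x‖ ^ 2 := by
    rw [CStarRing.norm_star_mul_self, sq]
    rfl
  have hb : IsSelfAdjoint b := IsSelfAdjoint.star_mul_self _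
  obtain ⟨y, hy⟩ := exists_norm_sub_eq_star_mul_self hb
  have hsquare : ((‖Θ x‖ ^ 2 : ℝ) : ℂ) • 1 - star (Θ x) * Θ x = star (y : K →L[ℂ] K) * y := by
    rw [← hnorm]
    exact congrArg (Subtype.val : Θ.cstar → (K →L[ℂ] K)) hy
  have hle := hpos y y.2
  rw [← hsquare, map_sub, map_smul, smul_eq_mul, sub_nonneg] at hle
  rwa [Θ.map_mul', Θ.map_star']

open Classical in
lemma IsRegular.apply_single_unit {Θ : StarRep C (L2Irr C)} (hΘ : IsRegular Θ) (a : Irr C) :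
    Θ (basisElt a) (lp.single 2 (Irr.unit C) (1 : ℂ)) = lp.single 2 a (1 : ℂ) :=
  lp.ext <| funext fun c => by
    rw [hΘ a (Irr.unit C) c, mult_tensor_unit, lp.single_apply, Pi.single_apply]
    split_ifs <;> simp

open Classical in
lemma IsRegular.exists_inner_apply_single_unit_eq {Θ : StarRep C (L2Irr C)} (hΘ : IsRegular Θ)
    {φ : Irr C → ℂ} (hfin : (Function.support φ).Finite) : ∃ η : L2Irr C, ∀ x : FusionAlgebra C,
      inner ℂ η (Θ x (lp.single 2 (Irr.unit C) (1 : ℂ))) = symbolFunctional φ x := by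
  let η : L2Irr C := ∑ a ∈ hfin.toFinset, lp.single 2 a (star ((catDim a.obj : ℂ) * φ a))
  have hη (a : Irr C) : η a = star ((catDim a.obj : ℂ) * φ a) := by
    simp only [η, lp.coeFn_sum, Finset.sum_apply, lp.single_apply, Pi.single_apply]
    rw [Finset.sum_ite_eq]
    split_ifs with ha
    · rfl
    · have : φ a = 0 := by simpa using ha
      simp [this]
  let Ω : (L2Irr C →L[ℂ] L2Irr C) →L[ℂ] ℂ :=
    (innerSL ℂ η).comp (ContinuousLinearMap.apply ℂ (L2Irr C) (lp.single 2 (Irr.unit C) (1 : ℂ)))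
  have hΩ : Ω.toLinearMap ∘ₗ Θ.toLinearMap = symbolFunctional φ := hom_ext fun a => by
    rw [symbolFunctional, lift_basisElt]
    change inner ℂ η (Θ (basisElt a) _) = _
    rw [hΘ.apply_single_unit, lp.inner_single_right, hη]
    simp
  exact ⟨η, LinearMap.congr_fun hΩ⟩

lemma IsRegular.symbolFunctional_le {Θ : StarRep C (L2Irr C)} (hΘ : IsRegular Θ)
    {φ : Irr C → ℂ} (hφ : IsCpMultiplier φ) (hfin : (Function.support φ).Finite)
    (x : FusionAlgebra C) :
    symbolFunctional φ (star x * x) ≤ ((‖Θ x‖ ^ 2 : ℝ) : ℂ) * φ (Irr.unit C) := by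
  classical
  obtain ⟨η, hη⟩ := hΘ.exists_inner_apply_single_unit_eq hfin
  let Ω : (L2Irr C →L[ℂ] L2Irr C) →L[ℂ] ℂ :=
    (innerSL ℂ η).comp (ContinuousLinearMap.apply ℂ (L2Irr C) (lp.single 2 (Irr.unit C) (1 : ℂ)))
  have hΩ : ∀ x, Ω (Θ x) = symbolFunctional φ x := hη
  have hΩ_one : Ω 1 = φ (Irr.unit C) := by
    have hone : Θ (basisElt (Irr.unit C)) = 1 := Θ.map_one'
    rw [← hone, hΩ, symbolFunctional, lift_basisElt, Irr.catDim_unit, Complex.ofReal_one, one_mul]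
  have hle := Θ.map_star_mul_self_le Ω (fun x => by rw [hΩ]; exact hφ.symbolFunctional_nonneg x) x
  rwa [hΩ, hΩ_one] at hle

lemma IsRegular.norm_le_of_isAmenable {Θ : StarRep C (L2Irr C)} (hΘ : IsRegular Θ)
    (hC : IsAmenable C) {π : StarRep C K} (hπ : π.IsAdmissible) (x : FusionAlgebra C) :
    ‖π x‖ ≤ ‖Θ x‖ := by
  obtain ⟨ι, _, _, _, φ, hφ, hlim⟩ := hC
  refine ContinuousLinearMap.opNorm_le_bound _ (norm_nonneg _) fun ξ => ?_
  have hbound : ∀ i, symbolFunctional (fun a => φ i a * π.coeff ξ a) (star x * x) ≤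
      ((‖Θ x‖ ^ 2 : ℝ) : ℂ) * (φ i (Irr.unit C) * π.coeff ξ (Irr.unit C)) := fun i =>
    hΘ.symbolFunctional_le (IsCpMultiplier.mul (hφ i).2 (hπ ξ))
      ((hφ i).1.subset (Function.support_mul_subset_left _ _)) x
  have htendsto : ∀ y, Filter.Tendsto
      (fun i => symbolFunctional (fun a => φ i a * π.coeff ξ a) y)
      Filter.atTop (nhds (symbolFunctional (π.coeff ξ) y)) := by
    intro y
    obtain ⟨S, r, rfl⟩ := exists_eq_sum y
    simp only [map_sum, map_smul, symbolFunctional, lift_basisElt]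
    refine tendsto_finsetSum _ fun a _ => (Filter.Tendsto.const_mul _ ?_).const_smul _
    simpa using (hlim a).mul_const (π.coeff ξ a)
  have hle := le_of_tendsto_of_tendsto' (htendsto (star x * x))
    (((hlim (Irr.unit C)).mul_const (π.coeff ξ (Irr.unit C))).const_mul _) hbound
  rw [π.symbolFunctional_coeff_star_mul, one_mul, π.coeff_unit] at hle
  have hsq : ‖π x ξ‖ ^ 2 ≤ (‖Θ x‖ * ‖ξ‖) ^ 2 := by
    rw [mul_pow]
    exact_mod_cast hle
  exact le_of_sq_le_sq hsq (by positivity)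

end Representations

section TrivialRepresentation

variable {C : Type u} [Category.{v} C] [Preadditive C] [Linear ℂ C]
  [MonoidalCategory C] [MonoidalPreadditive C] [MonoidalLinear ℂ C] [CStarTensorCategory C]

lemma trivialRep_eq_lift (x : FusionAlgebra C) :
    trivialRep x = lift (fun a => (catDim a.obj : ℂ)) x := by
  rw [lift_apply, trivialRep]
  simp only [smul_eq_mul]

lemma trivialRep_basisElt (a : Irr C) : trivialRep (basisElt a) = catDim a.obj := by
  rw [trivialRep_eq_lift, lift_basisElt]

end TrivialRepresentation

section Amenability

variable {C : Type u} [Category.{v} C] [Preadditive C] [Linear ℂ C]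
  [MonoidalCategory C] [MonoidalPreadditive C] [MonoidalLinear ℂ C] [CStarTensorCategory C]
  [RigidCStarTensorCategory C]

lemma norm_naturalHom {π : AdmissibleRep C}
    (h : ∀ (π' : AdmissibleRep C) (x : FusionAlgebra C), ‖π'.rep x‖ ≤ ‖π.rep x‖)
    (T : universalCStar C) : ‖naturalHom π T‖ = ‖T‖ := by
  have hcont : Continuous (evalHom π) :=
    (lp.evalCLM ℂ (fun π : AdmissibleRep C => π.K →L[ℂ] π.K) ∞ π).continuous
  have hT : (T : AdmissibleRep.Prod C) ∈ closure (universalRange C : Set (AdmissibleRep.Prod C)) :=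
    T.2
  refine le_antisymm
    (lp.norm_apply_le_norm ENNReal.top_ne_zero (T : AdmissibleRep.Prod C) π) ?_
  refine closure_minimal (t := {T | ‖T‖ ≤ ‖evalHom π T‖}) ?_ ?_ hT
  · rintro S ⟨x, hx⟩
    refine lp.norm_le_of_forall_le (norm_nonneg _) fun π' => ?_
    change _ ≤ ‖S π‖
    rw [hx, hx]
    exact h π' x
  · exact isClosed_le continuous_norm hcont.norm

lemma naturalHom_bijective (π : AdmissibleRep C)
    (h : ∀ (π' : AdmissibleRep C) (x : FusionAlgebra C), ‖π'.rep x‖ ≤ ‖π.rep x‖) :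
    Function.Bijective (naturalHom π) := by
  have hiso : Isometry fun T : universalCStar C => (naturalHom π T : π.K →L[ℂ] π.K) :=
    Isometry.of_dist_eq fun S T => by
      change dist (evalHom π S) (evalHom π T) = dist (S : AdmissibleRep.Prod C) T
      rw [dist_eq_norm, dist_eq_norm, ← map_sub]
      exact norm_naturalHom h (S - T)
  refine ⟨fun S T hST => hiso.injective (congrArg Subtype.val hST), fun S => ?_⟩
  have hcl : IsClosed (universalCStar C : Set (AdmissibleRep.Prod C)) :=
    (universalRange C).isClosed_topologicalClosure
  have : CompleteSpace (universalCStar C) := hcl.completeSpace_coe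
  have hrange : IsClosed (Set.range fun T : universalCStar C =>
      (naturalHom π T : π.K →L[ℂ] π.K)) := hiso.isClosedEmbedding.isClosed_range
  have hS : (S : π.K →L[ℂ] π.K) ∈ closure (π.rep.range : Set (π.K →L[ℂ] π.K)) := S.2
  obtain ⟨T, hT⟩ := closure_minimal (by
    rintro _ ⟨x, rfl⟩
    obtain ⟨T, hT⟩ := exists_universal x
    exact ⟨T, hT π⟩) hrange hS
  exact ⟨T, Subtype.ext hT⟩

lemma trivialRep_objClass (X : C) : trivialRep (objClass X) = catDim X := by
  rw [trivialRep_eq_lift, lift_objClass _ (irrDecomp X), (irrDecomp X).catDim_eq,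
    Complex.ofReal_sum]

lemma catDim_conj (X : C) : catDim (conj X) = catDim X :=
  (catDim_eq_of_pairing (conjPairing X)).symm

lemma trivialRep_mul (x y : FusionAlgebra C) :
    trivialRep (x * y) = trivialRep x * trivialRep y := by
  simp only [trivialRep_eq_lift]
  refine lift_mul (fun a b => ?_) x y
  rw [← trivialRep_eq_lift, trivialRep_objClass, catDim_tensor, Complex.ofReal_mul]

lemma trivialRep_star (x : FusionAlgebra C) : trivialRep (star x) = star (trivialRep x) := by
  simp only [trivialRep_eq_lift]
  refine lift_star (fun a => ?_) x
  rw [← trivialRep_eq_lift, trivialRep_objClass, catDim_conj, Complex.star_def,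
    Complex.conj_ofReal]

lemma trivialRep_one : trivialRep (1 : FusionAlgebra C) = 1 := by
  change trivialRep (basisElt (Irr.unit C)) = 1
  rw [trivialRep_basisElt, Irr.catDim_unit, Complex.ofReal_one]

variable (C) in
/-- The trivial representation as a representation on a one-dimensional Hilbert space. -/
def trivialStarRep : StarRep C (EuclideanSpace ℂ PUnit.{u + 1}) where
  toFun x := trivialRep x • 1
  map_add' x y := by simp only [trivialRep_eq_lift, map_add, add_smul]
  map_smul' c x := by
    simp only [trivialRep_eq_lift, map_smul, smul_eq_mul, mul_smul, RingHom.id_apply]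
  map_one' := by
    rw [trivialRep_one, one_smul]
  map_mul' x y := by
    rw [trivialRep_mul, smul_mul_smul_comm, one_mul]
  map_star' x := by
    rw [trivialRep_star, star_smul, star_one]

lemma trivialStarRep_apply (x : FusionAlgebra C) : trivialStarRep C x = trivialRep x • 1 := rfl

lemma norm_trivialStarRep (x : FusionAlgebra C) : ‖trivialStarRep C x‖ = ‖trivialRep x‖ := by
  rw [trivialStarRep_apply, norm_smul, norm_one, mul_one]

lemma trivialStarRep_isAdmissible : (trivialStarRep C).IsAdmissible := by
  intro ξ
  have hcoeff : (fun a : Irr C => ((catDim a.obj : ℝ) : ℂ)⁻¹ *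
      inner ℂ ξ (trivialStarRep C (basisElt a) ξ)) = fun _ => ((‖ξ‖ ^ 2 : ℝ) : ℂ) := by
    funext a
    have hd : (catDim a.obj : ℂ) ≠ 0 := by exact_mod_cast a.catDim_pos.ne'
    rw [trivialStarRep_apply, trivialRep_basisElt, smul_apply, inner_smul_right,
      inv_mul_cancel_left₀ hd]
    simp [inner_self_eq_norm_sq_to_K]
  rw [hcoeff]
  exact isCpMultiplier_const (Complex.zero_le_real.2 (sq_nonneg _))

variable (C) in
/-- The trivial representation as an admissible representation. -/
def trivialAdmissibleRep : AdmissibleRep C where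
  K := EuclideanSpace ℂ PUnit.{u + 1}
  rep := trivialStarRep C
  admissible := trivialStarRep_isAdmissible

lemma norm_trivialRep_le_of_injective (π : AdmissibleRep C)
    (h : Function.Injective (naturalHom π)) (x : FusionAlgebra C) : ‖trivialRep x‖ ≤ ‖π.rep x‖ := by
  obtain ⟨T, hT⟩ := exists_universal x
  have _ : IsClosed (universalCStar C : Set (AdmissibleRep.Prod C)) :=
    (universalRange C).isClosed_topologicalClosure
  have _ : IsClosed (π.rep.cstar : Set (π.K →L[ℂ] π.K)) :=
    π.rep.range.isClosed_topologicalClosure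
  calc ‖trivialRep x‖ = ‖(T : AdmissibleRep.Prod C) (trivialAdmissibleRep C)‖ := by
        rw [hT]
        exact (norm_trivialStarRep x).symm
    _ ≤ ‖T‖ := lp.norm_apply_le_norm ENNReal.top_ne_zero (T : AdmissibleRep.Prod C) _
    _ = ‖naturalHom π T‖ := (NonUnitalStarAlgHom.norm_map (naturalHom π) h T).symm
    _ = ‖π.rep x‖ := congrArg norm (hT π)

lemma IsDirectSum.objClass_eq_sum {X : C} {ι : Type*} [Fintype ι] {c : ι → Irr C}
    {p : ∀ i, (c i).obj ⟶ X} (hp : IsDirectSum p) : objClass X = ∑ i, basisElt (c i) := by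
  classical
  refine Finsupp.ext fun a => ?_
  refine (hp.mult_eq_sum a).trans ?_
  rw [show (∑ i, basisElt (c i) : FusionAlgebra C)
    = ∑ i, (Finsupp.single (c i) (1 : ℂ) : Irr C →₀ ℂ) from rfl, Finsupp.finsetSum_apply]
  refine Finset.sum_congr rfl fun i _ => ?_
  rw [Finsupp.single_apply, mult_obj]
  simp only [eq_comm (a := a)]
  split_ifs <;> simp

lemma exists_objClass_eq_one_add_sum (F : Finset (Irr C)) : ∃ X : C,
    objClass X = 1 + ∑ a ∈ F, basisElt a ∧ catDim X = 1 + ∑ a ∈ F, catDim a.obj := by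
  let c : Option F → Irr C := fun i => i.elim (Irr.unit C) Subtype.val
  obtain ⟨X, p, hp⟩ := exists_isDirectSum fun i => (c i).obj
  have hX : objClass X = 1 + ∑ a ∈ F, basisElt a := by
    rw [hp.objClass_eq_sum, Fintype.sum_option, ← Finset.sum_coe_sort F]
    rfl
  have hdim := trivialRep_objClass X
  rw [hX, trivialRep_eq_lift, map_add, map_sum, ← trivialRep_eq_lift, trivialRep_one] at hdim
  simp only [lift_basisElt] at hdim
  exact ⟨X, hX, by exact_mod_cast hdim.symm⟩

-- The unit is a summand of `conj a ⊗ a`.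
lemma Irr.one_le_catDim (a : Irr C) : 1 ≤ catDim a.obj := by
  have hunit : Irr.unit C ∈ irrSupport (conj a.obj ⊗ a.obj) := by
    by_contra hunit
    have hmult := mult_eq_zero_of_notMem subset_rfl hunit
    rw [mult_conj_tensor, mult_tensor_unit, if_pos rfl] at hmult
    exact one_ne_zero hmult
  classical
  obtain ⟨i, -, hi⟩ := Finset.mem_image.1 hunit
  have hle : catDim (Irr.unit C).obj ≤ catDim (conj a.obj ⊗ a.obj) := by
    rw [(irrDecomp (conj a.obj ⊗ a.obj)).catDim_eq, ← hi]
    exact Finset.single_le_sum (f := fun i => catDim ((irrDecomp _).irr i).obj)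
      (fun i _ => (Irr.catDim_pos _).le) (Finset.mem_univ i)
  rw [Irr.catDim_unit, catDim_tensor, catDim_conj, ← sq] at hle
  exact (one_le_sq_iff₀ a.catDim_pos.le).1 hle

lemma StarRep.IsAdmissible.norm_apply_one_add_sum_le {K : Type*} [NormedAddCommGroup K]
    [InnerProductSpace ℂ K] [CompleteSpace K] {Θ : StarRep C K} (hΘ : Θ.IsAdmissible)
    {F : Finset (Irr C)} {ζ : K} (hζ : ‖ζ‖ ≤ 1) {a : Irr C} (ha : a ∈ F) :
    ‖Θ (1 + ∑ b ∈ F, basisElt b) ζ‖ ≤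
      ‖ζ + Θ (basisElt a) ζ‖ + (∑ b ∈ F, catDim b.obj - catDim a.obj) := by
  classical
  have hsum : Θ (1 + ∑ b ∈ F, basisElt b) = 1 + ∑ b ∈ F, Θ (basisElt b) := by
    change Θ.toLinearMap _ = _
    rw [map_add, map_sum]
    exact congrArg (· + _) Θ.map_one'
  have hsplit : Θ (1 + ∑ b ∈ F, basisElt b) ζ =
      (ζ + Θ (basisElt a) ζ) + ∑ b ∈ F.erase a, Θ (basisElt b) ζ := by
    rw [hsum, add_apply, sum_apply, ← Finset.add_sum_erase F _ ha, add_assoc]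
    rfl
  rw [hsplit, ← Finset.sum_erase_eq_sub ha]
  refine (norm_add_le _ _).trans (add_le_add le_rfl ?_)
  exact norm_sum_le_of_le _ fun b _ =>
    (Θ (basisElt b)).le_of_opNorm_le_of_le (hΘ.norm_basisElt_le b) hζ |>.trans_eq (mul_one _)

-- Apply the norm condition to the sum of the unit and the elements of `F`: by rotundity, an almost
-- norming vector for the sum is almost invariant under each summand.
lemma IsRegular.exists_norm_one_sub_regularCoeff_le {Θ : StarRep C (L2Irr C)} (hΘ : IsRegular Θ)
    (h : ∀ X : C, ‖Θ (objClass X)‖ = catDim X) (F : Finset (Irr C)) {δ : ℝ} (hδ : 0 < δ) :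
    ∃ (S : Finset (Irr C)) (ξ : Irr C → ℂ), ∀ a ∈ F, ‖1 - regularCoeff S ξ a‖ ≤ δ := by
  classical
  obtain ⟨X, hX, hdim⟩ := exists_objClass_eq_one_add_sum F
  let δ' : ℝ := min 1 (δ ^ 2 / 4)
  have hδ' : 0 < δ' := lt_min one_pos (by positivity)
  obtain ⟨S, ξ, hζ, hlt⟩ := exists_sum_single_lt_norm_apply (Θ (objClass X))
    (show catDim X - δ' < ‖Θ (objClass X)‖ by rw [h]; linarith)
  refine ⟨S, ξ, fun a ha => ?_⟩
  rw [← hΘ.inner_eq_regularCoeff]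
  set ζ : L2Irr C := ∑ b ∈ S, lp.single 2 b (ξ b)
  have hnorm : ‖Θ (basisElt a) ζ‖ ≤ catDim a.obj :=
    ((Θ (basisElt a)).le_of_opNorm_le_of_le (hΘ.isAdmissible.norm_basisElt_le a) hζ.le).trans_eq
      (mul_one _)
  have hlow : 1 + catDim a.obj - δ' ≤ ‖ζ + Θ (basisElt a) ζ‖ := by
    have hle := hΘ.isAdmissible.norm_apply_one_add_sum_le hζ.le ha
    rw [← hX] at hle
    linarith
  have hclose := norm_one_sub_inv_mul_inner_sq_le a.one_le_catDim hδ'.le (min_le_left _ _) hζ.le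
    hnorm hlow
  exact le_of_sq_le_sq (by linarith [min_le_right 1 (δ ^ 2 / 4)]) hδ.le

lemma finite_support_regularCoeff (S : Finset (Irr C)) (ξ : Irr C → ℂ) :
    (Function.support (regularCoeff S ξ)).Finite := by
  obtain ⟨F, -, hF⟩ := exists_finset_irrSupport (𝟙_ C) S fun b c => c.obj ⊗ b.dual
  refine F.finite_toSet.subset fun a ha => ?_
  by_contra hne
  refine ha ?_
  rw [regularCoeff, Finset.sum_eq_zero fun b hb => Finset.sum_eq_zero fun c hc => ?_, mul_zero]
  rw [← mult_tensor_dual, mult_eq_zero_of_notMem (hF b hb c hc) hne, Nat.cast_zero, mul_zero]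

lemma IsRegular.isAmenable {Θ : StarRep C (L2Irr C)} (hΘ : IsRegular Θ)
    (h : ∀ X : C, ‖Θ (objClass X)‖ = catDim X) : IsAmenable C := by
  classical
  choose S ξ hS using fun i : Finset (Irr C) × ℕ =>
    hΘ.exists_norm_one_sub_regularCoeff_le h i.1 (δ := 1 / ((i.2 : ℝ) + 1)) (by positivity)
  refine ⟨Finset (Irr C) × ℕ, inferInstance, inferInstance, inferInstance,
    fun i => regularCoeff (S i) (ξ i), fun i => ⟨finite_support_regularCoeff _ _,
      isCpMultiplier_regularCoeff _ _⟩, fun a => ?_⟩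
  have hzero : Filter.Tendsto (fun i : Finset (Irr C) × ℕ => 1 / ((i.2 : ℝ) + 1)) Filter.atTop
      (nhds 0) := by
    rw [← Filter.prod_atTop_atTop_eq]
    exact tendsto_one_div_add_atTop_nhds_zero_nat.comp Filter.tendsto_snd
  rw [tendsto_iff_norm_sub_tendsto_zero]
  refine squeeze_zero' (Filter.Eventually.of_forall fun _ => norm_nonneg _) ?_ hzero
  filter_upwards [Filter.eventually_ge_atTop (({a} : Finset (Irr C)), 0)] with i hi
  rw [norm_sub_rev]
  exact hS i a (hi.1 (Finset.mem_singleton_self a))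

end Amenability

end CStarTensor

end

open CStarTensor in
/-- The universal *-representation `x ↦ (π(x))_π` is bounded, there is a unique *-representation
`Θ₀` given by the formula for the regular representation, it is admissible, and the four conditions
are equivalent. -/
theorem proposition5p3 (C : Type u) [Category.{v} C] [Preadditive C] [Linear ℂ C]
    [MonoidalCategory C] [MonoidalPreadditive C] [MonoidalLinear ℂ C]
    [CStarTensorCategory C] [RigidCStarTensorCategory C] :
    (∀ x : FusionAlgebra C, ∃ T : universalCStar C,
      ∀ π : AdmissibleRep C, (T : AdmissibleRep.Prod C) π = π.rep x) ∧
    (∃! Θ₀ : StarRep C (L2Irr C), IsRegular Θ₀) ∧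
    ∀ Θ₀ : StarRep C (L2Irr C), IsRegular Θ₀ →
      ∃ hΘ₀ : Θ₀.IsAdmissible,
        List.TFAE [
          IsAmenable C,
          Function.Bijective (naturalHom (AdmissibleRep.mk (L2Irr C) Θ₀ hΘ₀)),
          ∀ x : FusionAlgebra C, ‖trivialRep x‖ ≤ ‖Θ₀ x‖,
          ∀ X : C, ‖Θ₀ (objClass X)‖ = catDim X] := by
  refine ⟨exists_universal, ⟨regularRep C, isRegular_regularRep, fun Θ hΘ => hΘ.eq_regularRep⟩,
    fun Θ hΘ => ⟨hΘ.isAdmissible, ?_⟩⟩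
  tfae_have 1 → 2 := fun h => naturalHom_bijective _ fun π x =>
    hΘ.norm_le_of_isAmenable h π.admissible x
  tfae_have 2 → 3 := fun h x => norm_trivialRep_le_of_injective _ h.1 x
  tfae_have 3 → 4 := fun h X => le_antisymm (hΘ.isAdmissible.norm_objClass_le X) (by
    have hle := h (objClass X)
    rwa [trivialRep_objClass, Complex.norm_real, Real.norm_of_nonneg (catDim_nonneg X)] at hle)
  tfae_have 4 → 1 := hΘ.isAmenable
  tfae_finish
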